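/- Let $n\ge 1$, $0<s<1$, and let $\Omega\subset\mathbb R^n$ be a bounded Lipschitz domain (with polyhedral boundary, so that it can be triangulated). Let $H=H^s_0(\Omega)$ be the Hilbert space of all $v\in H^s(\mathbb R^n)$ with $v=0$ a.e. outside $\Omega$, with the norm $$\|v\|_H^2=\|v\|_{L^2(\mathbb R^n)}^2+\iint_{\mathbb R^n\times\mathbb R^n}\frac{(v(x)-v(y))^2}{|x-y|^{n+2s}}\,dy\,dx ,$$ let $H^*$ be its dual with the dual norm and pairing $\langle\cdot,\cdot\rangle$, and let $$a(u,v)=\frac{c_{n,s}}{2}\iint_{(\Omega\times\mathbb R^n)\cup(\mathbb R^n\times\Omega)}\frac{(u(x)-u(y))(v(x)-v(y))}{|x-y|^{n+2s}}\,dy\,dx,\qquad c_{n,s}=\frac{2^{2s}s\,\Gamma(\frac{n+2s}{2})}{\pi^{n/2}\Gamma(1-s)},\qquad b(\mu,v)=\langle\mu,v\rangle .$$ A triangulation of $\Omega$ is a finite conforming simplicial complex with union $\overline\Omega$; its elements are its $n$-dimensional simplices, and $h_T$ is the diameter of an element $T$. It is $\kappa$-shape-regular ($\kappa>0$) if every element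 $T$ contains a closed ball of radius $h_T/\kappa$ and $h_T\le\kappa h_{T'}$ for any two elements $T,T'$ with a common vertex (for $n\ge2$ the second condition follows from the first one up to a change of $\kappa$). For triangulations $\mathcal T_h,\mathcal T_H$ let $\mathbb V_h\subset H$ be the space of continuous functions that are affine on each element of $\mathcal T_h$ and vanish on $\partial\Omega$ (extended by zero), and let $\mathbb M_H\subset H^*$ be the space of functions that are constant on each element of $\mathcal T_H$, with $\langle\mu,v\rangle=\int_\Omega\mu v\,dx$. For $C>0$ write $H\ge Ch$ if $h_K\ge C\,h_T$ for all elements $K$ of $\mathcal T_H$ and $T$ of $\mathcal T_h$ whose interiors intersect. **Theorem.** There is a constant $C_1>0$ depending only on $n,s,\Omega$, and for each $\kappa>0$ there are constants $C_0,C_2>0$ depending only on $n,s,\Omega,\kappa$, such that the following holds. Let $\mathcal T_h,\mathcal T_H$ be $\kappa$-shape-regular triangulations of $\Omega$, let $\Lambda\subset H^*$ and $\Lambda_H\subset\mathbb M_H$ be closed and convex with $\Lambda_H\subset\Lambda$, and let $f\in H^*$, $w\in H$. Let $(u,\lambda)\in H\times\Lambda$ satisfy $$a(u,v)+b(\lambda,v)=\langle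 f,v\rangle,\qquad b(\mu-\lambda,u)\le\langle\mu-\lambda,w\rangle\qquad\text{for all }(v,\mu)\in H\times\Lambda,$$ and let $(u_h,\lambda_H)\in\mathbb V_h\times\Lambda_H$ satisfy $$a(u_h,v_h)+b(\lambda_H,v_h)=\langle f,v_h\rangle,\qquad b(\mu_H-\lambda_H,u_h)\le\langle\mu_H-\lambda_H,w\rangle\qquad\text{for all }(v_h,\mu_H)\in\mathbb V_h\times\Lambda_H.$$ Then for all $(v_h,\mu_H)\in\mathbb V_h\times\Lambda_H$ $$\|u-u_h\|_H^2\le C_1\bigl(\|u-v_h\|_H^2+\|\lambda-\mu_H\|_{H^*}^2+\|\lambda-\lambda_H\|_{H^*}^2\bigr),$$ and, if $H\ge C_0h$, $$\|\lambda-\lambda_H\|_{H^*}\le C_2\bigl(\|u-u_h\|_H+\|\lambda-\mu_H\|_{H^*}\bigr).$$ -/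

import Mathlib

open MeasureTheory

/-- The standard local-graph definition: near every boundary point, after choosing a direction `ν`,
the set is the region strictly above the graph of a Lipschitz function of the component
orthogonal to `ν`. -/
structure IsBoundedLipschitzDomain {n : ℕ} (Ω : Set (EuclideanSpace ℝ (Fin n))) : Prop where
  isOpen : IsOpen Ω
  isConnected : IsConnected Ω
  isBounded : Bornology.IsBounded Ω
  graph : ∀ z ∈ frontier Ω, ∃ r > 0, ∃ ν : EuclideanSpace ℝ (Fin n), ‖ν‖ = 1 ∧
    ∃ (L : NNReal) (φ : EuclideanSpace ℝ (Fin n) → ℝ), LipschitzWith L φ ∧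
      ∀ x ∈ Metric.ball z r, x ∈ Ω ↔ φ (x - inner ℝ x ν • ν) < inner ℝ x ν

/-- The ambient Hilbert space `L²(ℝⁿ) × L²(ℝⁿ × ℝⁿ)`, with norm `(‖v‖² + ‖g‖²)^{1/2}`. -/
abbrev FracAmbient (n : ℕ) : Type :=
  WithLp 2
    (Lp ℝ 2 (volume : Measure (EuclideanSpace ℝ (Fin n))) ×
      Lp ℝ 2 (volume : Measure (EuclideanSpace ℝ (Fin n) × EuclideanSpace ℝ (Fin n))))

/-- The fractional difference quotient `(v(x) - v(y)) / |x - y|^{(n+2s)/2}`. -/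
noncomputable def fracQuotient (n : ℕ) (s : ℝ) (v : EuclideanSpace ℝ (Fin n) → ℝ)
    (p : EuclideanSpace ℝ (Fin n) × EuclideanSpace ℝ (Fin n)) : ℝ :=
  (v p.1 - v p.2) / ‖p.1 - p.2‖ ^ (((n : ℝ) + 2 * s) / 2)

/-- The space `H = H^s_0(Ω)` of functions `v ∈ H^s(ℝⁿ)` that vanish a.e. outside `Ω`. An element is
the pair of `v ∈ L²(ℝⁿ)` and its fractional difference quotient, which has to be in `L²(ℝⁿ × ℝⁿ)`;
thus `v` alone determines the element, and the norm inherited from the ambient space is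
`‖v‖_H = (‖v‖²_{L²(ℝⁿ)} + ∬ (v(x) - v(y))² / |x - y|^{n+2s} dy dx)^{1/2}`. -/
noncomputable def fracSobolevZero (n : ℕ) (s : ℝ) (Ω : Set (EuclideanSpace ℝ (Fin n))) :
    Submodule ℝ (FracAmbient n) where
  carrier := {q | (∀ᵐ x, x ∉ Ω → q.fst x = 0) ∧
    ∀ᵐ p : EuclideanSpace ℝ (Fin n) × EuclideanSpace ℝ (Fin n),
      q.snd p = fracQuotient n s q.fst p}
  zero_mem' := by
    have h0 := Lp.coeFn_zero ℝ 2 (volume : Measure (EuclideanSpace ℝ (Fin n)))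
    have h1 := Lp.coeFn_zero ℝ 2
      (volume : Measure (EuclideanSpace ℝ (Fin n) × EuclideanSpace ℝ (Fin n)))
    refine ⟨?_, ?_⟩
    · filter_upwards [h0] with x _ _
      simp
    · filter_upwards [h1, Measure.quasiMeasurePreserving_fst.ae h0,
        Measure.quasiMeasurePreserving_snd.ae h0] with p hp ha hb
      simp only [WithLp.zero_fst, WithLp.zero_snd, fracQuotient]
      rw [hp, ha, hb]
      simp
  add_mem' := by
    rintro q r ⟨hq, hq'⟩ ⟨hr, hr'⟩
    have h0 := Lp.coeFn_add q.fst r.fst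
    have h1 := Lp.coeFn_add q.snd r.snd
    refine ⟨?_, ?_⟩
    · filter_upwards [h0, hq, hr] with x hx hqx hrx hxΩ
      simp only [WithLp.add_fst]
      rw [hx, Pi.add_apply, hqx hxΩ, hrx hxΩ, add_zero]
    · filter_upwards [h1, Measure.quasiMeasurePreserving_fst.ae h0,
        Measure.quasiMeasurePreserving_snd.ae h0, hq', hr'] with p hp ha hb hqp hrp
      simp only [WithLp.add_fst, WithLp.add_snd, fracQuotient] at *
      rw [hp, Pi.add_apply, ha, hb, hqp, hrp, Pi.add_apply, Pi.add_apply]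
      ring
  smul_mem' := by
    rintro c q ⟨hq, hq'⟩
    have h0 := Lp.coeFn_smul c q.fst
    have h1 := Lp.coeFn_smul c q.snd
    refine ⟨?_, ?_⟩
    · filter_upwards [h0, hq] with x hx hqx hxΩ
      simp only [WithLp.smul_fst]
      rw [hx, Pi.smul_apply, hqx hxΩ, smul_zero]
    · filter_upwards [h1, Measure.quasiMeasurePreserving_fst.ae h0,
        Measure.quasiMeasurePreserving_snd.ae h0, hq'] with p hp ha hb hqp
      simp only [WithLp.smul_fst, WithLp.smul_snd, fracQuotient] at *
      rw [hp, Pi.smul_apply, ha, hb, hqp, Pi.smul_apply, Pi.smul_apply]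
      simp only [smul_eq_mul]
      ring

/-- The function `ℝⁿ → ℝ` (defined up to null sets) underlying an element of `H^s_0(Ω)`. -/
noncomputable def fracSobolevFun {n : ℕ} {s : ℝ} {Ω : Set (EuclideanSpace ℝ (Fin n))}
    (v : fracSobolevZero n s Ω) : EuclideanSpace ℝ (Fin n) → ℝ :=
  (v : FracAmbient n).fst

/-- The normalization constant `c_{n,s}` of the fractional Laplacian. -/
noncomputable def fracConst (n : ℕ) (s : ℝ) : ℝ :=
  (2 : ℝ) ^ (2 * s) * s * Real.Gamma (((n : ℝ) + 2 * s) / 2) /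
    (Real.pi ^ ((n : ℝ) / 2) * Real.Gamma (1 - s))

/-- The bilinear form `a(u,v)` of the fractional Laplacian, with the double integral over
`(Ω × ℝⁿ) ∪ (ℝⁿ × Ω)`. -/
noncomputable def fracForm {n : ℕ} {s : ℝ} {Ω : Set (EuclideanSpace ℝ (Fin n))}
    (u v : fracSobolevZero n s Ω) : ℝ :=
  fracConst n s / 2 *
    ∫ p in {p : EuclideanSpace ℝ (Fin n) × EuclideanSpace ℝ (Fin n) | p.1 ∈ Ω ∨ p.2 ∈ Ω},
      (fracSobolevFun u p.1 - fracSobolevFun u p.2) * (fracSobolevFun v p.1 - fracSobolevFun v p.2) /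
        ‖p.1 - p.2‖ ^ ((n : ℝ) + 2 * s)

/-- `𝒯` is a (conforming, simplicial, finite) triangulation of `Ω`. -/
structure IsTriangulation {n : ℕ} (𝒯 : Geometry.SimplicialComplex ℝ (EuclideanSpace ℝ (Fin n)))
    (Ω : Set (EuclideanSpace ℝ (Fin n))) : Prop where
  finite : 𝒯.faces.Finite
  space_eq : 𝒯.space = closure Ω

/-- The elements of a triangulation: its `n`-dimensional simplices, given by their vertices. -/
def meshElements {n : ℕ} (𝒯 : Geometry.SimplicialComplex ℝ (EuclideanSpace ℝ (Fin n))) :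
    Set (Finset (EuclideanSpace ℝ (Fin n))) :=
  {T | T ∈ 𝒯.faces ∧ T.card = n + 1}

/-- The diameter `h_T` of the simplex with vertex set `T`. -/
noncomputable def simplexDiam {n : ℕ} (T : Finset (EuclideanSpace ℝ (Fin n))) : ℝ :=
  Metric.diam (convexHull ℝ (T : Set (EuclideanSpace ℝ (Fin n))))

/-- Shape regularity with parameter `κ`: every element contains a ball whose radius is at least the
`κ`-th part of its diameter, and elements that touch have comparable diameters. For triangulations
of Lipschitz domains in dimension `n ≥ 2` the second condition follows from the first one, up to a
change of `κ`; in dimension one it is the usual meaning of shape regularity. -/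
structure IsShapeRegular {n : ℕ} (κ : ℝ)
    (𝒯 : Geometry.SimplicialComplex ℝ (EuclideanSpace ℝ (Fin n))) : Prop where
  inball : ∀ T ∈ meshElements 𝒯, ∃ x : EuclideanSpace ℝ (Fin n),
    Metric.closedBall x (simplexDiam T / κ) ⊆ convexHull ℝ (T : Set (EuclideanSpace ℝ (Fin n)))
  neighbours : ∀ T ∈ meshElements 𝒯, ∀ T' ∈ meshElements 𝒯,
    (∃ x, x ∈ T ∧ x ∈ T') → simplexDiam T ≤ κ * simplexDiam T'

/-- The mesh condition `H ≥ C h` between local mesh sizes: wherever an element `K` of `𝒯H` and an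
element `T` of `𝒯h` overlap, `h_K ≥ C h_T`. -/
def MeshSizeGE {n : ℕ} (C : ℝ)
    (𝒯H 𝒯h : Geometry.SimplicialComplex ℝ (EuclideanSpace ℝ (Fin n))) : Prop :=
  ∀ K ∈ meshElements 𝒯H, ∀ T ∈ meshElements 𝒯h,
    (interior (convexHull ℝ (K : Set (EuclideanSpace ℝ (Fin n)))) ∩
      interior (convexHull ℝ (T : Set (EuclideanSpace ℝ (Fin n))))).Nonempty →
    C * simplexDiam T ≤ simplexDiam K

/-- The space `𝕍_h` of continuous functions that are affine on each element of the triangulation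
and vanish on the boundary (extended by zero outside `Ω`). -/
def piecewiseLinear {n : ℕ} (s : ℝ) (Ω : Set (EuclideanSpace ℝ (Fin n)))
    (𝒯 : Geometry.SimplicialComplex ℝ (EuclideanSpace ℝ (Fin n))) :
    Set (fracSobolevZero n s Ω) :=
  {v | ∃ g : EuclideanSpace ℝ (Fin n) → ℝ, Continuous g ∧ (∀ x, x ∉ Ω → g x = 0) ∧
    (∀ T ∈ meshElements 𝒯, ∃ A : EuclideanSpace ℝ (Fin n) →ᵃ[ℝ] ℝ,
      ∀ x ∈ convexHull ℝ (T : Set (EuclideanSpace ℝ (Fin n))), g x = A x) ∧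
    ∀ᵐ x, fracSobolevFun v x = g x}

/-- The space `𝕄_H` of piecewise constant functions `g` on the triangulation, regarded as a
subspace of `H*` by `⟨g, v⟩ = ∫_Ω g v`. -/
def piecewiseConstant {n : ℕ} (s : ℝ) (Ω : Set (EuclideanSpace ℝ (Fin n)))
    (𝒯 : Geometry.SimplicialComplex ℝ (EuclideanSpace ℝ (Fin n))) :
    Set (StrongDual ℝ (fracSobolevZero n s Ω)) :=
  {μ | ∃ g : EuclideanSpace ℝ (Fin n) → ℝ,
    (∀ K ∈ meshElements 𝒯, ∃ c : ℝ,
      ∀ x ∈ interior (convexHull ℝ (K : Set (EuclideanSpace ℝ (Fin n)))), g x = c) ∧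
    ∀ v : fracSobolevZero n s Ω, μ v = ∫ x in Ω, g x * fracSobolevFun v x}

/-- `(u, lam) ∈ V × Λ` solves the mixed formulation on `V × Λ` with data `f ∈ H*` and `w ∈ H`; the
bilinear form `b(μ, v)` is the duality pairing `⟨μ, v⟩`. The continuous problem is the case
`V = H`, the discrete problem the case `V = 𝕍_h` and `Λ = Λ_H ⊆ 𝕄_H`. -/
structure IsMixedSolution {n : ℕ} {s : ℝ} {Ω : Set (EuclideanSpace ℝ (Fin n))}
    (V : Set (fracSobolevZero n s Ω)) (Λ : Set (StrongDual ℝ (fracSobolevZero n s Ω)))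
    (f : StrongDual ℝ (fracSobolevZero n s Ω)) (w : fracSobolevZero n s Ω)
    (u : fracSobolevZero n s Ω) (lam : StrongDual ℝ (fracSobolevZero n s Ω)) : Prop where
  mem_space : u ∈ V
  mem_multipliers : lam ∈ Λ
  equation : ∀ v ∈ V, fracForm u v + lam v = f v
  inequality : ∀ μ ∈ Λ, (μ - lam) u ≤ (μ - lam) w

/-! The first estimate is Céa's lemma with a consistency error. The form `a` is bounded, and it is
coercive by a fractional Poincaré inequality. Subtracting the two equations gives `a(u - u_h, z) =
⟨λ_H - λ, z⟩` for `z ∈ 𝕍_h`; testing with `z = v_h - u_h` and using Young's inequality finishes the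
proof. No property of the meshes enters, so `C₁` does not depend on `κ`.

The second estimate is a discrete inf-sup argument with a Fortin operator (`exists_fortin`,
`exists_discrete_lift`). Suppose every `v ∈ H` has some `z ∈ 𝕍_h` with `‖z‖ ≤ C‖v‖` and the same
mean on every coarse element. Piecewise constant multipliers do not distinguish `v` from `z`, so
`⟨λ_H - μ_H, v⟩ = ⟨λ_H - μ_H, z⟩`, and the error equation bounds the right-hand side.

This `z` is a quasi-interpolant of `v` plus one bubble per coarse element that corrects the mean.
The nodal values are averages of `v` over balls of the local mesh size; at boundary nodes the ball
lies outside `Ω`, where the Lipschitz graph condition provides room, so the boundary condition is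
automatic. By Jensen, `(v(x) - average)² ≤ C h^{2s} ∫ (v(x) - v(y))² / |x - y|^{n+2s} dy`
(`sq_sub_average_le_gagliardoAt`). The right-hand side is the inner Gagliardo integral at the same
point `x`, so local errors add up over the elements although the seminorm is nonlocal. With an
exterior ball at the distance of `x` to the complement, the same inequality is a pointwise Hardy
inequality, which implies Poincaré.

The energy of the quasi-interpolant is bounded in `exists_gagliardo_le`: each pair `(x, y)` is
charged to the boundary distance, to a local slope, or to the interpolation error and the energy of
`v`. In each case one kernel bound, `exists_lintegral_truncKernel_le`, integrates out the other
variable. The condition `H ≥ 8κh` makes the fine elements inside a coarse element `K` small compared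
with the inball of `K`: a bubble from the fine mesh fits into `K`, and its energy is controlled by
the integral over `K` of the inner Gagliardo integral of `v`. -/

/-- Euclidean space of dimension `n`. -/
abbrev Euc (n : ℕ) : Type := EuclideanSpace ℝ (Fin n)

/-! ### The Gagliardo kernel truncated at a scale. -/

/-- The exponent `n + 2s` of the Gagliardo kernel. -/
noncomputable def kexp (n : ℕ) (s : ℝ) : ℝ := (n : ℝ) + 2 * s

theorem kexp_pos {n : ℕ} {s : ℝ} (hs0 : 0 < s) : 0 < kexp n s := by
  unfold kexp; positivity

/-- The truncated second moment `min (r²) (|t|²) / |t|^(n+2s)` of the kernel. -/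
noncomputable def truncKernel (n : ℕ) (s r t : ℝ) : ℝ := min (r ^ 2) (t ^ 2) / t ^ kexp n s

theorem truncKernel_nonneg (n : ℕ) (s r : ℝ) {t : ℝ} (ht : 0 ≤ t) : 0 ≤ truncKernel n s r t := by
  unfold truncKernel; positivity

/-- In polar coordinates the integrand is `t^{1-2s}` near `0` and `t^{-1-2s}` near infinity; the
first is integrable because `s < 1`, the second because `0 < s`. -/
theorem integrable_truncKernel_one {n : ℕ} (hn : 0 < n) {s : ℝ} (hs0 : 0 < s) (hs1 : s < 1) :
    Integrable (fun x : Euc n => truncKernel n s 1 ‖x‖) := by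
  have : Nonempty (Fin n) := ⟨⟨0, hn⟩⟩
  have : Nontrivial (Euc n) := inferInstance
  have key : IntegrableOn (fun y : ℝ => y ^ (n - 1) • truncKernel n s 1 y) (Set.Ioi 0) := by
    rw [← Set.Ioc_union_Ioi_eq_Ioi (zero_le_one' ℝ)]
    refine IntegrableOn.union ?_ ?_
    · have h1 : IntegrableOn (fun y : ℝ => y ^ (1 - 2 * s)) (Set.Ioc 0 1) := by
        rw [← intervalIntegrable_iff_integrableOn_Ioc_of_le zero_le_one]
        exact intervalIntegral.intervalIntegrable_rpow' (by linarith)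
      refine h1.congr_fun (fun y hy => ?_) measurableSet_Ioc
      have hy0 : 0 < y := hy.1
      have : min ((1 : ℝ) ^ 2) (y ^ 2) = y ^ 2 := by
        apply min_eq_right
        have := hy.2
        nlinarith
      simp only [truncKernel, smul_eq_mul, this, kexp]
      rw [← Real.rpow_natCast y (n - 1), ← Real.rpow_natCast y 2, ← Real.rpow_sub hy0,
        ← Real.rpow_add hy0]
      congr 1
      rw [Nat.cast_sub (by omega)]
      push_cast
      ring
    · have h1 : IntegrableOn (fun y : ℝ => y ^ (-1 - 2 * s)) (Set.Ioi 1) :=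
        integrableOn_Ioi_rpow_of_lt (by linarith) zero_lt_one
      refine h1.congr_fun (fun y hy => ?_) measurableSet_Ioi
      have hy1 : 1 < y := hy
      have hy0 : 0 < y := by linarith
      have : min ((1 : ℝ) ^ 2) (y ^ 2) = 1 := by
        rw [one_pow]
        apply min_eq_left
        nlinarith
      simp only [truncKernel, smul_eq_mul, this, kexp]
      rw [← Real.rpow_natCast y (n - 1), one_div, ← Real.rpow_neg hy0.le, ← Real.rpow_add hy0]
      congr 1
      rw [Nat.cast_sub (by omega)]
      push_cast
      ring
  have := integrable_fun_norm_addHaar (E := Euc n) volume (f := fun t => truncKernel n s 1 t)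
  rw [this]
  simpa using key

theorem truncKernel_scale {n : ℕ} {s r : ℝ} (hr : 0 < r) (x : Euc n) :
    truncKernel n s r ‖x‖ = r ^ (2 - kexp n s) * truncKernel n s 1 ‖r⁻¹ • x‖ := by
  have hr' : ‖r⁻¹ • x‖ = r⁻¹ * ‖x‖ := by
    rw [norm_smul, Real.norm_of_nonneg (by positivity)]
  rw [hr', truncKernel, truncKernel, Real.mul_rpow (by positivity) (norm_nonneg x),
    Real.inv_rpow hr.le, Real.rpow_sub hr]
  have h1 : min ((1 : ℝ) ^ 2) ((r⁻¹ * ‖x‖) ^ 2) = (r ^ 2)⁻¹ * min (r ^ 2) (‖x‖ ^ 2) := by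
    rw [mul_min_of_nonneg _ _ (by positivity)]
    congr 1
    · field_simp
    · field_simp
  rw [h1, show (r : ℝ) ^ (2 : ℝ) = r ^ 2 by norm_num]
  have : 0 < r ^ kexp n s := by positivity
  field_simp

/-- Rescaling to `r = 1` gives the factor `r^{2-n-2s} · r^n`. Near pairs with a slope bound and far
pairs with a size bound are both integrated by this one estimate. -/
theorem exists_lintegral_truncKernel_le {n : ℕ} (hn : 0 < n) {s : ℝ} (hs0 : 0 < s) (hs1 : s < 1) :
    ∃ C : ℝ, 0 < C ∧ ∀ r : ℝ, 0 < r → ∀ x : Euc n,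
      ∫⁻ y, ENNReal.ofReal (truncKernel n s r ‖x - y‖) ≤ ENNReal.ofReal (C * r ^ (2 - 2 * s)) := by
  have hint := integrable_truncKernel_one hn hs0 hs1
  set J := ∫ x : Euc n, truncKernel n s 1 ‖x‖
  have hJ : 0 ≤ J := integral_nonneg fun x => truncKernel_nonneg _ _ _ (norm_nonneg _)
  refine ⟨J + 1, by linarith, fun r hr x => ?_⟩
  rw [lintegral_sub_left_eq_self (fun z : Euc n => ENNReal.ofReal (truncKernel n s r ‖z‖)) x]
  have hintr : Integrable (fun x : Euc n => truncKernel n s r ‖x‖) := by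
    simp_rw [truncKernel_scale hr]
    refine Integrable.const_mul ?_ _
    exact hint.comp_smul (by positivity)
  rw [← ofReal_integral_eq_lintegral_ofReal hintr
    (Filter.Eventually.of_forall fun z => truncKernel_nonneg _ _ _ (norm_nonneg _))]
  apply ENNReal.ofReal_le_ofReal
  simp_rw [truncKernel_scale hr]
  rw [integral_const_mul, Measure.integral_comp_smul volume
    (fun z : Euc n => truncKernel n s 1 ‖z‖) r⁻¹]
  have h2 : |((r⁻¹ : ℝ) ^ Module.finrank ℝ (Euc n))⁻¹| = r ^ (n : ℝ) := by
    rw [inv_pow, inv_inv, abs_of_pos (by positivity)]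
    simp
  rw [h2, smul_eq_mul, ← mul_assoc, ← Real.rpow_add hr]
  have h3 : (2 - kexp n s + (n : ℝ)) = 2 - 2 * s := by unfold kexp; ring
  rw [h3, mul_comm]
  have : 0 < r ^ (2 - 2 * s) := by positivity
  change J * _ ≤ _
  nlinarith

/-! ### The Gagliardo seminorm and the space `H^s_0(Ω)`. -/

/-- The inner integral `∫ (v x - v y)² / |x - y|^(n+2s) dy` of the Gagliardo seminorm. -/
noncomputable def gagliardoAt {n : ℕ} (s : ℝ) (v : Euc n → ℝ) (x : Euc n) : ENNReal :=
  ∫⁻ y, ENNReal.ofReal ((v x - v y) ^ 2 / ‖x - y‖ ^ kexp n s)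

/-- The squared Gagliardo seminorm. -/
noncomputable def gagliardo {n : ℕ} (s : ℝ) (v : Euc n → ℝ) : ENNReal :=
  ∫⁻ x, gagliardoAt s v x

theorem measurable_gagliardo_integrand {n : ℕ} (s : ℝ) {v : Euc n → ℝ} (hv : Measurable v) :
    Measurable (fun p : Euc n × Euc n =>
      ENNReal.ofReal ((v p.1 - v p.2) ^ 2 / ‖p.1 - p.2‖ ^ kexp n s)) := by
  fun_prop

theorem measurable_gagliardoAt {n : ℕ} (s : ℝ) {v : Euc n → ℝ} (hv : Measurable v) :
    Measurable (gagliardoAt s v) :=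
  (measurable_gagliardo_integrand s hv).lintegral_prod_right'

theorem gagliardo_eq_lintegral_prod {n : ℕ} (s : ℝ) {v : Euc n → ℝ} (hv : Measurable v) :
    gagliardo s v = ∫⁻ p : Euc n × Euc n,
      ENNReal.ofReal ((v p.1 - v p.2) ^ 2 / ‖p.1 - p.2‖ ^ kexp n s) := by
  rw [Measure.volume_eq_prod, lintegral_prod _ (measurable_gagliardo_integrand s hv).aemeasurable]
  rfl

theorem fracQuotient_sq {n : ℕ} (s : ℝ) (v : Euc n → ℝ) (p : Euc n × Euc n) :
    fracQuotient n s v p ^ 2 = (v p.1 - v p.2) ^ 2 / ‖p.1 - p.2‖ ^ kexp n s := by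
  unfold fracQuotient kexp
  rw [div_pow, ← Real.rpow_natCast (_ ^ _) 2, ← Real.rpow_mul (norm_nonneg _)]
  congr 2
  push_cast
  ring

theorem fracQuotient_mul {n : ℕ} (s : ℝ) (u v : Euc n → ℝ) (p : Euc n × Euc n) :
    fracQuotient n s u p * fracQuotient n s v p =
      (u p.1 - u p.2) * (v p.1 - v p.2) / ‖p.1 - p.2‖ ^ ((n : ℝ) + 2 * s) := by
  unfold fracQuotient
  rw [div_mul_div_comm, ← sq, ← Real.rpow_natCast (_ ^ _) 2, ← Real.rpow_mul (norm_nonneg _)]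
  congr 2
  push_cast
  ring

theorem ofReal_norm_sq_Lp_two {α : Type*} [MeasurableSpace α] {μ : Measure α} (f : Lp ℝ 2 μ) :
    ENNReal.ofReal (‖f‖ ^ 2) = ∫⁻ x, ENNReal.ofReal (f x ^ 2) ∂μ := by
  rw [← real_inner_self_eq_norm_sq, L2.inner_def]
  have h := L2.integrable_inner (𝕜 := ℝ) f f
  have he : (fun x => inner ℝ (f x) (f x)) = fun x => f x ^ 2 := by
    funext x
    rw [real_inner_self_eq_norm_sq, Real.norm_eq_abs, sq_abs]
  rw [he] at h ⊢
  exact ofReal_integral_eq_lintegral_ofReal h (Filter.Eventually.of_forall fun x => sq_nonneg _)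

theorem gagliardo_congr_ae {n : ℕ} (s : ℝ) {u v : Euc n → ℝ} (h : u =ᵐ[volume] v) :
    gagliardo s u = gagliardo s v := by
  refine lintegral_congr_ae ?_
  filter_upwards [h] with x hx
  refine lintegral_congr_ae ?_
  filter_upwards [h] with y hy
  rw [hx, hy]

section SobolevSpace

variable {n : ℕ} {s : ℝ} {Ω : Set (EuclideanSpace ℝ (Fin n))}

theorem measurable_fracSobolevFun (v : fracSobolevZero n s Ω) : Measurable (fracSobolevFun v) :=
  (Lp.stronglyMeasurable _).measurable

theorem fracSobolevFun_ae_zero (v : fracSobolevZero n s Ω) :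
    ∀ᵐ x, x ∉ Ω → fracSobolevFun v x = 0 := v.2.1

theorem memLp_fracSobolevFun (v : fracSobolevZero n s Ω) : MemLp (fracSobolevFun v) 2 volume :=
  Lp.memLp _

theorem snd_ae_eq (v : fracSobolevZero n s Ω) :
    (v : FracAmbient n).snd =ᵐ[volume] fracQuotient n s (fracSobolevFun v) := v.2.2

theorem ofReal_norm_snd_sq (v : fracSobolevZero n s Ω) :
    ENNReal.ofReal (‖(v : FracAmbient n).snd‖ ^ 2) = gagliardo s (fracSobolevFun v) := by
  rw [ofReal_norm_sq_Lp_two, gagliardo_eq_lintegral_prod s (measurable_fracSobolevFun v)]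
  refine lintegral_congr_ae ?_
  filter_upwards [snd_ae_eq v] with p hp
  rw [hp, fracQuotient_sq]

theorem ofReal_norm_sq_fracSobolevZero (v : fracSobolevZero n s Ω) :
    ENNReal.ofReal (‖v‖ ^ 2) =
      (∫⁻ x, ENNReal.ofReal (fracSobolevFun v x ^ 2)) + gagliardo s (fracSobolevFun v) := by
  rw [← ofReal_norm_snd_sq, ← Submodule.norm_coe, WithLp.prod_norm_sq_eq_of_L2,
    ENNReal.ofReal_add (sq_nonneg _) (sq_nonneg _), ofReal_norm_sq_Lp_two]
  rfl

theorem memLp_two_of_lintegral_sq_lt_top {α : Type*} [MeasurableSpace α] {μ : Measure α}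
    {f : α → ℝ} (hf : Measurable f) (h : ∫⁻ x, ENNReal.ofReal (f x ^ 2) ∂μ < ⊤) :
    MemLp f 2 μ := by
  rw [memLp_two_iff_integrable_sq hf.aestronglyMeasurable]
  refine ⟨(hf.pow_const 2).aestronglyMeasurable, ?_⟩
  rw [hasFiniteIntegral_iff_ofReal (Filter.Eventually.of_forall fun x => sq_nonneg _)]
  exact h

/-- The way from functions back to the Hilbert space: functions constructed on the mesh enter `H`
through a bound on their energy. -/
theorem exists_fracSobolevZero_of_energy {g : Euc n → ℝ} (hg : Measurable g)
    (hΩ : ∀ x, x ∉ Ω → g x = 0) {C : ℝ} (hC : 0 ≤ C)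
    (h : (∫⁻ x, ENNReal.ofReal (g x ^ 2)) + gagliardo s g ≤ ENNReal.ofReal C) :
    ∃ v : fracSobolevZero n s Ω, fracSobolevFun v =ᵐ[volume] g ∧ ‖v‖ ^ 2 ≤ C := by
  have hfin := h.trans_lt ENNReal.ofReal_lt_top
  have h1 : MemLp g 2 volume :=
    memLp_two_of_lintegral_sq_lt_top hg (lt_of_le_of_lt le_self_add hfin)
  have hqm : Measurable (fracQuotient n s g) := by unfold fracQuotient; fun_prop
  have h2 : MemLp (fracQuotient n s g) 2 volume := by
    refine memLp_two_of_lintegral_sq_lt_top hqm ?_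
    simp_rw [fracQuotient_sq]
    rw [← gagliardo_eq_lintegral_prod s hg]
    exact lt_of_le_of_lt le_add_self hfin
  have e1 := h1.coeFn_toLp
  have e2 := h2.coeFn_toLp
  let q : FracAmbient n := WithLp.toLp 2 (h1.toLp g, h2.toLp _)
  have hq : q ∈ fracSobolevZero n s Ω := by
    refine ⟨?_, ?_⟩
    · filter_upwards [e1] with x hx hxΩ
      exact hx.trans (hΩ x hxΩ)
    · filter_upwards [e2, Measure.quasiMeasurePreserving_fst.ae e1,
        Measure.quasiMeasurePreserving_snd.ae e1] with p hp ha hb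
      refine hp.trans ?_
      change _ = (h1.toLp g p.1 - h1.toLp g p.2) / _
      rw [ha, hb]
      rfl
  refine ⟨⟨q, hq⟩, e1, ?_⟩
  have := ofReal_norm_sq_fracSobolevZero (⟨q, hq⟩ : fracSobolevZero n s Ω)
  have ea : fracSobolevFun (⟨q, hq⟩ : fracSobolevZero n s Ω) =ᵐ[volume] g := e1
  rw [gagliardo_congr_ae s ea, lintegral_congr_ae (g := fun x => ENNReal.ofReal (g x ^ 2))
    (by filter_upwards [ea] with x hx; rw [hx])] at this
  rw [← this] at h
  exact (ENNReal.ofReal_le_ofReal_iff hC).1 h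

/-- If both points lie outside `Ω`, the differences vanish, so the integral extends to the whole
product space and becomes an inner product of the second components. -/
theorem fracForm_eq (u v : fracSobolevZero n s Ω) :
    fracForm u v =
      fracConst n s / 2 * inner ℝ (u : FracAmbient n).snd (v : FracAmbient n).snd := by
  unfold fracForm
  congr 1
  rw [L2.inner_def, setIntegral_eq_integral_of_ae_compl_eq_zero]
  · refine integral_congr_ae ?_
    filter_upwards [snd_ae_eq u, snd_ae_eq v] with p hu hv
    rw [hu, hv, ← fracQuotient_mul]
    simp [mul_comm]
  · filter_upwards [Measure.quasiMeasurePreserving_fst.ae (fracSobolevFun_ae_zero u),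
      Measure.quasiMeasurePreserving_snd.ae (fracSobolevFun_ae_zero u)] with p h1 h2 hp
    simp only [not_or] at hp
    rw [h1 hp.1, h2 hp.2]
    simp

theorem fracConst_pos (hs0 : 0 < s) (hs1 : s < 1) : 0 < fracConst n s := by
  unfold fracConst
  have h1 : 0 < Real.Gamma (((n : ℝ) + 2 * s) / 2) := Real.Gamma_pos_of_pos (by positivity)
  have h2 : 0 < Real.Gamma (1 - s) := Real.Gamma_pos_of_pos (by linarith)
  positivity

theorem norm_fracSobolevZero_snd_le (u : fracSobolevZero n s Ω) : ‖(u : FracAmbient n).snd‖ ≤ ‖u‖ :=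
  WithLp.norm_snd_le (x := (u : FracAmbient n))

theorem abs_fracForm_le (hs0 : 0 < s) (hs1 : s < 1) (u v : fracSobolevZero n s Ω) :
    |fracForm u v| ≤ fracConst n s / 2 * (‖u‖ * ‖v‖) := by
  have hc := fracConst_pos (n := n) hs0 hs1
  rw [fracForm_eq, abs_mul, abs_of_pos (by positivity)]
  gcongr
  exact (abs_real_inner_le_norm _ _).trans
    (mul_le_mul (norm_fracSobolevZero_snd_le u) (norm_fracSobolevZero_snd_le v) (norm_nonneg _) (norm_nonneg _))

theorem fracForm_sub_left (u u' v : fracSobolevZero n s Ω) :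
    fracForm (u - u') v = fracForm u v - fracForm u' v := by
  simp only [fracForm_eq, Submodule.coe_sub, WithLp.sub_snd, inner_sub_left]
  ring

theorem fracForm_sub_right (u v v' : fracSobolevZero n s Ω) :
    fracForm u (v - v') = fracForm u v - fracForm u v' := by
  simp only [fracForm_eq, Submodule.coe_sub, WithLp.sub_snd, inner_sub_right]
  ring

end SobolevSpace

/-! ### Comparing a value of a function with its average over a ball. -/

theorem setLIntegral_sq_sub_le_gagliardoAt {n : ℕ} {s : ℝ} (hs0 : 0 < s) (v : Euc n → ℝ)
    (x : Euc n) {B : Set (Euc n)} (hB : MeasurableSet B) {D : ℝ}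
    (hD : ∀ y ∈ B, ‖x - y‖ ≤ D) :
    ∫⁻ y in B, ENNReal.ofReal ((v x - v y) ^ 2) ≤
      ENNReal.ofReal (D ^ kexp n s) * gagliardoAt s v x := by
  rw [gagliardoAt, ← lintegral_const_mul' _ _ ENNReal.ofReal_ne_top]
  refine le_trans ?_ (setLIntegral_le_lintegral B _)
  refine setLIntegral_mono' hB fun y hy => ?_
  have hD0 : 0 ≤ D := (norm_nonneg _).trans (hD y hy)
  rw [← ENNReal.ofReal_mul (by positivity)]
  apply ENNReal.ofReal_le_ofReal
  rcases eq_or_ne x y with rfl | hxy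
  · simp
  have h0 : 0 < ‖x - y‖ := norm_pos_iff.2 (sub_ne_zero.2 hxy)
  have h1 : ‖x - y‖ ^ kexp n s ≤ D ^ kexp n s :=
    Real.rpow_le_rpow h0.le (hD y hy) (kexp_pos hs0).le
  have h2 : 0 < ‖x - y‖ ^ kexp n s := by positivity
  rw [mul_div_assoc', le_div_iff₀ h2, mul_comm]
  gcongr

/-- The volume of the unit ball. -/
noncomputable def unitBallVol (n : ℕ) : ℝ := (volume (Metric.ball (0 : Euc n) 1)).toReal

theorem unitBallVol_pos (n : ℕ) : 0 < unitBallVol n :=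
  ENNReal.toReal_pos (Metric.measure_ball_pos _ _ one_pos).ne' measure_ball_lt_top.ne

theorem volume_ball_eq {n : ℕ} (b : Euc n) {ρ : ℝ} (hρ : 0 < ρ) :
    volume (Metric.ball b ρ) = ENNReal.ofReal (unitBallVol n * ρ ^ n) := by
  rw [Measure.addHaar_ball_of_pos _ _ hρ, finrank_euclideanSpace, Fintype.card_fin, unitBallVol,
    ENNReal.ofReal_mul ENNReal.toReal_nonneg, ENNReal.ofReal_toReal measure_ball_lt_top.ne,
    mul_comm]

/-- Jensen for the convex function `t ↦ (v x - t)²`, followed by the lower bound `D^{-(n+2s)}` for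
the kernel on the ball. The ball need not contain `x`, which permits balls outside the domain. -/
theorem sq_sub_average_le_gagliardoAt {n : ℕ} {s : ℝ} (hs0 : 0 < s) {v : Euc n → ℝ}
    (hv : MemLp v 2 volume) (x b : Euc n) {ρ D : ℝ} (hρ : 0 < ρ)
    (hD : ∀ y ∈ Metric.ball b ρ, ‖x - y‖ ≤ D) :
    ENNReal.ofReal ((v x - ⨍ y in Metric.ball b ρ, v y) ^ 2) ≤
      ENNReal.ofReal (D ^ kexp n s / (unitBallVol n * ρ ^ n)) * gagliardoAt s v x := by
  have hvol := volume_ball_eq b hρ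
  have hω := unitBallVol_pos n
  have hpos : 0 < unitBallVol n * ρ ^ n := by positivity
  have hD0 : 0 ≤ D := (norm_nonneg _).trans (hD b (Metric.mem_ball_self hρ))
  have hfin : IsFiniteMeasure (volume.restrict (Metric.ball b ρ)) :=
    ⟨by rw [Measure.restrict_apply_univ]; exact measure_ball_lt_top⟩
  have hne : NeZero (volume.restrict (Metric.ball b ρ)) := by
    refine ⟨fun h => ?_⟩
    rw [Measure.restrict_eq_zero, hvol, ENNReal.ofReal_eq_zero] at h
    linarith
  have hvB : MemLp v 2 (volume.restrict (Metric.ball b ρ)) := hv.restrict _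
  have hint : Integrable v (volume.restrict (Metric.ball b ρ)) :=
    hvB.integrable (by norm_num)
  have hsq : Integrable (fun y => (v x - v y) ^ 2) (volume.restrict (Metric.ball b ρ)) :=
    ((memLp_const (v x)).sub hvB).integrable_sq
  have hconv : ConvexOn ℝ Set.univ (fun t : ℝ => (v x - t) ^ 2) := by
    have h := (even_two.convexOn_pow (𝕜 := ℝ)).comp_affineMap
      (AffineMap.const ℝ ℝ (v x) - AffineMap.id ℝ ℝ)
    exact h
  have hJ := hconv.map_average_le (f := v) (μ := volume.restrict (Metric.ball b ρ))
    (by fun_prop) isClosed_univ (by simp) hint hsq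
  refine (ENNReal.ofReal_le_ofReal hJ).trans ?_
  have hreal : volume.real (Metric.ball b ρ) = unitBallVol n * ρ ^ n := by
    rw [Measure.real, hvol, ENNReal.toReal_ofReal hpos.le]
  rw [setAverage_eq, hreal, smul_eq_mul, ENNReal.ofReal_mul (by positivity),
    div_eq_inv_mul, ENNReal.ofReal_mul (by positivity), mul_assoc]
  gcongr
  rw [ofReal_integral_eq_lintegral_ofReal]
  · exact setLIntegral_sq_sub_le_gagliardoAt hs0 v x Metric.isOpen_ball.measurableSet hD
  · exact hsq
  · exact Filter.Eventually.of_forall fun y => sq_nonneg _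

/-! ### Exterior balls of Lipschitz domains, Hardy and Poincaré inequalities. -/

section Domain

variable {n : ℕ} {Ω : Set (EuclideanSpace ℝ (Fin n))}

/-- Near every boundary point the complement contains balls of comparable size. -/
theorem IsBoundedLipschitzDomain.exists_local_exterior_ball (hΩ : IsBoundedLipschitzDomain Ω)
    {z : Euc n} (hz : z ∈ frontier Ω) :
    ∃ r > 0, ∃ θ > 0, ∃ t₀ > 0, ∀ p ∈ frontier Ω ∩ Metric.ball z r, ∀ t, 0 < t → t ≤ t₀ →
      ∃ b, ∀ y ∈ Metric.ball b (θ * t), y ∉ Ω ∧ dist y p ≤ 2 * t := by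
  obtain ⟨r, hr, ν, hν, L, φ, hφ, hgraph⟩ := hΩ.graph z hz
  have hL : (0 : ℝ) ≤ L := L.2
  -- The ball is centred at `p` moved by `t` below the graph. A perturbation `w` changes the height
  -- by at most `‖w‖` and the graph value by at most `2L‖w‖`, and `(1 + 2L)‖w‖ < t`. With `r/2` and
  -- `r/4` all points stay in the ball where the graph describes `Ω`.
  refine ⟨r / 2, by positivity, 1 / (1 + 2 * L), by positivity, r / 4, by positivity,
    fun p hp t ht ht' => ⟨p - t • ν, fun y hy => ?_⟩⟩
  obtain ⟨w, rfl⟩ : ∃ w, y = p - t • ν + w := ⟨y - (p - t • ν), by abel⟩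
  have hw : ‖w‖ < 1 / (1 + 2 * L) * t := by simpa [dist_eq_norm] using hy
  have hw2 : (1 + 2 * L) * ‖w‖ < t := by
    rw [one_div, inv_mul_eq_div, lt_div_iff₀ (by positivity)] at hw
    linarith
  have hw3 : ‖w‖ < t := by nlinarith [norm_nonneg w]
  have hdist : dist (p - t • ν + w) p ≤ 2 * t := by
    rw [dist_eq_norm]
    calc ‖p - t • ν + w - p‖ = ‖w - t • ν‖ := by congr 1; abel
      _ ≤ ‖w‖ + ‖t • ν‖ := norm_sub_le _ _
      _ = ‖w‖ + t := by rw [norm_smul, hν, mul_one, Real.norm_of_nonneg ht.le]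
      _ ≤ 2 * t := by linarith
  refine ⟨fun hmem => ?_, hdist⟩
  have hpz : dist p z < r / 2 := hp.2
  have hp' : p ∉ Ω := by
    have := hp.1.2
    rwa [hΩ.isOpen.interior_eq] at this
  have h1 : inner ℝ p ν ≤ φ (p - inner ℝ p ν • ν) := by
    by_contra! h
    exact hp' ((hgraph p (by rw [Metric.mem_ball]; linarith)).2 h)
  have h2 := (hgraph (p - t • ν + w) (by
    rw [Metric.mem_ball]
    have := dist_triangle (p - t • ν + w) p z
    linarith)).1 hmem
  have hνν : inner ℝ ν ν = (1 : ℝ) := by rw [real_inner_self_eq_norm_sq, hν, one_pow]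
  have hin : inner ℝ (p - t • ν + w) ν = inner ℝ p ν - t + inner ℝ w ν := by
    rw [inner_add_left, inner_sub_left, real_inner_smul_left, hνν, mul_one]
  have hwν : |inner ℝ w ν| ≤ ‖w‖ := by
    have := abs_real_inner_le_norm w ν
    rwa [hν, mul_one] at this
  have h3 := hφ.dist_le_mul (p - t • ν + w - inner ℝ (p - t • ν + w) ν • ν)
    (p - inner ℝ p ν • ν)
  have h4 : dist (p - t • ν + w - inner ℝ (p - t • ν + w) ν • ν) (p - inner ℝ p ν • ν) ≤
      2 * ‖w‖ := by
    rw [dist_eq_norm, hin]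
    calc _ = ‖w - inner ℝ w ν • ν‖ := by congr 1; module
      _ ≤ ‖w‖ + ‖inner ℝ w ν • ν‖ := norm_sub_le _ _
      _ ≤ ‖w‖ + ‖w‖ := by
        rw [norm_smul, hν, mul_one, Real.norm_eq_abs]; linarith
      _ = 2 * ‖w‖ := by ring
  rw [Real.dist_eq] at h3
  have h5 := (abs_le.1 h3).1
  have h6 := (abs_le.1 hwν).2
  rw [hin] at h2
  have h7 : (L : ℝ) * dist (p - t • ν + w - inner ℝ (p - t • ν + w) ν • ν)
      (p - inner ℝ p ν • ν) ≤ L * (2 * ‖w‖) := by gcongr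
  rw [hin] at h5 h7
  nlinarith

theorem IsBoundedLipschitzDomain.isCompact_frontier (hΩ : IsBoundedLipschitzDomain Ω) :
    IsCompact (frontier Ω) :=
  Metric.isCompact_of_isClosed_isBounded isClosed_frontier
    (hΩ.isBounded.closure.subset frontier_subset_closure)

/-- The exterior ball (corkscrew) property at all scales up to `R`. -/
theorem IsBoundedLipschitzDomain.exists_exterior_ball (hΩ : IsBoundedLipschitzDomain Ω)
    {R : ℝ} (hR : 0 < R) :
    ∃ θ > 0, ∀ p ∈ frontier Ω, ∀ t, 0 < t → t ≤ R →
      ∃ b, ∀ y ∈ Metric.ball b (θ * t), y ∉ Ω ∧ dist y p ≤ 2 * t := by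
  have key : ∃ θ > 0, ∃ t₀ > 0, ∀ p ∈ frontier Ω, ∀ t, 0 < t → t ≤ t₀ →
      ∃ b, ∀ y ∈ Metric.ball b (θ * t), y ∉ Ω ∧ dist y p ≤ 2 * t := by
    refine hΩ.isCompact_frontier.induction_on (p := fun A => ∃ θ > 0, ∃ t₀ > 0, ∀ p ∈ A, ∀ t,
      0 < t → t ≤ t₀ → ∃ b, ∀ y ∈ Metric.ball b (θ * t), y ∉ Ω ∧ dist y p ≤ 2 * t) ?_ ?_ ?_ ?_
    · exact ⟨1, one_pos, 1, one_pos, fun p hp => absurd hp (Set.notMem_empty p)⟩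
    · rintro A B hAB ⟨θ, hθ, t₀, ht₀, h⟩
      exact ⟨θ, hθ, t₀, ht₀, fun p hp => h p (hAB hp)⟩
    · rintro A B ⟨θ, hθ, t₀, ht₀, h⟩ ⟨θ', hθ', t₀', ht₀', h'⟩
      refine ⟨min θ θ', lt_min hθ hθ', min t₀ t₀', lt_min ht₀ ht₀', ?_⟩
      rintro p (hp | hp) t ht htt
      · obtain ⟨b, hb⟩ := h p hp t ht (htt.trans (min_le_left _ _))
        exact ⟨b, fun y hy => hb y (Metric.ball_subset_ball
          (by gcongr; exact min_le_left _ _) hy)⟩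
      · obtain ⟨b, hb⟩ := h' p hp t ht (htt.trans (min_le_right _ _))
        exact ⟨b, fun y hy => hb y (Metric.ball_subset_ball
          (by gcongr; exact min_le_right _ _) hy)⟩
    · intro z hz
      obtain ⟨r, hr, θ, hθ, t₀, ht₀, h⟩ := hΩ.exists_local_exterior_ball hz
      exact ⟨frontier Ω ∩ Metric.ball z r,
        Filter.inter_mem self_mem_nhdsWithin (mem_nhdsWithin_of_mem_nhds (Metric.ball_mem_nhds z hr)),
        θ, hθ, t₀, ht₀, h⟩
  obtain ⟨θ, hθ, t₀, ht₀, h⟩ := key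
  -- Scales between `t₀` and `R` are treated by shrinking every `t` by the factor `min 1 (t₀ / R)`.
  have hm : 0 < min 1 (t₀ / R) := by positivity
  refine ⟨θ * min 1 (t₀ / R), by positivity, fun p hp t ht htR => ?_⟩
  obtain ⟨b, hb⟩ := h p hp (min 1 (t₀ / R) * t) (by positivity) (by
    calc min 1 (t₀ / R) * t ≤ t₀ / R * R := by gcongr; exact min_le_right _ _
      _ = t₀ := by field_simp)
  refine ⟨b, fun y hy => ?_⟩
  rw [mul_assoc] at hy
  obtain ⟨h1, h2⟩ := hb y hy
  refine ⟨h1, h2.trans ?_⟩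
  have : min 1 (t₀ / R) * t ≤ 1 * t := by gcongr; exact min_le_left _ _
  linarith

/-- A boundary point in the interior of `closure Ω` would have exterior balls inside `closure Ω`.
Triangulations only cover `closure Ω`; this puts the interiors of their elements into `Ω` itself. -/
theorem IsBoundedLipschitzDomain.interior_closure_subset (hΩ : IsBoundedLipschitzDomain Ω) :
    interior (closure Ω) ⊆ Ω := by
  intro z hz
  by_contra hzΩ
  have hzf : z ∈ frontier Ω := ⟨interior_subset hz, fun h => hzΩ (interior_subset h)⟩
  obtain ⟨ε, hε, hball⟩ := Metric.isOpen_iff.1 isOpen_interior z hz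
  obtain ⟨θ, hθ, h⟩ := hΩ.exists_exterior_ball (R := ε / 4) (by positivity)
  obtain ⟨b, hb⟩ := h z hzf (ε / 4) (by positivity) le_rfl
  have hbb : b ∈ Metric.ball b (θ * (ε / 4)) := Metric.mem_ball_self (by positivity)
  have hbc : b ∈ closure Ω := interior_subset (hball (by
    rw [Metric.mem_ball]; linarith [(hb b hbb).2]))
  obtain ⟨y, hy, hyΩ⟩ := mem_closure_iff.1 hbc _ Metric.isOpen_ball hbb
  exact (hb y hy).1 hyΩ

theorem IsBoundedLipschitzDomain.compl_nonempty (hn : 0 < n) (hΩ : IsBoundedLipschitzDomain Ω) :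
    Ωᶜ.Nonempty := by
  have : Nonempty (Fin n) := ⟨⟨0, hn⟩⟩
  rw [Set.nonempty_compl]
  rintro rfl
  exact NormedSpace.unbounded_univ ℝ (EuclideanSpace ℝ (Fin n)) hΩ.isBounded

theorem IsBoundedLipschitzDomain.exists_dist_bound (hΩ : IsBoundedLipschitzDomain Ω) :
    ∃ R : ℝ, 0 < R ∧ ∀ x ∈ closure Ω, ∀ y ∈ closure Ω, dist x y ≤ R := by
  obtain ⟨C, hC⟩ := Metric.isBounded_iff.1 hΩ.isBounded.closure
  exact ⟨max C 1, by positivity, fun x hx y hy => (hC hx hy).trans (le_max_left _ _)⟩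

theorem infDist_compl_pos (hn : 0 < n) (hΩ : IsBoundedLipschitzDomain Ω) {x : Euc n}
    (hx : x ∈ Ω) : 0 < Metric.infDist x Ωᶜ := by
  rw [← hΩ.isOpen.isClosed_compl.notMem_iff_infDist_pos (hΩ.compl_nonempty hn)]
  simpa using hx

theorem ball_infDist_compl_subset (x : Euc n) : Metric.ball x (Metric.infDist x Ωᶜ) ⊆ Ω := by
  intro y hy
  by_contra h
  have := Metric.infDist_le_dist_of_mem (x := x) (s := Ωᶜ) h
  rw [Metric.mem_ball, dist_comm] at hy
  linarith

theorem exists_frontier_dist_eq (hn : 0 < n) (hΩ : IsBoundedLipschitzDomain Ω) {x : Euc n}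
    (hx : x ∈ Ω) : ∃ p ∈ frontier Ω, dist x p = Metric.infDist x Ωᶜ := by
  obtain ⟨p, hp, hpd⟩ := hΩ.isOpen.isClosed_compl.exists_infDist_eq_dist (hΩ.compl_nonempty hn) x
  refine ⟨p, ⟨?_, fun h => hp (interior_subset h)⟩, hpd.symm⟩
  have h1 : p ∈ closure (Metric.ball x (Metric.infDist x Ωᶜ)) := by
    rw [closure_ball _ (infDist_compl_pos hn hΩ hx).ne', Metric.mem_closedBall, dist_comm]
    exact hpd.symm.le
  exact closure_mono (ball_infDist_compl_subset x) h1

/-- Pointwise form of the fractional Hardy inequality. -/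
theorem exists_hardy (hn : 0 < n) (hΩ : IsBoundedLipschitzDomain Ω) {s : ℝ} (hs0 : 0 < s) :
    ∃ C : ℝ, 0 < C ∧ ∀ v : Euc n → ℝ, MemLp v 2 volume → (∀ x, x ∉ Ω → v x = 0) → ∀ x ∈ Ω,
      ENNReal.ofReal (v x ^ 2) ≤
        ENNReal.ofReal (C * Metric.infDist x Ωᶜ ^ (2 * s)) * gagliardoAt s v x := by
  obtain ⟨R, hR, hRd⟩ := hΩ.exists_dist_bound
  obtain ⟨θ, hθ, hext⟩ := hΩ.exists_exterior_ball hR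
  have hω := unitBallVol_pos n
  refine ⟨3 ^ kexp n s / (unitBallVol n * θ ^ n), by positivity, fun v hv hv0 x hx => ?_⟩
  obtain ⟨p, hp, hpd⟩ := exists_frontier_dist_eq hn hΩ hx
  have hd := infDist_compl_pos hn hΩ hx
  set d := Metric.infDist x Ωᶜ
  obtain ⟨b, hb⟩ := hext p hp d hd
    (hpd ▸ hRd x (subset_closure hx) p (frontier_subset_closure hp))
  -- The ball is exterior, at the scale `d` of the distance to the nearest boundary point `p`, so
  -- the average of `v` over it is zero. Also `|x - y| ≤ |x - p| + |p - y| ≤ d + 2d`.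
  have h := sq_sub_average_le_gagliardoAt (s := s) (D := 3 * d) hs0 hv x b (ρ := θ * d)
    (by positivity) (fun y hy => by
      have := dist_triangle_right x y p
      rw [← dist_eq_norm]
      linarith [(hb y hy).2])
  have h0 : ⨍ y in Metric.ball b (θ * d), v y = 0 := by
    rw [setAverage_eq, setIntegral_eq_zero_of_forall_eq_zero fun y hy => hv0 y (hb y hy).1,
      smul_zero]
  rw [h0, sub_zero] at h
  refine h.trans_eq ?_
  congr 2
  rw [Real.mul_rpow (by norm_num) hd.le, mul_pow]
  have : d ^ kexp n s = d ^ n * d ^ (2 * s) := by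
    rw [kexp, Real.rpow_add hd, Real.rpow_natCast]
  rw [this]
  field_simp

theorem exists_poincare (hn : 0 < n) (hΩ : IsBoundedLipschitzDomain Ω) {s : ℝ} (hs0 : 0 < s) :
    ∃ C : ℝ, 0 < C ∧ ∀ v : Euc n → ℝ, MemLp v 2 volume → (∀ x, x ∉ Ω → v x = 0) →
      ∫⁻ x, ENNReal.ofReal (v x ^ 2) ≤ ENNReal.ofReal C * gagliardo s v := by
  obtain ⟨R, hR, hRd⟩ := hΩ.exists_dist_bound
  obtain ⟨C, hC, h⟩ := exists_hardy hn hΩ hs0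
  refine ⟨C * R ^ (2 * s), by positivity, fun v hv hv0 => ?_⟩
  rw [gagliardo, ← lintegral_const_mul' _ _ ENNReal.ofReal_ne_top]
  refine lintegral_mono fun x => ?_
  by_cases hx : x ∈ Ω
  · refine (h v hv hv0 x hx).trans ?_
    obtain ⟨p, hp, hpd⟩ := exists_frontier_dist_eq hn hΩ hx
    have := hRd x (subset_closure hx) p (frontier_subset_closure hp)
    gcongr
    · exact Metric.infDist_nonneg
    · exact hpd ▸ this
  · simp [hv0 x hx]

end Domain

/-! ### Lipschitz bounds along segments through finitely many pieces. -/

/-- A one-sided Lipschitz bound along a segment covered by finitely many closed pieces. -/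
theorem sub_le_of_segment_subset_iUnion {E ι : Type*} [NormedAddCommGroup E] [NormedSpace ℝ E]
    (I : Finset ι) (C : ι → Set E) {f : E → ℝ} {x y : E} {L : ℝ}
    (hf : ContinuousOn f (segment ℝ x y)) (hC : ∀ i ∈ I, IsClosed (C i))
    (hcov : ∀ p ∈ segment ℝ x y, ∃ i ∈ I, p ∈ C i)
    (hL : ∀ i ∈ I, ∀ p ∈ C i, ∀ q ∈ C i, |f p - f q| ≤ L * ‖p - q‖) :
    f y - f x ≤ L * ‖x - y‖ := by
  set γ : ℝ → E := fun t => x + t • (y - x) with hγ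
  have hγc : Continuous γ := by fun_prop
  have hseg : ∀ t ∈ Set.Icc (0 : ℝ) 1, γ t ∈ segment ℝ x y := fun t ht => by
    rw [segment_eq_image']
    exact ⟨t, ht, rfl⟩
  have h := image_le_of_liminf_slope_right_le_deriv_boundary (f := fun t => f (γ t))
    (a := 0) (b := 1) (B := fun t => f x + t * (L * ‖x - y‖)) (B' := fun _ => L * ‖x - y‖)
    (hf.comp hγc.continuousOn hseg) (by simp [hγ]) (by fun_prop)
    (fun t _ => (by
      simpa using ((hasDerivAt_id t).mul_const (L * ‖x - y‖)).const_add (f x) :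
        HasDerivAt _ _ t).hasDerivWithinAt) ?_ (x := 1) (by simp)
  · simp only [hγ, one_smul, one_mul, add_sub_cancel] at h
    linarith
  intro t ht r hr
  have hev : ∀ᶠ z in nhdsWithin t (Set.Ioi t), z ∈ Set.Ioo t 1 := Ioo_mem_nhdsGT ht.2
  -- By pigeonhole one of the finitely many pieces contains points of the segment arbitrarily close
  -- to the right of `t`; being closed, it also contains `γ t`. Along these points the slope is
  -- bounded, and a lower right derivative bound is enough. No ordering of the pieces is needed.
  have hfreq : ∃ i ∈ I, ∃ᶠ z in nhdsWithin t (Set.Ioi t), γ z ∈ C i := by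
    by_contra! hcon
    have hall : ∀ᶠ z in nhdsWithin t (Set.Ioi t), ∀ i ∈ I, γ z ∉ C i :=
      (Filter.eventually_all_finset I).2 fun i hi => hcon i hi
    obtain ⟨z, hz, hz'⟩ := (hall.and hev).exists
    obtain ⟨i, hi, hiz⟩ := hcov (γ z) (hseg z ⟨by linarith [ht.1, hz'.1], hz'.2.le⟩)
    exact hz i hi hiz
  obtain ⟨i, hi, hfr⟩ := hfreq
  have hti : γ t ∈ C i := by
    have hcl : IsClosed (γ ⁻¹' C i) := (hC i hi).preimage hγc
    exact hcl.mem_of_frequently_of_tendsto hfr (Filter.tendsto_id.mono_left nhdsWithin_le_nhds)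
  refine (hfr.and_eventually hev).mono fun z hz => ?_
  have hzt : 0 < z - t := sub_pos.2 hz.2.1
  have h1 := (le_abs_self _).trans (hL i hi _ hz.1 _ hti)
  have h2 : ‖γ z - γ t‖ = (z - t) * ‖x - y‖ := by
    have : γ z - γ t = (z - t) • (y - x) := by simp only [hγ]; module
    rw [this, norm_smul, Real.norm_of_nonneg hzt.le, norm_sub_rev]
  rw [slope_def_field, div_lt_iff₀ hzt]
  rw [h2] at h1
  nlinarith

theorem abs_sub_le_of_segment_subset_iUnion {E ι : Type*} [NormedAddCommGroup E]
    [NormedSpace ℝ E] (I : Finset ι) (C : ι → Set E) {f : E → ℝ} {x y : E} {L : ℝ}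
    (hf : ContinuousOn f (segment ℝ x y)) (hC : ∀ i ∈ I, IsClosed (C i))
    (hcov : ∀ p ∈ segment ℝ x y, ∃ i ∈ I, p ∈ C i)
    (hL : ∀ i ∈ I, ∀ p ∈ C i, ∀ q ∈ C i, |f p - f q| ≤ L * ‖p - q‖) :
    |f x - f y| ≤ L * ‖x - y‖ := by
  rw [abs_sub_le_iff]
  refine ⟨?_, sub_le_of_segment_subset_iUnion I C hf hC hcov hL⟩
  have := sub_le_of_segment_subset_iUnion I C (f := fun p => - f p) hf.neg hC hcov
    (fun i hi p hp q hq => by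
      rw [← abs_neg]
      convert hL i hi p hp q hq using 2
      ring)
  linarith

/-! ### Simplices and triangulations. -/

/-- The closed simplex with vertex set `T`. -/
abbrev simplexHull {n : ℕ} (T : Finset (EuclideanSpace ℝ (Fin n))) :
    Set (EuclideanSpace ℝ (Fin n)) :=
  convexHull ℝ (T : Set (EuclideanSpace ℝ (Fin n)))

section Simplex

variable {n : ℕ} {T : Finset (Euc n)}

theorem isCompact_simplexHull (T : Finset (Euc n)) : IsCompact (simplexHull T) :=
  T.finite_toSet.isCompact_convexHull ℝ

theorem isClosed_simplexHull (T : Finset (Euc n)) : IsClosed (simplexHull T) :=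
  (isCompact_simplexHull T).isClosed

theorem mem_simplexHull_of_mem {z : Euc n} (hz : z ∈ T) : z ∈ simplexHull T :=
  subset_convexHull ℝ _ hz

theorem dist_le_simplexDiam {x y : Euc n} (hx : x ∈ simplexHull T) (hy : y ∈ simplexHull T) :
    dist x y ≤ simplexDiam T :=
  Metric.dist_le_diam_of_mem (isCompact_simplexHull T).isBounded hx hy

/-- A convex function on a simplex is bounded by a vertex value. The constant `c` is arbitrary, so
this gives oscillation bounds, uniqueness from vertex values and interpolation errors. -/
theorem exists_vertex_abs_sub_le (A : Euc n →ᵃ[ℝ] ℝ) (c : ℝ) {x : Euc n}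
    (hx : x ∈ simplexHull T) : ∃ z ∈ T, |A x - c| ≤ |A z - c| := by
  have hconv : ConvexOn ℝ Set.univ (fun p => |A p - c|) := by
    refine ⟨convex_univ, fun p _ q _ a b ha hb hab => ?_⟩
    have h1 : A (a • p + b • q) - c = a * (A p - c) + b * (A q - c) := by
      rw [Convex.combo_affine_apply hab, smul_eq_mul, smul_eq_mul]
      linear_combination c * hab
    simp only [h1, smul_eq_mul]
    refine (abs_add_le _ _).trans ?_
    rw [abs_mul, abs_mul, abs_of_nonneg ha, abs_of_nonneg hb]
  exact hconv.exists_ge_of_mem_convexHull (Set.subset_univ _) hx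

theorem abs_sub_le_of_vertices (A : Euc n →ᵃ[ℝ] ℝ) {D : ℝ}
    (hD : ∀ z ∈ T, ∀ z' ∈ T, |A z - A z'| ≤ D) {x y : Euc n}
    (hx : x ∈ simplexHull T) (hy : y ∈ simplexHull T) : |A x - A y| ≤ D := by
  obtain ⟨z, hz, h1⟩ := exists_vertex_abs_sub_le A (A y) hx
  obtain ⟨z', hz', h2⟩ := exists_vertex_abs_sub_le A (A z) hy
  exact h1.trans (by rw [abs_sub_comm]; exact h2.trans (hD z' hz' z hz))

theorem AffineMap.eqOn_simplexHull {A B : Euc n →ᵃ[ℝ] ℝ} (h : ∀ z ∈ T, A z = B z) {x : Euc n}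
    (hx : x ∈ simplexHull T) : A x = B x := by
  obtain ⟨z, hz, h1⟩ := exists_vertex_abs_sub_le (A - B) 0 hx
  have h2 : (A - B) z = 0 := by simp [h z hz]
  rw [h2, sub_zero, sub_zero, abs_zero] at h1
  have h3 := abs_nonpos_iff.1 h1
  simpa [sub_eq_zero] using h3

/-- An affine function of oscillation at most `D` on a ball of radius `ρ` has slope at most
`D / ρ`. -/
theorem AffineMap.abs_sub_le_of_ball (A : Euc n →ᵃ[ℝ] ℝ) {c : Euc n} {ρ D : ℝ} (hρ : 0 < ρ)
    (hD : ∀ p ∈ Metric.closedBall c ρ, ∀ q ∈ Metric.closedBall c ρ, |A p - A q| ≤ D)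
    (x y : Euc n) : |A x - A y| ≤ D / ρ * ‖x - y‖ := by
  rcases eq_or_ne x y with rfl | hxy
  · simp
  have h0 : 0 < ‖x - y‖ := norm_pos_iff.2 (sub_ne_zero.2 hxy)
  have h1 := hD (c + (ρ / ‖x - y‖) • (x - y)) (by
    rw [Metric.mem_closedBall, dist_eq_norm, add_sub_cancel_left, norm_smul, norm_div, norm_norm,
      Real.norm_of_nonneg hρ.le, div_mul_cancel₀ _ h0.ne']) c (Metric.mem_closedBall_self hρ.le)
  have h2 : A (c + (ρ / ‖x - y‖) • (x - y)) - A c = (ρ / ‖x - y‖) * (A x - A y) := by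
    have e1 : A (c + (ρ / ‖x - y‖) • (x - y)) - A c = A.linear ((ρ / ‖x - y‖) • (x - y)) := by
      rw [add_comm, ← vadd_eq_add, A.map_vadd, vadd_eq_add, add_sub_cancel_right]
    have e2 : A x - A y = A.linear (x - y) := by
      have := A.linearMap_vsub x y
      simpa using this.symm
    rw [e1, e2, map_smul, smul_eq_mul]
  rw [h2, abs_mul, abs_of_pos (by positivity)] at h1
  rw [div_mul_eq_mul_div, div_le_iff₀ h0] at h1
  rw [div_mul_eq_mul_div, le_div_iff₀ hρ]
  linarith

theorem volume_simplexHull_eq_zero (hT : T.card ≤ n) : volume (simplexHull T) = 0 := by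
  rcases T.eq_empty_or_nonempty with rfl | hne
  · simp [simplexHull]
  refine measure_mono_null (convexHull_subset_affineSpan _)
    (Measure.addHaar_affineSubspace _ _ fun h => ?_)
  have hcard : T.card = (T.card - 1) + 1 := (Nat.sub_add_cancel hne.card_pos).symm
  have h1 := finrank_vectorSpan_image_finset_le ℝ (id : Euc n → Euc n) T hcard
  rw [Finset.image_id, ← direction_affineSpan, h, AffineSubspace.direction_top, finrank_top,
    finrank_euclideanSpace, Fintype.card_fin] at h1
  have := hne.card_pos
  omega

end Simplex

section Mesh

variable {n : ℕ} {Ω : Set (EuclideanSpace ℝ (Fin n))}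
  {𝒯 : Geometry.SimplicialComplex ℝ (EuclideanSpace ℝ (Fin n))}

theorem affineSpan_meshElement {T : Finset (Euc n)} (hT : T ∈ meshElements 𝒯) :
    affineSpan ℝ (T : Set (Euc n)) = ⊤ := by
  have h := (𝒯.indep hT.1).affineSpan_eq_top_iff_card_eq_finrank_add_one
  rw [Subtype.range_coe] at h
  exact h.2 (by simpa using hT.2)

theorem interior_simplexHull_nonempty {T : Finset (Euc n)} (hT : T ∈ meshElements 𝒯) :
    (interior (simplexHull T)).Nonempty :=
  interior_convexHull_nonempty_iff_affineSpan_eq_top.2 (affineSpan_meshElement hT)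

theorem exists_affineMap_eq_on_vertices {T : Finset (Euc n)} (hT : T ∈ meshElements 𝒯)
    (a : Euc n → ℝ) : ∃ A : Euc n →ᵃ[ℝ] ℝ, ∀ z ∈ T, A z = a z := by
  classical
  let b : AffineBasis T ℝ (Euc n) := ⟨Subtype.val, 𝒯.indep hT.1, by
    rw [Subtype.range_coe]; exact affineSpan_meshElement hT⟩
  refine ⟨∑ i : T, a i • b.coord i, fun z hz => ?_⟩
  have h1 : ∀ i : T, b.coord i z = if i = ⟨z, hz⟩ then 1 else 0 := fun i =>
    b.coord_apply i ⟨z, hz⟩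
  have h2 : (∑ i : T, a i • b.coord i) z = ∑ i : T, a i * b.coord i z := by
    have : ∀ I : Finset T, (∑ i ∈ I, a i • b.coord i) z = ∑ i ∈ I, a i * b.coord i z := by
      intro I
      induction I using Finset.induction_on with
      | empty => simp
      | insert i I hi ih =>
        rw [Finset.sum_insert hi, Finset.sum_insert hi, AffineMap.coe_add, Pi.add_apply, ih]
        simp
    exact this _
  rw [h2]
  simp [h1]

theorem simplexDiam_pos (hn : 0 < n) {T : Finset (Euc n)} (hT : T ∈ meshElements 𝒯) :
    0 < simplexDiam T := by
  obtain ⟨z, hz, z', hz', hne⟩ := Finset.one_lt_card.1 (by rw [hT.2]; omega : 1 < T.card)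
  exact (dist_pos.2 hne).trans_le
    (dist_le_simplexDiam (mem_simplexHull_of_mem hz) (mem_simplexHull_of_mem hz'))

/-- By conformity the intersection is contained in the hull of the common vertices, and distinct
elements share at most `n` of them. -/
theorem volume_inter_simplexHull {T T' : Finset (Euc n)} (hT : T ∈ meshElements 𝒯)
    (hT' : T' ∈ meshElements 𝒯) (hne : T ≠ T') :
    volume (simplexHull T ∩ simplexHull T') = 0 := by
  classical
  refine measure_mono_null (𝒯.inter_subset_convexHull hT.1 hT'.1) ?_
  rw [← Finset.coe_inter]
  refine volume_simplexHull_eq_zero ?_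
  by_contra! h
  have h1 : T ∩ T' = T := Finset.eq_of_subset_of_card_le Finset.inter_subset_left
    (by rw [hT.2]; exact h)
  have h2 : T ∩ T' = T' := Finset.eq_of_subset_of_card_le Finset.inter_subset_right
    (by rw [hT'.2]; exact h)
  exact hne (h1.symm.trans h2)

theorem disjoint_interior_simplexHull {T T' : Finset (Euc n)} (hT : T ∈ meshElements 𝒯)
    (hT' : T' ∈ meshElements 𝒯) (hne : T ≠ T') :
    Disjoint (interior (simplexHull T)) (interior (simplexHull T')) := by
  rw [Set.disjoint_iff_inter_eq_empty]
  by_contra h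
  have hne' := Set.nonempty_iff_ne_empty.2 h
  refine ((isOpen_interior.inter isOpen_interior).measure_pos volume hne').ne' ?_
  exact measure_mono_null (Set.inter_subset_inter interior_subset interior_subset)
    (volume_inter_simplexHull hT hT' hne)

theorem volume_diff_interior_simplexHull (T : Finset (Euc n)) :
    volume (simplexHull T \ interior (simplexHull T)) = 0 := by
  have h := (convex_convexHull ℝ (T : Set (Euc n))).addHaar_frontier volume
  rwa [frontier, (isClosed_simplexHull T).closure_eq] at h

theorem interior_simplexHull_ae_eq (T : Finset (Euc n)) :
    interior (simplexHull T) =ᵐ[volume] simplexHull T :=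
  interior_subset.eventuallyLE.antisymm
    (ae_le_set.2 (volume_diff_interior_simplexHull T))

namespace IsTriangulation

/-- The elements of a triangulation as a `Finset`. -/
noncomputable def elements (h : IsTriangulation 𝒯 Ω) : Finset (Finset (Euc n)) :=
  (h.finite.subset (fun _ hT => hT.1 : meshElements 𝒯 ⊆ 𝒯.faces)).toFinset

theorem mem_elements (h : IsTriangulation 𝒯 Ω) {T : Finset (Euc n)} :
    T ∈ h.elements ↔ T ∈ meshElements 𝒯 := by
  simp [elements]

theorem simplexHull_subset (h : IsTriangulation 𝒯 Ω) {T : Finset (Euc n)}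
    (hT : T ∈ meshElements 𝒯) : simplexHull T ⊆ closure Ω := by
  rw [← h.space_eq]
  exact 𝒯.convexHull_subset_space hT.1

/-- The complex may contain faces that belong to no element, but they have at most `n` vertices and
form a null set. The part of `Ω` missed by the elements is open and null, hence empty; the union of
the elements is closed and so contains `closure Ω`. -/
theorem exists_mem_element (h : IsTriangulation 𝒯 Ω) (hΩ : IsOpen Ω) {x : Euc n}
    (hx : x ∈ closure Ω) : ∃ T ∈ meshElements 𝒯, x ∈ simplexHull T := by
  set U : Set (Euc n) := ⋃ T ∈ h.elements, simplexHull T with hU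
  have hUc : IsClosed U := isClosed_biUnion_finset fun T _ => isClosed_simplexHull T
  have hsub : Ω \ U ⊆ ⋃ T ∈ h.finite.toFinset.filter (fun T => T.card ≤ n), simplexHull T := by
    rintro y ⟨hy, hyU⟩
    have hys : y ∈ 𝒯.space := by rw [h.space_eq]; exact subset_closure hy
    obtain ⟨T, hT, hyT⟩ := 𝒯.mem_space_iff.1 hys
    have hcard : T.card ≤ n + 1 := by
      have := (𝒯.indep hT).card_le_finrank_succ
      have h2 : Module.finrank ℝ (vectorSpan ℝ (Set.range (Subtype.val : T → Euc n))) ≤ n := by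
        refine (Submodule.finrank_le _).trans ?_
        simp
      simp only [Fintype.card_coe] at this
      omega
    have hlt : T.card ≤ n := by
      by_contra! hlt
      refine hyU (Set.mem_biUnion (h.mem_elements.2 ⟨hT, by omega⟩) hyT)
    simp only [Set.mem_iUnion, Finset.mem_filter, Set.Finite.mem_toFinset]
    exact ⟨T, ⟨hT, hlt⟩, hyT⟩
  have hnull : volume (Ω \ U) = 0 := by
    refine measure_mono_null hsub ((measure_biUnion_null_iff (Finset.countable_toSet _)).2 ?_)
    intro T hT
    simp only [Finset.coe_filter, Set.mem_ofPred_eq] at hT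
    exact volume_simplexHull_eq_zero hT.2
  have hemp : Ω \ U = ∅ := by
    by_contra hne
    exact ((hΩ.sdiff hUc).measure_pos volume (Set.nonempty_iff_ne_empty.2 hne)).ne' hnull
  have hΩU : Ω ⊆ U := by rwa [Set.sdiff_eq_empty] at hemp
  have hxU := closure_minimal hΩU hUc hx
  simp only [hU, Set.mem_iUnion] at hxU
  obtain ⟨T, hT, hxT⟩ := hxU
  exact ⟨T, h.mem_elements.1 hT, hxT⟩

theorem sum_setLIntegral_le (h : IsTriangulation 𝒯 Ω) (f : Euc n → ENNReal) :
    ∑ T ∈ h.elements, ∫⁻ x in simplexHull T, f x ≤ ∫⁻ x, f x := by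
  have h1 : ∀ T ∈ h.elements, ∫⁻ x in simplexHull T, f x =
      ∫⁻ x in interior (simplexHull T), f x := fun T _ =>
    (setLIntegral_congr (interior_simplexHull_ae_eq T)).symm
  rw [Finset.sum_congr rfl h1, ← lintegral_biUnion_finset]
  · exact setLIntegral_le_lintegral _ _
  · intro T hT T' hT' hne
    exact disjoint_interior_simplexHull (h.mem_elements.1 hT) (h.mem_elements.1 hT') hne
  · exact fun T _ => isOpen_interior.measurableSet

end IsTriangulation

end Mesh

/-! ### Hat functions, interpolation and mesh functions. -/

section MeshInterpolation

variable {n : ℕ} {Ω : Set (EuclideanSpace ℝ (Fin n))} {κ : ℝ}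
  {𝒯 : Geometry.SimplicialComplex ℝ (EuclideanSpace ℝ (Fin n))}

theorem IsShapeRegular.abs_affine_sub_le (hκ : IsShapeRegular κ 𝒯) (hκ0 : 0 < κ) (hn : 0 < n)
    {T : Finset (Euc n)} (hT : T ∈ meshElements 𝒯) (A : Euc n →ᵃ[ℝ] ℝ) {D : ℝ}
    (hD : ∀ z ∈ T, ∀ z' ∈ T, |A z - A z'| ≤ D) (x y : Euc n) :
    |A x - A y| ≤ κ * D / simplexDiam T * ‖x - y‖ := by
  obtain ⟨c, hc⟩ := hκ.inball T hT
  have hd := simplexDiam_pos hn hT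
  have h := A.abs_sub_le_of_ball (c := c) (ρ := simplexDiam T / κ) (D := D) (by positivity)
    (fun p hp q hq => abs_sub_le_of_vertices A hD (hc hp) (hc hq)) x y
  have e : D / (simplexDiam T / κ) = κ * D / simplexDiam T := by field_simp
  rwa [e] at h

namespace IsTriangulation

theorem exists_hat (h : IsTriangulation 𝒯 Ω) (hΩ : IsOpen Ω) (a : Euc n → ℝ) :
    ∃ g : Euc n → ℝ, ContinuousOn g (closure Ω) ∧ (∀ x, x ∉ closure Ω → g x = 0) ∧
      ∀ T ∈ meshElements 𝒯, ∃ A : Euc n →ᵃ[ℝ] ℝ, (∀ z ∈ T, A z = a z) ∧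
        ∀ x ∈ simplexHull T, g x = A x := by
  classical
  have hA : ∀ T : Finset (Euc n), ∃ A : Euc n →ᵃ[ℝ] ℝ, T ∈ meshElements 𝒯 → ∀ z ∈ T, A z = a z := by
    intro T
    by_cases hT : T ∈ meshElements 𝒯
    · obtain ⟨A, hA⟩ := exists_affineMap_eq_on_vertices hT a
      exact ⟨A, fun _ => hA⟩
    · exact ⟨0, fun h => absurd h hT⟩
  choose A hA using hA
  have hel : ∀ x : Euc n, ∃ T : Finset (Euc n), x ∈ closure Ω →
      T ∈ meshElements 𝒯 ∧ x ∈ simplexHull T := by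
    intro x
    by_cases hx : x ∈ closure Ω
    · obtain ⟨T, hT⟩ := h.exists_mem_element hΩ hx
      exact ⟨T, fun _ => hT⟩
    · exact ⟨∅, fun h => absurd h hx⟩
  choose τ hτ using hel
  let g : Euc n → ℝ := fun x => if x ∈ closure Ω then A (τ x) x else 0
  have hg : ∀ T ∈ meshElements 𝒯, ∀ x ∈ simplexHull T, g x = A T x := by
    intro T hT x hx
    have hxΩ := h.simplexHull_subset hT hx
    obtain ⟨h1, h2⟩ := hτ x hxΩ
    simp only [g, if_pos hxΩ]
    -- The value does not depend on the element chosen at `x`: two elements meet in the hull of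
    -- their common vertices, where both affine maps agree.
    have h3 := 𝒯.inter_subset_convexHull h1.1 hT.1 ⟨h2, hx⟩
    rw [← Finset.coe_inter] at h3
    refine AffineMap.eqOn_simplexHull (fun z hz => ?_) h3
    rw [Finset.mem_inter] at hz
    rw [hA _ h1 z hz.1, hA _ hT z hz.2]
  refine ⟨g, ?_, fun x hx => by simp [g, hx], fun T hT => ⟨A T, hA T hT, hg T hT⟩⟩
  have hcov : closure Ω = ⋃ T : h.elements, simplexHull (T : Finset (Euc n)) := by
    ext x
    simp only [Set.mem_iUnion]
    constructor
    · intro hx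
      obtain ⟨T, hT, hxT⟩ := h.exists_mem_element hΩ hx
      exact ⟨⟨T, h.mem_elements.2 hT⟩, hxT⟩
    · rintro ⟨T, hT⟩
      exact h.simplexHull_subset (h.mem_elements.1 T.2) hT
  rw [hcov]
  refine (locallyFinite_of_finite _).continuousOn_iUnion (fun T => isClosed_simplexHull _)
    fun T => ?_
  exact (AffineMap.continuous_of_finiteDimensional (A T)).continuousOn.congr
    fun x hx => hg T (h.mem_elements.1 T.2) x hx

/-- The hat function of the vertex `z`. -/
noncomputable def hat (h : IsTriangulation 𝒯 Ω) (hΩ : IsOpen Ω) (z : Euc n) : Euc n → ℝ :=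
  (h.exists_hat hΩ (Set.indicator {z} fun _ => 1)).choose

theorem continuousOn_hat (h : IsTriangulation 𝒯 Ω) (hΩ : IsOpen Ω) (z : Euc n) :
    ContinuousOn (h.hat hΩ z) (closure Ω) :=
  (h.exists_hat hΩ (Set.indicator {z} fun _ => 1)).choose_spec.1

theorem hat_eq_zero_of_notMem (h : IsTriangulation 𝒯 Ω) (hΩ : IsOpen Ω) (z : Euc n) {x : Euc n}
    (hx : x ∉ closure Ω) : h.hat hΩ z x = 0 :=
  (h.exists_hat hΩ (Set.indicator {z} fun _ => 1)).choose_spec.2.1 x hx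

theorem exists_affine_eq_hat (h : IsTriangulation 𝒯 Ω) (hΩ : IsOpen Ω) (z : Euc n)
    {T : Finset (Euc n)} (hT : T ∈ meshElements 𝒯) : ∃ A : Euc n →ᵃ[ℝ] ℝ,
      (∀ y ∈ T, A y = Set.indicator {z} (fun _ => (1 : ℝ)) y) ∧
        ∀ x ∈ simplexHull T, h.hat hΩ z x = A x :=
  (h.exists_hat hΩ (Set.indicator {z} fun _ => 1)).choose_spec.2.2 T hT

/-- The vertices of the elements. -/
noncomputable def nodes (h : IsTriangulation 𝒯 Ω) : Finset (Euc n) :=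
  (h.elements.finite_toSet.biUnion fun T _ => T.finite_toSet).toFinset

theorem mem_nodes (h : IsTriangulation 𝒯 Ω) {T : Finset (Euc n)} (hT : T ∈ meshElements 𝒯)
    {z : Euc n} (hz : z ∈ T) : z ∈ h.nodes := by
  rw [nodes, Set.Finite.mem_toFinset]
  exact Set.mem_biUnion (Finset.mem_coe.2 (h.mem_elements.2 hT)) hz

/-- The piecewise affine interpolant with the vertex values `a`. -/
noncomputable def interp (h : IsTriangulation 𝒯 Ω) (hΩ : IsOpen Ω) (a : Euc n → ℝ) (x : Euc n) :
    ℝ := ∑ z ∈ h.nodes, a z * h.hat hΩ z x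

theorem continuousOn_interp (h : IsTriangulation 𝒯 Ω) (hΩ : IsOpen Ω) (a : Euc n → ℝ) :
    ContinuousOn (h.interp hΩ a) (closure Ω) := by
  exact continuousOn_finsetSum _ fun z _ => continuousOn_const.mul (h.continuousOn_hat hΩ z)

theorem interp_eq_zero_of_notMem (h : IsTriangulation 𝒯 Ω) (hΩ : IsOpen Ω) (a : Euc n → ℝ)
    {x : Euc n} (hx : x ∉ closure Ω) : h.interp hΩ a x = 0 := by
  refine Finset.sum_eq_zero fun z _ => ?_
  rw [h.hat_eq_zero_of_notMem hΩ z hx, mul_zero]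

theorem exists_affine_eq_interp (h : IsTriangulation 𝒯 Ω) (hΩ : IsOpen Ω) (a : Euc n → ℝ)
    {T : Finset (Euc n)} (hT : T ∈ meshElements 𝒯) :
    ∃ A : Euc n →ᵃ[ℝ] ℝ, (∀ z ∈ T, A z = a z) ∧ ∀ x ∈ simplexHull T, h.interp hΩ a x = A x := by
  classical
  have hA := fun z => h.exists_affine_eq_hat hΩ z hT
  choose A hA hA' using hA
  have hsum : ∀ (I : Finset (Euc n)) x, (∑ z ∈ I, a z • A z) x = ∑ z ∈ I, a z * A z x := by
    intro I x
    induction I using Finset.induction_on with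
    | empty => simp
    | insert i I hi ih =>
      rw [Finset.sum_insert hi, Finset.sum_insert hi, AffineMap.coe_add, Pi.add_apply, ih]
      simp
  refine ⟨∑ z ∈ h.nodes, a z • A z, fun y hy => ?_, fun x hx => ?_⟩
  · rw [hsum, Finset.sum_eq_single y]
    · simp [hA y y hy]
    · intro z _ hzy
      rw [hA z y hy, Set.indicator_of_notMem (by simpa using hzy.symm), mul_zero]
    · exact fun hy' => absurd (h.mem_nodes hT hy) hy'
  · rw [hsum, interp]
    exact Finset.sum_congr rfl fun z _ => by rw [hA' z x hx]

theorem exists_vertex_interp (h : IsTriangulation 𝒯 Ω) (hΩ : IsOpen Ω) (a : Euc n → ℝ)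
    {T : Finset (Euc n)} (hT : T ∈ meshElements 𝒯) (c : ℝ) {x : Euc n} (hx : x ∈ simplexHull T) :
    ∃ z ∈ T, |h.interp hΩ a x - c| ≤ |a z - c| := by
  obtain ⟨A, hA, hA'⟩ := h.exists_affine_eq_interp hΩ a hT
  obtain ⟨z, hz, h1⟩ := exists_vertex_abs_sub_le A c hx
  exact ⟨z, hz, by rw [hA' x hx, ← hA z hz]; exact h1⟩

theorem interp_eq_of_vertices (h : IsTriangulation 𝒯 Ω) (hΩ : IsOpen Ω) {a : Euc n → ℝ}
    {T : Finset (Euc n)} (hT : T ∈ meshElements 𝒯) {c : ℝ} (hc : ∀ z ∈ T, a z = c)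
    {x : Euc n} (hx : x ∈ simplexHull T) : h.interp hΩ a x = c := by
  obtain ⟨z, hz, h1⟩ := h.exists_vertex_interp hΩ a hT c hx
  rw [hc z hz, sub_self, abs_zero] at h1
  exact sub_eq_zero.1 (abs_nonpos_iff.1 h1)

theorem abs_interp_sub_le (h : IsTriangulation 𝒯 Ω) (hΩ : IsOpen Ω) (hκ : IsShapeRegular κ 𝒯)
    (hκ0 : 0 < κ) (hn : 0 < n) {a : Euc n → ℝ} {T : Finset (Euc n)} (hT : T ∈ meshElements 𝒯)
    {D : ℝ} (hD : ∀ z ∈ T, ∀ z' ∈ T, |a z - a z'| ≤ D) {x y : Euc n}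
    (hx : x ∈ simplexHull T) (hy : y ∈ simplexHull T) :
    |h.interp hΩ a x - h.interp hΩ a y| ≤ κ * D / simplexDiam T * ‖x - y‖ := by
  obtain ⟨A, hA, hA'⟩ := h.exists_affine_eq_interp hΩ a hT
  rw [hA' x hx, hA' y hy]
  exact hκ.abs_affine_sub_le hκ0 hn hT A (fun z hz z' hz' => by
    rw [hA z hz, hA z' hz']; exact hD z hz z' hz') x y

/-- Points reached from `T` by a short segment inside the domain lie in elements touching `T`. -/
theorem exists_touching_element (h : IsTriangulation 𝒯 Ω) (hΩ : IsOpen Ω)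
    (hκ : IsShapeRegular κ 𝒯) (hκ0 : 0 < κ) (hn : 0 < n) {T : Finset (Euc n)}
    (hT : T ∈ meshElements 𝒯) {x y : Euc n} (hx : x ∈ simplexHull T)
    (hseg : segment ℝ x y ⊆ closure Ω) (hxy : ‖x - y‖ ≤ simplexDiam T / (2 * κ ^ 2)) :
    ∀ p ∈ segment ℝ x y, ∃ T' ∈ meshElements 𝒯, p ∈ simplexHull T' ∧ ∃ z, z ∈ T ∧ z ∈ T' := by
  classical
  intro p hp
  have hd := simplexDiam_pos hn hT
  -- The interpolant of the indicator of the vertices of `T` is `1` on `T`, vanishes on elements not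
  -- touching `T`, and has slope at most `κ² / h_T`. On a segment of length at most `h_T / (2κ²)`
  -- starting in `T` it stays above `1/2`, so the segment meets no element away from `T`.
  set a : Euc n → ℝ := fun z => if z ∈ T then 1 else 0 with ha
  have hsub : segment ℝ x p ⊆ segment ℝ x y :=
    (convex_segment x y).segment_subset (left_mem_segment ℝ x y) hp
  have hsub' := hsub.trans hseg
  have hosc : ∀ z z', |a z - a z'| ≤ 1 := fun z z' => by
    simp only [ha]
    split_ifs <;> simp
  have hLip : ∀ T' ∈ h.elements, ∀ q ∈ simplexHull T', ∀ r ∈ simplexHull T',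
      |h.interp hΩ a q - h.interp hΩ a r| ≤ κ ^ 2 / simplexDiam T * ‖q - r‖ := by
    intro T' hT' q hq r hr
    have hT'm := h.mem_elements.1 hT'
    have hd' := simplexDiam_pos hn hT'm
    by_cases htouch : ∃ z, z ∈ T ∧ z ∈ T'
    · refine (h.abs_interp_sub_le hΩ hκ hκ0 hn hT'm (fun z _ z' _ => hosc z z') hq hr).trans ?_
      have := hκ.neighbours T hT T' hT'm htouch
      gcongr ?_ * _
      rw [div_le_div_iff₀ hd' hd]
      nlinarith
    · push Not at htouch
      have h0 : ∀ z ∈ T', a z = 0 := fun z hz => if_neg fun hzT => htouch z hzT hz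
      rw [h.interp_eq_of_vertices hΩ hT'm h0 hq, h.interp_eq_of_vertices hΩ hT'm h0 hr, sub_self,
        abs_zero]
      positivity
  have h1 := abs_sub_le_of_segment_subset_iUnion h.elements simplexHull
    ((h.continuousOn_interp hΩ a).mono hsub') (fun _ _ => isClosed_simplexHull _)
    (fun q hq => by
      obtain ⟨T', hT', hqT'⟩ := h.exists_mem_element hΩ (hsub' hq)
      exact ⟨T', h.mem_elements.2 hT', hqT'⟩) hLip
  have h2 : h.interp hΩ a x = 1 := h.interp_eq_of_vertices hΩ hT (fun z hz => if_pos hz) hx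
  have h3 : ‖x - p‖ ≤ ‖x - y‖ := by
    obtain ⟨t, ht, rfl⟩ := (segment_eq_image' ℝ x y) ▸ hp
    have : x - (x + t • (y - x)) = t • (x - y) := by module
    rw [this, norm_smul, Real.norm_of_nonneg ht.1]
    exact mul_le_of_le_one_left (norm_nonneg _) ht.2
  have h4 : κ ^ 2 / simplexDiam T * ‖x - p‖ ≤ 1 / 2 := by
    calc _ ≤ κ ^ 2 / simplexDiam T * (simplexDiam T / (2 * κ ^ 2)) := by
          gcongr
          exact h3.trans hxy
      _ = 1 / 2 := by field_simp
  obtain ⟨T', hT', hpT'⟩ := h.exists_mem_element hΩ (hseg hp)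
  refine ⟨T', hT', hpT', ?_⟩
  by_contra! hcon
  have h5 := h.interp_eq_of_vertices hΩ hT' (a := a) (c := 0)
    (fun z hz => if_neg fun hzT => hcon z hzT hz) hpT'
  rw [h2, h5, sub_zero, abs_one] at h1
  linarith

theorem abs_sub_le_of_touching (h : IsTriangulation 𝒯 Ω) (hΩ : IsOpen Ω)
    (hκ : IsShapeRegular κ 𝒯) (hκ0 : 0 < κ) (hn : 0 < n) {T : Finset (Euc n)}
    (hT : T ∈ meshElements 𝒯) {g : Euc n → ℝ} (hg : ContinuousOn g (closure Ω)) {M : ℝ}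
    (hM : ∀ T' ∈ meshElements 𝒯, (∃ z, z ∈ T ∧ z ∈ T') → ∀ q ∈ simplexHull T',
      ∀ r ∈ simplexHull T', |g q - g r| ≤ M * ‖q - r‖)
    {x y : Euc n} (hx : x ∈ simplexHull T)
    (hseg : segment ℝ x y ⊆ closure Ω) (hxy : ‖x - y‖ ≤ simplexDiam T / (2 * κ ^ 2)) :
    |g x - g y| ≤ M * ‖x - y‖ := by
  classical
  refine abs_sub_le_of_segment_subset_iUnion
    (h.elements.filter fun T' => ∃ z, z ∈ T ∧ z ∈ T') simplexHull (hg.mono hseg)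
    (fun _ _ => isClosed_simplexHull _) (fun p hp => ?_) (fun T' hT' => ?_)
  · obtain ⟨T', hT', hpT', hz⟩ := h.exists_touching_element hΩ hκ hκ0 hn hT hx hseg hxy p hp
    exact ⟨T', Finset.mem_filter.2 ⟨h.mem_elements.2 hT', hz⟩, hpT'⟩
  · obtain ⟨h1, h2⟩ := Finset.mem_filter.1 hT'
    exact hM T' (h.mem_elements.1 h1) h2

/-- A vertex is free if its hat function vanishes on the boundary of the domain. -/
def IsFree (h : IsTriangulation 𝒯 Ω) (hΩ : IsOpen Ω) (z : Euc n) : Prop :=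
  ∀ x ∈ frontier Ω, h.hat hΩ z x = 0

/-- Freeness is defined through the hat function, so nothing has to be known about how the faces fit
`∂Ω`: a boundary point where the hat is nonzero lies in an element having `z` as a vertex. -/
theorem exists_frontier_of_not_isFree (h : IsTriangulation 𝒯 Ω) (hΩ : IsOpen Ω) {z : Euc n}
    (hz : ¬ h.IsFree hΩ z) :
    ∃ p ∈ frontier Ω, ∃ T ∈ meshElements 𝒯, z ∈ T ∧ p ∈ simplexHull T := by
  classical
  simp only [IsFree, not_forall] at hz
  obtain ⟨p, hp, hpz⟩ := hz
  obtain ⟨T, hT, hpT⟩ := h.exists_mem_element hΩ (frontier_subset_closure hp)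
  refine ⟨p, hp, T, hT, ?_, hpT⟩
  by_contra hzT
  obtain ⟨A, hA, hA'⟩ := h.exists_affine_eq_hat hΩ z hT
  refine hpz ?_
  have h1 : A p = (0 : Euc n →ᵃ[ℝ] ℝ) p := by
    refine AffineMap.eqOn_simplexHull (fun y hy => ?_) hpT
    rw [hA y hy, Set.indicator_of_notMem (by rintro rfl; exact hzT hy)]
    rfl
  exact (hA' p hpT).trans h1

/-- The reason for writing `interp` as a sum of hats: on the boundary every summand vanishes,
through either the hat or the coefficient. -/
theorem interp_eq_zero_of_free (h : IsTriangulation 𝒯 Ω) (hΩ : IsOpen Ω) {a : Euc n → ℝ}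
    (ha : ∀ z, ¬ h.IsFree hΩ z → a z = 0) {x : Euc n} (hx : x ∉ Ω) : h.interp hΩ a x = 0 := by
  by_cases hxc : x ∈ closure Ω
  · have hxf : x ∈ frontier Ω := ⟨hxc, fun hi => hx (interior_subset hi)⟩
    refine Finset.sum_eq_zero fun z _ => ?_
    by_cases hz : h.IsFree hΩ z
    · rw [hz x hxf, mul_zero]
    · rw [ha z hz, zero_mul]
  · exact h.interp_eq_zero_of_notMem hΩ a hxc

end IsTriangulation

theorem continuous_of_continuousOn_closure (hΩ : IsOpen Ω) {g : Euc n → ℝ}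
    (hg : ContinuousOn g (closure Ω)) (h0 : ∀ x, x ∉ Ω → g x = 0) : Continuous g := by
  have h1 : ContinuousOn g Ωᶜ := (continuousOn_const (c := (0 : ℝ))).congr fun x hx => h0 x hx
  have h2 := hg.union_of_isClosed h1 isClosed_closure hΩ.isClosed_compl
  have h3 : closure Ω ∪ Ωᶜ = Set.univ := by
    rw [Set.eq_univ_iff_forall]
    intro x
    by_cases hx : x ∈ Ω
    · exact Or.inl (subset_closure hx)
    · exact Or.inr hx
  rwa [h3, continuousOn_univ] at h2

/-- Continuous functions, affine on each element, that vanish outside the domain. -/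
structure IsMeshFunction (𝒯 : Geometry.SimplicialComplex ℝ (EuclideanSpace ℝ (Fin n)))
    (Ω : Set (EuclideanSpace ℝ (Fin n))) (g : EuclideanSpace ℝ (Fin n) → ℝ) : Prop where
  continuous : Continuous g
  eq_zero : ∀ x, x ∉ Ω → g x = 0
  affine : ∀ T ∈ meshElements 𝒯, ∃ A : EuclideanSpace ℝ (Fin n) →ᵃ[ℝ] ℝ,
    ∀ x ∈ simplexHull T, g x = A x

namespace IsMeshFunction

theorem zero : IsMeshFunction 𝒯 Ω (fun _ => 0) :=
  ⟨continuous_const, fun _ _ => rfl, fun _ _ => ⟨0, fun _ _ => rfl⟩⟩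

theorem add {f g : Euc n → ℝ} (hf : IsMeshFunction 𝒯 Ω f) (hg : IsMeshFunction 𝒯 Ω g) :
    IsMeshFunction 𝒯 Ω (fun x => f x + g x) := by
  refine ⟨hf.continuous.add hg.continuous, fun x hx => ?_, fun T hT => ?_⟩
  · rw [hf.eq_zero x hx, hg.eq_zero x hx, add_zero]
  · obtain ⟨A, hA⟩ := hf.affine T hT
    obtain ⟨B, hB⟩ := hg.affine T hT
    exact ⟨A + B, fun x hx => by rw [hA x hx, hB x hx]; rfl⟩

theorem const_mul {f : Euc n → ℝ} (hf : IsMeshFunction 𝒯 Ω f) (c : ℝ) :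
    IsMeshFunction 𝒯 Ω (fun x => c * f x) := by
  refine ⟨continuous_const.mul hf.continuous, fun x hx => ?_, fun T hT => ?_⟩
  · rw [hf.eq_zero x hx, mul_zero]
  · obtain ⟨A, hA⟩ := hf.affine T hT
    exact ⟨c • A, fun x hx => by rw [hA x hx]; rfl⟩

theorem finset_sum {ι : Type*} (I : Finset ι) {f : ι → Euc n → ℝ}
    (hf : ∀ i ∈ I, IsMeshFunction 𝒯 Ω (f i)) :
    IsMeshFunction 𝒯 Ω (fun x => ∑ i ∈ I, f i x) := by
  classical
  induction I using Finset.induction_on with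
  | empty => simpa using zero
  | insert i I hi ih =>
    simp_rw [Finset.sum_insert hi]
    exact (hf i (Finset.mem_insert_self i I)).add
      (ih fun j hj => hf j (Finset.mem_insert_of_mem hj))

/-- Slope bounds on the elements give a global Lipschitz bound. -/
theorem abs_sub_le {g : Euc n → ℝ} (hg : IsMeshFunction 𝒯 Ω g) (h : IsTriangulation 𝒯 Ω)
    (hΩ : IsOpen Ω) {M : ℝ} (hM0 : 0 ≤ M)
    (hM : ∀ T ∈ meshElements 𝒯, ∀ q ∈ simplexHull T, ∀ r ∈ simplexHull T,
      |g q - g r| ≤ M * ‖q - r‖) (x y : Euc n) : |g x - g y| ≤ M * ‖x - y‖ := by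
  classical
  -- The complement of `Ω`, where `g = 0`, serves as one more piece, since a segment between two
  -- points may leave the domain.
  refine abs_sub_le_of_segment_subset_iUnion (insert Ωᶜ (h.elements.image simplexHull)) id
    hg.continuous.continuousOn (fun i hi => ?_) (fun p _ => ?_) (fun i hi => ?_)
  · rcases Finset.mem_insert.1 hi with rfl | hi
    · exact hΩ.isClosed_compl
    · obtain ⟨T, _, rfl⟩ := Finset.mem_image.1 hi
      exact isClosed_simplexHull T
  · by_cases hp : p ∈ Ω
    · obtain ⟨T, hT, hpT⟩ := h.exists_mem_element hΩ (subset_closure hp)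
      exact ⟨_, Finset.mem_insert_of_mem
        (Finset.mem_image_of_mem _ (h.mem_elements.2 hT)), hpT⟩
    · exact ⟨_, Finset.mem_insert_self _ _, hp⟩
  · rcases Finset.mem_insert.1 hi with rfl | hi
    · intro p hp q hq
      rw [hg.eq_zero p hp, hg.eq_zero q hq, sub_self, abs_zero]
      positivity
    · obtain ⟨T, hT, rfl⟩ := Finset.mem_image.1 hi
      exact hM T (h.mem_elements.1 hT)

end IsMeshFunction

theorem IsTriangulation.isMeshFunction_interp (h : IsTriangulation 𝒯 Ω) (hΩ : IsOpen Ω)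
    {a : Euc n → ℝ} (h0 : ∀ x, x ∉ Ω → h.interp hΩ a x = 0) :
    IsMeshFunction 𝒯 Ω (h.interp hΩ a) := by
  refine ⟨continuous_of_continuousOn_closure hΩ (h.continuousOn_interp hΩ a) h0, h0,
    fun T hT => ?_⟩
  obtain ⟨A, _, hA⟩ := h.exists_affine_eq_interp hΩ a hT
  exact ⟨A, hA⟩

end MeshInterpolation

/-! ### Energy of a function that is close to `v` at the scale of the mesh. -/

section Energy

variable {n : ℕ} {s : ℝ} {Ω : Set (EuclideanSpace ℝ (Fin n))} {κ : ℝ}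
  {𝒯 : Geometry.SimplicialComplex ℝ (EuclideanSpace ℝ (Fin n))}

theorem ofReal_div_le_truncKernel {a r t : ℝ} (ha : 0 ≤ a) (hr : 0 < r) (hrt : r ≤ t) :
    ENNReal.ofReal (a / t ^ kexp n s) ≤
      ENNReal.ofReal (a / r ^ 2) * ENNReal.ofReal (truncKernel n s r t) := by
  rw [← ENNReal.ofReal_mul (by positivity)]
  apply ENNReal.ofReal_le_ofReal
  have h : min (r ^ 2) (t ^ 2) = r ^ 2 := min_eq_left (by gcongr)
  rw [truncKernel, h]
  apply le_of_eq
  field_simp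

theorem ofReal_sq_div_le_truncKernel {b m r t : ℝ} (hb : |b| ≤ m * t) (ht : 0 ≤ t) (htr : t ≤ r) :
    ENNReal.ofReal (b ^ 2 / t ^ kexp n s) ≤
      ENNReal.ofReal (m ^ 2) * ENNReal.ofReal (truncKernel n s r t) := by
  rw [← ENNReal.ofReal_mul (by positivity)]
  apply ENNReal.ofReal_le_ofReal
  have h : min (r ^ 2) (t ^ 2) = t ^ 2 := min_eq_right (by gcongr)
  rw [truncKernel, h, ← mul_div_assoc, ← mul_pow]
  have h2 : b ^ 2 ≤ (m * t) ^ 2 := sq_le_sq' (by linarith [(abs_le.1 hb).1]) ((le_abs_self b).trans hb)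
  gcongr

/-- A majorant for the part of the Gagliardo integrand of `g` charged to its first variable. -/
noncomputable def gagMajorant (n : ℕ) (s : ℝ) (Ω : Set (EuclideanSpace ℝ (Fin n)))
    (I : Finset (Finset (EuclideanSpace ℝ (Fin n)))) (ρ M : Finset (EuclideanSpace ℝ (Fin n)) → ℝ)
    (g v : EuclideanSpace ℝ (Fin n) → ℝ) (x y : EuclideanSpace ℝ (Fin n)) : ENNReal :=
  ENNReal.ofReal (2 * g x ^ 2 / Metric.infDist x Ωᶜ ^ 2) *
      ENNReal.ofReal (truncKernel n s (Metric.infDist x Ωᶜ) ‖x - y‖) +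
    ∑ T ∈ I, (simplexHull T).indicator
      (fun x => ENNReal.ofReal (3 * (g x - v x) ^ 2 / ρ T ^ 2 + M T ^ 2)) x *
        ENNReal.ofReal (truncKernel n s (ρ T) ‖x - y‖)

theorem measurable_gagMajorant (I : Finset (Finset (Euc n))) (ρ M : Finset (Euc n) → ℝ)
    {g v : Euc n → ℝ} (hg : Measurable g) (hv : Measurable v) :
    Measurable (fun p : Euc n × Euc n => gagMajorant n s Ω I ρ M g v p.1 p.2) := by
  unfold gagMajorant
  have hd : Measurable fun x : Euc n => Metric.infDist x Ωᶜ :=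
    (Metric.continuous_infDist_pt _).measurable
  have h0 : Measurable fun p : Euc n × Euc n =>
      ENNReal.ofReal (2 * g p.1 ^ 2 / Metric.infDist p.1 Ωᶜ ^ 2) *
        ENNReal.ofReal (truncKernel n s (Metric.infDist p.1 Ωᶜ) ‖p.1 - p.2‖) := by
    unfold truncKernel
    fun_prop
  refine h0.add (Finset.measurable_fun_sum _ fun T _ => ?_)
  have h1 : Measurable ((simplexHull T).indicator
      (fun x => ENNReal.ofReal (3 * (g x - v x) ^ 2 / ρ T ^ 2 + M T ^ 2))) :=
    Measurable.indicator (by fun_prop) (isClosed_simplexHull T).measurableSet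
  unfold truncKernel
  fun_prop

theorem mul_truncKernel_le_gagMajorant {I : Finset (Finset (Euc n))} {ρ M : Finset (Euc n) → ℝ}
    {g v : Euc n → ℝ} {T : Finset (Euc n)} (hT : T ∈ I) {x : Euc n} (hx : x ∈ simplexHull T)
    (y : Euc n) {b : ℝ} (hb : b ≤ 3 * (g x - v x) ^ 2 / ρ T ^ 2 + M T ^ 2) :
    ENNReal.ofReal b * ENNReal.ofReal (truncKernel n s (ρ T) ‖x - y‖) ≤
      gagMajorant n s Ω I ρ M g v x y := by
  refine le_trans ?_ le_add_self
  refine le_trans ?_ (Finset.single_le_sum (f := fun T => (simplexHull T).indicator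
      (fun x => ENNReal.ofReal (3 * (g x - v x) ^ 2 / ρ T ^ 2 + M T ^ 2)) x *
        ENNReal.ofReal (truncKernel n s (ρ T) ‖x - y‖)) (fun _ _ => zero_le) hT)
  rw [Set.indicator_of_mem hx]
  gcongr

theorem segment_subset_of_norm_lt_infDist {x y : Euc n} (h : ‖x - y‖ < Metric.infDist x Ωᶜ) :
    segment ℝ x y ⊆ Ω := by
  refine Set.Subset.trans ?_ (ball_infDist_compl_subset x)
  refine (convex_ball _ _).segment_subset (Metric.mem_ball_self ((norm_nonneg _).trans_lt h)) ?_
  rwa [Metric.mem_ball, dist_comm, dist_eq_norm]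

/-- Pairs fall into three classes. If `|x - y|` is at least both distances to the complement, then
`g(x)²` and `g(y)²` are charged at those scales. Otherwise the segment lies in `Ω`; if `|x - y|` is
at most the scale of the element of one endpoint, its slope bound applies. In the remaining case `g`
is compared with `v` at both endpoints, and the square of a sum of three terms costs the factor `3`.
-/
theorem ofReal_gagliardo_integrand_le (hn : 0 < n)
    (hΩ : IsBoundedLipschitzDomain Ω) (h : IsTriangulation 𝒯 Ω) {ρ M : Finset (Euc n) → ℝ}
    (hρ : ∀ T ∈ meshElements 𝒯, 0 < ρ T) {g v : Euc n → ℝ} (hg0 : ∀ x, x ∉ Ω → g x = 0)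
    (hM : ∀ T ∈ meshElements 𝒯, ∀ x ∈ simplexHull T, ∀ y, segment ℝ x y ⊆ closure Ω →
      ‖x - y‖ ≤ ρ T → |g x - g y| ≤ M T * ‖x - y‖) (x y : Euc n) :
    ENNReal.ofReal ((g x - g y) ^ 2 / ‖x - y‖ ^ kexp n s) ≤
      gagMajorant n s Ω h.elements ρ M g v x y + gagMajorant n s Ω h.elements ρ M g v y x +
        3 * ENNReal.ofReal ((v x - v y) ^ 2 / ‖x - y‖ ^ kexp n s) := by
  rcases eq_or_ne x y with rfl | hxy
  · simp
  have ht : 0 < ‖x - y‖ := norm_pos_iff.2 (sub_ne_zero.2 hxy)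
  have htp : 0 < ‖x - y‖ ^ kexp n s := by positivity
  by_cases hfar : Metric.infDist x Ωᶜ ≤ ‖x - y‖ ∧ Metric.infDist y Ωᶜ ≤ ‖y - x‖
  · have hone : ∀ x y : Euc n, Metric.infDist x Ωᶜ ≤ ‖x - y‖ →
        ENNReal.ofReal (2 * g x ^ 2 / ‖x - y‖ ^ kexp n s) ≤
          gagMajorant n s Ω h.elements ρ M g v x y := by
      intro x y hxy
      by_cases hx : x ∈ Ω
      · exact (ofReal_div_le_truncKernel (by positivity) (infDist_compl_pos hn hΩ hx) hxy).trans
          le_self_add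
      · simp [hg0 x hx]
    refine le_trans ?_ le_self_add
    refine le_trans ?_ (add_le_add (hone x y hfar.1) (hone y x hfar.2))
    rw [norm_sub_rev y x, ← ENNReal.ofReal_add (by positivity) (by positivity), ← add_div]
    apply ENNReal.ofReal_le_ofReal
    gcongr
    nlinarith [sq_nonneg (g x + g y)]
  have hseg : segment ℝ x y ⊆ Ω := by
    rw [not_and_or, not_le, not_le] at hfar
    rcases hfar with hf | hf
    · exact segment_subset_of_norm_lt_infDist hf
    · rw [segment_symm]
      exact segment_subset_of_norm_lt_infDist hf
  have hsegc := hseg.trans subset_closure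
  obtain ⟨T, hT, hxT⟩ := h.exists_mem_element hΩ.isOpen (hsegc (left_mem_segment ℝ x y))
  obtain ⟨T', hT', hyT'⟩ := h.exists_mem_element hΩ.isOpen (hsegc (right_mem_segment ℝ x y))
  have hTe := h.mem_elements.2 hT
  have hTe' := h.mem_elements.2 hT'
  by_cases hnx : ‖x - y‖ ≤ ρ T
  · refine le_trans ?_ (le_self_add.trans le_self_add)
    refine (ofReal_sq_div_le_truncKernel (hM T hT x hxT y hsegc hnx) ht.le hnx).trans
      (mul_truncKernel_le_gagMajorant hTe hxT y ?_)
    have : 0 ≤ 3 * (g x - v x) ^ 2 / ρ T ^ 2 := by positivity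
    linarith
  by_cases hny : ‖y - x‖ ≤ ρ T'
  · refine le_trans ?_ (le_add_self.trans le_self_add)
    rw [norm_sub_rev x y, ← neg_sub (g y) (g x), neg_sq]
    refine (ofReal_sq_div_le_truncKernel (hM T' hT' y hyT' x (by rwa [segment_symm]) hny)
      (norm_nonneg _) hny).trans (mul_truncKernel_le_gagMajorant hTe' hyT' x ?_)
    have : 0 ≤ 3 * (g y - v y) ^ 2 / ρ T' ^ 2 := by positivity
    linarith
  push Not at hnx hny
  have hone : ∀ T ∈ meshElements 𝒯, ∀ x ∈ simplexHull T, ∀ y, ρ T < ‖x - y‖ →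
      ENNReal.ofReal (3 * (g x - v x) ^ 2 / ‖x - y‖ ^ kexp n s) ≤
        gagMajorant n s Ω h.elements ρ M g v x y := by
    intro T hT x hx y hxy
    refine (ofReal_div_le_truncKernel (by positivity) (hρ T hT) hxy.le).trans
      (mul_truncKernel_le_gagMajorant (h.mem_elements.2 hT) hx y ?_)
    have : 0 ≤ M T ^ 2 := by positivity
    linarith
  have h3 : (3 : ENNReal) * ENNReal.ofReal ((v x - v y) ^ 2 / ‖x - y‖ ^ kexp n s) =
      ENNReal.ofReal (3 * (v x - v y) ^ 2 / ‖x - y‖ ^ kexp n s) := by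
    rw [mul_div_assoc, ENNReal.ofReal_mul (by norm_num)]
    norm_num
  refine le_trans ?_ (add_le_add (add_le_add (hone T hT x hxT y hnx) (hone T' hT' y hyT' x hny))
    h3.ge)
  rw [norm_sub_rev y x, ← ENNReal.ofReal_add (by positivity) (by positivity), ← add_div,
    ← ENNReal.ofReal_add (by positivity) (by positivity), ← add_div]
  apply ENNReal.ofReal_le_ofReal
  gcongr
  nlinarith [sq_nonneg (g x - v x - (v x - v y)), sq_nonneg (g x - v x + (g y - v y)),
    sq_nonneg ((v x - v y) + (g y - v y))]

end Energy

section Energy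

variable {n : ℕ} {s : ℝ} {Ω : Set (EuclideanSpace ℝ (Fin n))} {κ : ℝ}
  {𝒯 : Geometry.SimplicialComplex ℝ (EuclideanSpace ℝ (Fin n))}

theorem lintegral_gagMajorant_le {C₀ : ℝ}
    (hC₀ : ∀ r : ℝ, 0 < r → ∀ x : Euc n,
      ∫⁻ y, ENNReal.ofReal (truncKernel n s r ‖x - y‖) ≤ ENNReal.ofReal (C₀ * r ^ (2 - 2 * s)))
    (hn : 0 < n) (hΩ : IsBoundedLipschitzDomain Ω) {I : Finset (Finset (Euc n))}
    {ρ M : Finset (Euc n) → ℝ} (hρ : ∀ T ∈ I, 0 < ρ T) {g v : Euc n → ℝ}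
    (hg0 : ∀ x, x ∉ Ω → g x = 0) (x : Euc n) :
    ∫⁻ y, gagMajorant n s Ω I ρ M g v x y ≤
      ENNReal.ofReal (2 * g x ^ 2 / Metric.infDist x Ωᶜ ^ 2) *
        ENNReal.ofReal (C₀ * Metric.infDist x Ωᶜ ^ (2 - 2 * s)) +
      ∑ T ∈ I, (simplexHull T).indicator
        (fun x => ENNReal.ofReal (3 * (g x - v x) ^ 2 / ρ T ^ 2 + M T ^ 2)) x *
          ENNReal.ofReal (C₀ * ρ T ^ (2 - 2 * s)) := by
  have hk : ∀ r : ℝ, Measurable fun y : Euc n => ENNReal.ofReal (truncKernel n s r ‖x - y‖) := by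
    intro r
    unfold truncKernel
    fun_prop
  unfold gagMajorant
  rw [lintegral_add_left ((hk _).const_mul _), lintegral_finsetSum _ fun T _ => (hk _).const_mul _]
  refine add_le_add ?_ (Finset.sum_le_sum fun T hT => ?_)
  · rw [lintegral_const_mul _ (hk _)]
    by_cases hx : x ∈ Ω
    · gcongr
      exact hC₀ _ (infDist_compl_pos hn hΩ hx) x
    · simp [hg0 x hx]
  · rw [lintegral_const_mul _ (hk _)]
    gcongr
    exact hC₀ _ (hρ T hT) x

theorem ofReal_mul_le_of_le {a b c : ℝ} {S : ENNReal} (ha : 0 ≤ a)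
    (h : ENNReal.ofReal b ≤ ENNReal.ofReal c * S) :
    ENNReal.ofReal (a * b) ≤ ENNReal.ofReal (a * c) * S := by
  rw [ENNReal.ofReal_mul ha, ENNReal.ofReal_mul ha, mul_assoc]
  gcongr

/-- The elements overlap only in null sets, so their contributions of `S` amount to at most one
further copy of its integral. -/
theorem IsTriangulation.lintegral_add_sum_indicator_le (h : IsTriangulation 𝒯 Ω)
    {S : Euc n → ENNReal} (hS : Measurable S) (μ : Finset (Euc n) → ENNReal) :
    ∫⁻ x, (S x + ∑ T ∈ h.elements, (simplexHull T).indicator (fun x => S x + μ T) x) ≤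
      2 * ((∫⁻ x, S x) + ∑ T ∈ h.elements, μ T * volume (simplexHull T)) := by
  have hm : ∀ T, MeasurableSet (simplexHull (n := n) T) := fun T =>
    (isClosed_simplexHull T).measurableSet
  rw [lintegral_add_left hS, lintegral_finsetSum _ fun T _ =>
    (hS.add_const (μ T)).indicator (hm T)]
  have h1 : ∀ T ∈ h.elements, ∫⁻ x, (simplexHull T).indicator (fun x => S x + μ T) x =
      (∫⁻ x in simplexHull T, S x) + μ T * volume (simplexHull T) := by
    intro T _
    rw [lintegral_indicator (hm T), lintegral_add_left hS, setLIntegral_const]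
  rw [Finset.sum_congr rfl h1, Finset.sum_add_distrib, two_mul, ← add_assoc]
  have h2 := h.sum_setLIntegral_le S
  calc _ ≤ (∫⁻ x, S x) + (∫⁻ x, S x) + ∑ T ∈ h.elements, μ T * volume (simplexHull T) := by
        gcongr
    _ ≤ (∫⁻ x, S x) + (∫⁻ x, S x) + ∑ T ∈ h.elements, μ T * volume (simplexHull T) +
        ∑ T ∈ h.elements, μ T * volume (simplexHull T) := le_self_add
    _ = _ := by ring

theorem gagliardo_le_of_gagMajorant (hn : 0 < n) (hΩ : IsBoundedLipschitzDomain Ω)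
    (h : IsTriangulation 𝒯 Ω) {ρ M : Finset (Euc n) → ℝ}
    (hρ : ∀ T ∈ meshElements 𝒯, 0 < ρ T) {g v : Euc n → ℝ} (hvm : Measurable v)
    (hg : Measurable g) (hg0 : ∀ x, x ∉ Ω → g x = 0)
    (hM : ∀ T ∈ meshElements 𝒯, ∀ x ∈ simplexHull T, ∀ y, segment ℝ x y ⊆ closure Ω →
      ‖x - y‖ ≤ ρ T → |g x - g y| ≤ M T * ‖x - y‖) :
    gagliardo s g ≤
      2 * (∫⁻ x, ∫⁻ y, gagMajorant n s Ω h.elements ρ M g v x y) + 3 * gagliardo s v := by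
  have hmm := measurable_gagMajorant (s := s) (Ω := Ω) h.elements ρ M hg hvm
  generalize hA : gagMajorant n s Ω h.elements ρ M g v = A at hmm
  have hswap : ∫⁻ x, ∫⁻ y, A y x = ∫⁻ x, ∫⁻ y, A x y :=
    lintegral_lintegral_swap (hmm.comp measurable_swap).aemeasurable
  have hm1 : ∀ x, Measurable fun y => A x y := fun x => hmm.comp measurable_prodMk_left
  have hm2 : ∀ x, Measurable fun y => A y x := fun x => hmm.comp measurable_prodMk_right
  have e1 : Measurable fun x => ∫⁻ y, A x y := hmm.lintegral_prod_right'
  have e2 : Measurable fun x => ∫⁻ y, A y x := (hmm.comp measurable_swap).lintegral_prod_right'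
  calc gagliardo s g ≤ ∫⁻ x, ∫⁻ y, (A x y + A y x +
        3 * ENNReal.ofReal ((v x - v y) ^ 2 / ‖x - y‖ ^ kexp n s)) :=
      lintegral_mono fun x => lintegral_mono fun y =>
        hA ▸ ofReal_gagliardo_integrand_le hn hΩ h hρ hg0 hM x y
    _ = ∫⁻ x, ((∫⁻ y, A x y) + (∫⁻ y, A y x) + 3 * gagliardoAt s v x) := by
      refine lintegral_congr fun x => ?_
      rw [lintegral_add_left (f := fun y => A x y + A y x) ((hm1 x).add (hm2 x)),
        lintegral_add_left (hm1 x),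
        lintegral_const_mul' _ _ (by norm_num)]
      rfl
    _ = (∫⁻ x, ∫⁻ y, A x y) + (∫⁻ x, ∫⁻ y, A y x) + 3 * gagliardo s v := by
      rw [lintegral_add_left (f := fun x => (∫⁻ y, A x y) + ∫⁻ y, A y x) (e1.add e2),
        lintegral_add_left e1,
        lintegral_const_mul' _ _ (by norm_num)]
      rfl
    _ = _ := by rw [hswap, two_mul]

/-- Integrating out `y` turns truncation at scale `r` into `r^{2-2s}`. Element terms become
`h^{-2s}(g - v)²`, controlled by the local error, and `M² h^{2-2s}`, which is kept. The boundary
term needs Hardy's inequality or the vanishing of `g` on the boundary. -/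
theorem lintegral_gagMajorant_le_gagliardoAt {C₀ CH c c₁ : ℝ} (hC₀ : 0 < C₀) (hCH : 0 < CH)
    (hc : 0 < c) (hc₁ : 0 < c₁) (hs0 : 0 < s) (hs1 : s < 1)
    (hker : ∀ r : ℝ, 0 < r → ∀ x : Euc n,
      ∫⁻ y, ENNReal.ofReal (truncKernel n s r ‖x - y‖) ≤ ENNReal.ofReal (C₀ * r ^ (2 - 2 * s)))
    (hn : 0 < n) (hΩ : IsBoundedLipschitzDomain Ω) (h : IsTriangulation 𝒯 Ω)
    {M : Finset (Euc n) → ℝ} {g v : Euc n → ℝ} (hg0 : ∀ x, x ∉ Ω → g x = 0)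
    (hM : ∀ T ∈ meshElements 𝒯, ∀ x ∈ simplexHull T, ∀ y, segment ℝ x y ⊆ closure Ω →
      ‖x - y‖ ≤ c * simplexDiam T → |g x - g y| ≤ M T * ‖x - y‖)
    (hardy : ∀ x ∈ Ω, ENNReal.ofReal (v x ^ 2) ≤
        ENNReal.ofReal (CH * Metric.infDist x Ωᶜ ^ (2 * s)) * gagliardoAt s v x)
    (he : ∀ T ∈ meshElements 𝒯, ∀ x ∈ simplexHull T, ENNReal.ofReal ((g x - v x) ^ 2) ≤
        ENNReal.ofReal (c₁ * simplexDiam T ^ (2 * s)) * gagliardoAt s v x) (x : Euc n) :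
    ∫⁻ y, gagMajorant n s Ω h.elements (fun T => c * simplexDiam T) M g v x y ≤
      ENNReal.ofReal (C₀ * (4 * CH + 7 * c₁ * c ^ (-(2 * s)) + 3 * c ^ (2 - 2 * s))) *
        (gagliardoAt s v x + ∑ T ∈ h.elements, (simplexHull T).indicator
          (fun x => gagliardoAt s v x +
            ENNReal.ofReal (M T ^ 2 * simplexDiam T ^ (2 - 2 * s))) x) := by
  have hcp : 0 < c ^ (-(2 * s)) := by positivity
  have hcp' : 0 < c ^ (2 - 2 * s) := by positivity
  have hρ : ∀ T ∈ meshElements 𝒯, 0 < c * simplexDiam T := fun T hT =>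
    mul_pos hc (simplexDiam_pos hn hT)
  have hsplit : ∀ r : ℝ, 0 < r → r ^ (2 - 2 * s) = r ^ 2 * r ^ (-(2 * s)) := fun r hr => by
    rw [sub_eq_add_neg, Real.rpow_add hr, Real.rpow_two]
  have herr : ∀ T ∈ meshElements 𝒯, x ∈ simplexHull T →
      ENNReal.ofReal (C₀ * (c * simplexDiam T) ^ (-(2 * s)) * (g x - v x) ^ 2) ≤
        ENNReal.ofReal (C₀ * c₁ * c ^ (-(2 * s))) * gagliardoAt s v x := by
    intro T hT hx
    have hd := simplexDiam_pos hn hT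
    have h1 := ofReal_mul_le_of_le (a := C₀ * (c * simplexDiam T) ^ (-(2 * s)))
      (mul_nonneg hC₀.le (Real.rpow_nonneg (hρ T hT).le _)) (he T hT x hx)
    refine h1.trans_eq ?_
    congr 2
    rw [Real.mul_rpow hc.le hd.le, Real.rpow_neg hd.le (2 * s)]
    have : 0 < simplexDiam T ^ (2 * s) := by positivity
    field_simp
  have hMt : ∀ T ∈ meshElements 𝒯,
      ENNReal.ofReal (C₀ * (c * simplexDiam T) ^ (2 - 2 * s) * M T ^ 2) =
      ENNReal.ofReal (C₀ * c ^ (2 - 2 * s)) *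
        ENNReal.ofReal (M T ^ 2 * simplexDiam T ^ (2 - 2 * s)) := by
    intro T hT
    have hd := simplexDiam_pos hn hT
    rw [← ENNReal.ofReal_mul (by positivity), Real.mul_rpow hc.le hd.le]
    congr 1
    ring
  refine (lintegral_gagMajorant_le hker hn hΩ (fun T hT => hρ T (h.mem_elements.1 hT)) hg0
    x).trans ?_
  set S := gagliardoAt s v x
  set μ : Finset (Euc n) → ENNReal := fun T =>
    ENNReal.ofReal (M T ^ 2 * simplexDiam T ^ (2 - 2 * s)) with hμ
  set J := S + ∑ T ∈ h.elements, (simplexHull T).indicator (fun x => gagliardoAt s v x + μ T) x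
    with hJ
  have hsum : ∑ T ∈ h.elements, (simplexHull T).indicator
        (fun x => ENNReal.ofReal (3 * (g x - v x) ^ 2 / (c * simplexDiam T) ^ 2 + M T ^ 2)) x *
          ENNReal.ofReal (C₀ * (c * simplexDiam T) ^ (2 - 2 * s)) ≤
      ENNReal.ofReal (C₀ * (3 * c₁ * c ^ (-(2 * s)) + c ^ (2 - 2 * s))) * J := by
    calc _ ≤ ∑ T ∈ h.elements, ENNReal.ofReal (C₀ * (3 * c₁ * c ^ (-(2 * s)) + c ^ (2 - 2 * s))) *
          (simplexHull T).indicator (fun x => gagliardoAt s v x + μ T) x := by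
          refine Finset.sum_le_sum fun T hTe => ?_
          by_cases hx : x ∈ simplexHull T
          · have hT := h.mem_elements.1 hTe
            have hr := hρ T hT
            have hd := simplexDiam_pos hn hT
            rw [Set.indicator_of_mem hx, Set.indicator_of_mem hx,
              ← ENNReal.ofReal_mul (by positivity)]
            have e1 : (3 * (g x - v x) ^ 2 / (c * simplexDiam T) ^ 2 + M T ^ 2) *
                (C₀ * (c * simplexDiam T) ^ (2 - 2 * s)) =
                3 * (C₀ * (c * simplexDiam T) ^ (-(2 * s)) * (g x - v x) ^ 2) +
                  C₀ * (c * simplexDiam T) ^ (2 - 2 * s) * M T ^ 2 := by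
              rw [hsplit _ hr]
              field_simp
            rw [e1, ENNReal.ofReal_add (by positivity) (by positivity), hMt T hT, mul_add]
            refine add_le_add ?_ ?_
            · refine (ofReal_mul_le_of_le (by norm_num) (herr T hT hx)).trans ?_
              refine mul_le_mul' (ENNReal.ofReal_le_ofReal ?_) le_rfl
              nlinarith [mul_pos hC₀ hcp']
            · refine mul_le_mul' (ENNReal.ofReal_le_ofReal ?_) le_rfl
              nlinarith [mul_pos hC₀ (mul_pos hc₁ hcp)]
          · simp [hx]
      _ ≤ _ := by
          rw [← Finset.mul_sum]
          gcongr
          exact le_add_self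
  have hfirst : ENNReal.ofReal (2 * g x ^ 2 / Metric.infDist x Ωᶜ ^ 2) *
        ENNReal.ofReal (C₀ * Metric.infDist x Ωᶜ ^ (2 - 2 * s)) ≤
      ENNReal.ofReal (C₀ * (4 * CH + 4 * c₁ * c ^ (-(2 * s)) + 2 * c ^ (2 - 2 * s))) * J := by
    by_cases hx : x ∈ Ω
    swap
    · simp [hg0 x hx]
    have hd := infDist_compl_pos hn hΩ hx
    obtain ⟨p, hp, hpd⟩ := exists_frontier_dist_eq hn hΩ hx
    obtain ⟨T, hT, hxT⟩ := h.exists_mem_element hΩ.isOpen (subset_closure hx)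
    have hr := hρ T hT
    set d := Metric.infDist x Ωᶜ with hddef
    have hSJ : S ≤ J := le_self_add
    have hμJ : μ T ≤ J := by
      refine le_trans ?_ le_add_self
      refine le_trans ?_ (Finset.single_le_sum (f := fun T => (simplexHull T).indicator
        (fun x => gagliardoAt s v x + μ T) x) (fun _ _ => zero_le) (h.mem_elements.2 hT))
      rw [Set.indicator_of_mem hxT]
      exact le_add_self
    have hcc := mul_pos hC₀ (mul_pos hc₁ hcp)
    have hcc' := mul_pos hC₀ hcp'
    have hcc'' := mul_pos hC₀ hCH
    have hds : 0 < d ^ (-(2 * s)) := by positivity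
    rw [← ENNReal.ofReal_mul (by positivity), hsplit _ hd]
    have e1 : 2 * g x ^ 2 / d ^ 2 * (C₀ * (d ^ 2 * d ^ (-(2 * s)))) =
        2 * (C₀ * d ^ (-(2 * s))) * g x ^ 2 := by field_simp
    rw [e1]
    -- Close to the boundary, the slope bound towards the nearest boundary point `p`, where `g = 0`,
    -- gives `|g x| ≤ M_T d`; this is why `hM` admits segments in the closure. Farther away `g² ≤
    -- 2(g - v)² + 2v²`, with the local error and Hardy's inequality for the two terms.
    rcases le_or_gt d (c * simplexDiam T) with hle | hlt
    · have hseg : segment ℝ x p ⊆ closure Ω := by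
        refine Set.Subset.trans ?_ (closure_mono (ball_infDist_compl_subset (Ω := Ω) x))
        rw [closure_ball _ hd.ne']
        refine (convex_closedBall _ _).segment_subset (Metric.mem_closedBall_self hd.le) ?_
        rw [Metric.mem_closedBall, dist_comm, hpd]
      have hpΩ : p ∉ Ω := fun hpΩ => hp.2 (hΩ.isOpen.interior_eq.symm ▸ hpΩ)
      rw [dist_eq_norm] at hpd
      have h1 := hM T hT x hxT p hseg (hpd.le.trans hle)
      rw [hg0 p hpΩ, sub_zero, hpd] at h1
      have h2 : g x ^ 2 ≤ (M T * d) ^ 2 :=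
        sq_le_sq' (by linarith [(abs_le.1 h1).1]) ((le_abs_self _).trans h1)
      have h3 : d ^ (2 - 2 * s) ≤ (c * simplexDiam T) ^ (2 - 2 * s) :=
        Real.rpow_le_rpow hd.le hle (by linarith)
      calc _ ≤ ENNReal.ofReal (2 * (C₀ * (c * simplexDiam T) ^ (2 - 2 * s) * M T ^ 2)) := by
            apply ENNReal.ofReal_le_ofReal
            calc _ ≤ 2 * (C₀ * d ^ (-(2 * s))) * (M T * d) ^ 2 := by gcongr
              _ = 2 * (C₀ * d ^ (2 - 2 * s) * M T ^ 2) := by rw [hsplit _ hd]; ring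
              _ ≤ _ := by gcongr
        _ ≤ ENNReal.ofReal (2 * (C₀ * c ^ (2 - 2 * s))) * μ T :=
            ofReal_mul_le_of_le (by norm_num) (hMt T hT).le
        _ ≤ _ := by
            refine mul_le_mul' (ENNReal.ofReal_le_ofReal ?_) hμJ
            nlinarith
    · have h1 : (c * simplexDiam T) ^ (-(2 * s)) ≥ d ^ (-(2 * s)) :=
        Real.rpow_le_rpow_of_nonpos hr hlt.le (by linarith)
      have h2 := ofReal_mul_le_of_le (a := 4 * (C₀ * d ^ (-(2 * s)))) (by positivity) (hardy x hx)
      have e2 : 4 * (C₀ * d ^ (-(2 * s))) * (CH * d ^ (2 * s)) = 4 * (C₀ * CH) := by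
        rw [Real.rpow_neg hd.le]
        field_simp
      rw [e2] at h2
      calc _ ≤ ENNReal.ofReal (4 * (C₀ * (c * simplexDiam T) ^ (-(2 * s)) * (g x - v x) ^ 2) +
              4 * (C₀ * d ^ (-(2 * s))) * v x ^ 2) := by
            apply ENNReal.ofReal_le_ofReal
            calc _ ≤ 2 * (C₀ * d ^ (-(2 * s))) * (2 * (g x - v x) ^ 2 + 2 * v x ^ 2) := by
                  gcongr
                  nlinarith [sq_nonneg (g x - v x - v x)]
              _ = 4 * (C₀ * d ^ (-(2 * s)) * (g x - v x) ^ 2) +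
                  4 * (C₀ * d ^ (-(2 * s))) * v x ^ 2 := by ring
              _ ≤ _ := by gcongr
        _ ≤ ENNReal.ofReal (4 * (C₀ * c₁ * c ^ (-(2 * s)))) * S +
            ENNReal.ofReal (4 * (C₀ * CH)) * S := by
            rw [ENNReal.ofReal_add (by positivity) (by positivity)]
            exact add_le_add (ofReal_mul_le_of_le (by norm_num) (herr T hT hxT)) h2
        _ ≤ _ := by
            rw [← add_mul, ← ENNReal.ofReal_add (by positivity) (by positivity)]
            refine mul_le_mul' (ENNReal.ofReal_le_ofReal ?_) hSJ
            nlinarith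
  refine (add_le_add hfirst hsum).trans_eq ?_
  rw [← add_mul, ← ENNReal.ofReal_add (by positivity) (by positivity)]
  congr 2
  ring

/-- Energy bound for a function `g` that is Lipschitz at the scale of the mesh and close to `v`
at the scale of the mesh. -/
theorem exists_gagliardo_le (hn : 0 < n) (hs0 : 0 < s) (hs1 : s < 1)
    (hΩ : IsBoundedLipschitzDomain Ω) {c c₁ : ℝ} (hc : 0 < c) (hc₁ : 0 < c₁) :
    ∃ C : ℝ, 0 < C ∧ ∀ 𝒯 : Geometry.SimplicialComplex ℝ (EuclideanSpace ℝ (Fin n)),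
      ∀ h : IsTriangulation 𝒯 Ω, ∀ v : Euc n → ℝ, Measurable v → MemLp v 2 volume →
      (∀ x, x ∉ Ω → v x = 0) → ∀ g : Euc n → ℝ, Continuous g → (∀ x, x ∉ Ω → g x = 0) →
      ∀ M : Finset (Euc n) → ℝ,
      (∀ T ∈ meshElements 𝒯, ∀ x ∈ simplexHull T, ∀ y, segment ℝ x y ⊆ closure Ω →
        ‖x - y‖ ≤ c * simplexDiam T → |g x - g y| ≤ M T * ‖x - y‖) →
      (∀ T ∈ meshElements 𝒯, ∀ x ∈ simplexHull T, ENNReal.ofReal ((g x - v x) ^ 2) ≤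
        ENNReal.ofReal (c₁ * simplexDiam T ^ (2 * s)) * gagliardoAt s v x) →
      gagliardo s g ≤ ENNReal.ofReal C * (gagliardo s v + ∑ T ∈ h.elements,
        ENNReal.ofReal (M T ^ 2 * simplexDiam T ^ (2 - 2 * s)) * volume (simplexHull T)) := by
  obtain ⟨C₀, hC₀, hker⟩ := exists_lintegral_truncKernel_le hn hs0 hs1
  obtain ⟨CH, hCH, hardy⟩ := exists_hardy hn hΩ hs0
  set D : ℝ := C₀ * (4 * CH + 7 * c₁ * c ^ (-(2 * s)) + 3 * c ^ (2 - 2 * s))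
  have hDpos : 0 < D := by positivity
  -- Both variables carry the majorant (factor `2`), its integral is at most `D · 2X`, and the
  -- energy of `v` enters with the factor `3`.
  refine ⟨4 * D + 3, by positivity, fun 𝒯 h v hvm hv hv0 g hg hg0 M hM he => ?_⟩
  have hρ : ∀ T ∈ meshElements 𝒯, 0 < c * simplexDiam T := fun T hT =>
    mul_pos hc (simplexDiam_pos hn hT)
  set X := gagliardo s v + ∑ T ∈ h.elements,
        ENNReal.ofReal (M T ^ 2 * simplexDiam T ^ (2 - 2 * s)) * volume (simplexHull T) with hX
  have hmaj : ∫⁻ x, ∫⁻ y, gagMajorant n s Ω h.elements (fun T => c * simplexDiam T) M g v x y ≤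
      ENNReal.ofReal D * (2 * X) :=
    (lintegral_mono fun x => lintegral_gagMajorant_le_gagliardoAt hC₀ hCH hc hc₁ hs0 hs1 hker hn
      hΩ h hg0 hM (hardy v hv hv0) he x).trans (by
        rw [lintegral_const_mul' _ _ ENNReal.ofReal_ne_top]
        gcongr
        exact h.lintegral_add_sum_indicator_le (measurable_gagliardoAt s hvm) _)
  refine (gagliardo_le_of_gagMajorant hn hΩ h hρ hvm hg.measurable hg0 hM).trans ?_
  have h3 : 3 * gagliardo s v ≤ ENNReal.ofReal 3 * X := by
    rw [show ENNReal.ofReal 3 = 3 by norm_num]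
    gcongr
    exact le_self_add
  refine (add_le_add (mul_le_mul_right hmaj 2) h3).trans_eq ?_
  have h4 : ENNReal.ofReal (4 * D) = 4 * ENNReal.ofReal D := by
    rw [ENNReal.ofReal_mul (by norm_num)]
    norm_num
  rw [ENNReal.ofReal_add (by positivity) (by positivity), add_mul, h4]
  ring

end Energy

/-! ### A quasi-interpolation operator stable in the Gagliardo seminorm. -/

section QuasiInterpolation

variable {n : ℕ} {s : ℝ} {Ω : Set (EuclideanSpace ℝ (Fin n))} {κ : ℝ}
  {𝒯 : Geometry.SimplicialComplex ℝ (EuclideanSpace ℝ (Fin n))}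

theorem IsTriangulation.simplexDiam_le (h : IsTriangulation 𝒯 Ω) {R : ℝ} (hR : 0 ≤ R)
    (hRd : ∀ x ∈ closure Ω, ∀ y ∈ closure Ω, dist x y ≤ R) {T : Finset (Euc n)}
    (hT : T ∈ meshElements 𝒯) : simplexDiam T ≤ R :=
  Metric.diam_le_of_forall_dist_le hR fun x hx y hy =>
    hRd x (h.simplexHull_subset hT hx) y (h.simplexHull_subset hT hy)

theorem IsShapeRegular.le_volume (hκ : IsShapeRegular κ 𝒯) (hκ0 : 0 < κ) (hn : 0 < n)
    {T : Finset (Euc n)} (hT : T ∈ meshElements 𝒯) :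
    ENNReal.ofReal (unitBallVol n * (simplexDiam T / κ) ^ n) ≤ volume (simplexHull T) := by
  obtain ⟨c, hc⟩ := hκ.inball T hT
  have hd := simplexDiam_pos hn hT
  rw [← volume_ball_eq c (by positivity)]
  exact measure_mono (Metric.ball_subset_closedBall.trans hc)

/-- Every vertex has a ball of the local mesh size nearby, outside the domain if it is not free. -/
theorem exists_node_ball (hn : 0 < n) (hΩ : IsBoundedLipschitzDomain Ω) (hκ0 : 0 < κ) :
    ∃ c C : ℝ, 0 < c ∧ 0 < C ∧ ∀ 𝒯 : Geometry.SimplicialComplex ℝ (EuclideanSpace ℝ (Fin n)),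
      ∀ h : IsTriangulation 𝒯 Ω, IsShapeRegular κ 𝒯 → ∀ z : Euc n, ∃ (b : Euc n) (r : ℝ), 0 < r ∧
        (∀ T ∈ meshElements 𝒯, z ∈ T → c * simplexDiam T ≤ r ∧
          ∀ x ∈ simplexHull T, ∀ y ∈ Metric.ball b r, ‖x - y‖ ≤ C * simplexDiam T) ∧
        (¬ h.IsFree hΩ.isOpen z → ∀ y ∈ Metric.ball b r, y ∉ Ω) := by
  obtain ⟨R, hR, hRd⟩ := hΩ.exists_dist_bound
  obtain ⟨θ, hθ, hext⟩ := hΩ.exists_exterior_ball hR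
  -- A free vertex gets the inball of one element `T₀` at `z`, another vertex an exterior ball of
  -- radius `θ h_{T₀}` near a boundary point of such an element. All elements at `z` have diameters
  -- comparable to `h_{T₀}` up to `κ`. The distance bound adds `h_T` from `x` to `z` and at most
  -- `3h_{T₀}` from `z` to the ball.
  refine ⟨min (1 / κ ^ 2) (θ / κ), 1 + 3 * κ, by positivity, by positivity,
    fun 𝒯 h hκ z => ?_⟩
  by_cases hz : h.IsFree hΩ.isOpen z
  · by_cases hex : ∃ T ∈ meshElements 𝒯, z ∈ T
    · obtain ⟨T₀, hT₀, hzT₀⟩ := hex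
      obtain ⟨b, hb⟩ := hκ.inball T₀ hT₀
      have hd₀ := simplexDiam_pos hn hT₀
      refine ⟨b, simplexDiam T₀ / κ, by positivity, fun T hT hzT => ⟨?_, fun x hx y hy => ?_⟩,
        fun h => absurd hz h⟩
      · have h1 := hκ.neighbours T hT T₀ hT₀ ⟨z, hzT, hzT₀⟩
        have hd := simplexDiam_pos hn hT
        calc min (1 / κ ^ 2) (θ / κ) * simplexDiam T ≤ 1 / κ ^ 2 * (κ * simplexDiam T₀) := by
              gcongr
              exact min_le_left _ _
          _ = simplexDiam T₀ / κ := by field_simp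
      · have h1 := hκ.neighbours T₀ hT₀ T hT ⟨z, hzT₀, hzT⟩
        have h2 := dist_le_simplexDiam hx (mem_simplexHull_of_mem hzT)
        have h3 := dist_le_simplexDiam (mem_simplexHull_of_mem hzT₀)
          (hb (Metric.ball_subset_closedBall hy))
        have hd := simplexDiam_pos hn hT
        rw [← dist_eq_norm]
        have := dist_triangle x z y
        nlinarith
    · push Not at hex
      -- A point that is a vertex of no element may get any ball.
      exact ⟨0, 1, one_pos, fun T hT hzT => absurd hzT (hex T hT), fun h => absurd hz h⟩
  · obtain ⟨p, hp, T₀, hT₀, hzT₀, hpT₀⟩ := h.exists_frontier_of_not_isFree hΩ.isOpen hz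
    have hd₀ := simplexDiam_pos hn hT₀
    obtain ⟨b, hb⟩ := hext p hp (simplexDiam T₀) hd₀ (h.simplexDiam_le hR.le hRd hT₀)
    refine ⟨b, θ * simplexDiam T₀, by positivity, fun T hT hzT => ⟨?_, fun x hx y hy => ?_⟩,
      fun _ y hy => (hb y hy).1⟩
    · have h1 := hκ.neighbours T hT T₀ hT₀ ⟨z, hzT, hzT₀⟩
      have hd := simplexDiam_pos hn hT
      calc min (1 / κ ^ 2) (θ / κ) * simplexDiam T ≤ θ / κ * (κ * simplexDiam T₀) := by
            gcongr
            exact min_le_right _ _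
        _ = θ * simplexDiam T₀ := by field_simp
    · have h1 := hκ.neighbours T₀ hT₀ T hT ⟨z, hzT₀, hzT⟩
      have h2 := dist_le_simplexDiam hx (mem_simplexHull_of_mem hzT)
      have h3 := dist_le_simplexDiam (mem_simplexHull_of_mem hzT₀) hpT₀
      have h4 := (hb y hy).2
      have hd := simplexDiam_pos hn hT
      rw [← dist_eq_norm]
      have := dist_triangle x z y
      have := dist_triangle_right z y p
      nlinarith

/-- The nodal values are averages over the node balls. At a non-free vertex the ball lies outside
`Ω`, so the average is zero without loss in the error bound. -/
theorem exists_node_values (hn : 0 < n) (hs0 : 0 < s) (hΩ : IsBoundedLipschitzDomain Ω)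
    (hκ0 : 0 < κ) :
    ∃ C : ℝ, 0 < C ∧ ∀ 𝒯 : Geometry.SimplicialComplex ℝ (EuclideanSpace ℝ (Fin n)),
      ∀ h : IsTriangulation 𝒯 Ω, IsShapeRegular κ 𝒯 → ∀ v : Euc n → ℝ, MemLp v 2 volume →
      (∀ x, x ∉ Ω → v x = 0) → ∃ a : Euc n → ℝ, (∀ z, ¬ h.IsFree hΩ.isOpen z → a z = 0) ∧
        ∀ T ∈ meshElements 𝒯, ∀ z ∈ T, ∀ x ∈ simplexHull T, ENNReal.ofReal ((v x - a z) ^ 2) ≤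
          ENNReal.ofReal (C * simplexDiam T ^ (2 * s)) * gagliardoAt s v x := by
  obtain ⟨c, C, hc, hC, hball⟩ := exists_node_ball hn hΩ hκ0
  have hω := unitBallVol_pos n
  refine ⟨C ^ kexp n s / (unitBallVol n * c ^ n), by positivity, fun 𝒯 h hκ v hv hv0 => ?_⟩
  choose b r hr hbr hfree using hball 𝒯 h hκ
  refine ⟨fun z => ⨍ y in Metric.ball (b z) (r z), v y, fun z hz => ?_, fun T hT z hz x hx => ?_⟩
  · beta_reduce
    rw [setAverage_eq, setIntegral_eq_zero_of_forall_eq_zero fun y hy => hv0 y (hfree z hz y hy),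
      smul_zero]
  · obtain ⟨h1, h2⟩ := hbr z T hT hz
    have hd := simplexDiam_pos hn hT
    refine (sq_sub_average_le_gagliardoAt hs0 hv x (b z) (hr z) (h2 x hx)).trans ?_
    refine mul_le_mul' (ENNReal.ofReal_le_ofReal ?_) le_rfl
    calc _ ≤ (C * simplexDiam T) ^ kexp n s / (unitBallVol n * (c * simplexDiam T) ^ n) := by
          gcongr
      _ = _ := by
          rw [Real.mul_rpow hC.le hd.le, mul_pow]
          have : simplexDiam T ^ kexp n s = simplexDiam T ^ n * simplexDiam T ^ (2 * s) := by
            rw [kexp, Real.rpow_add hd, Real.rpow_natCast]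
          rw [this]
          field_simp

/-- A difference of two nodal values of `T` is at most `|v x - a z| + |v x - a z'|` for every `x ∈
T`. Integrating over `x ∈ T` bounds it by the local part of the energy of `v`. -/
theorem exists_slopes (h : IsTriangulation 𝒯 Ω) (hΩ : IsOpen Ω) (hκ : IsShapeRegular κ 𝒯)
    (hκ0 : 0 < κ) (hn : 0 < n) {a v : Euc n → ℝ} {C : ℝ} (hC : 0 < C)
    (ha : ∀ T ∈ meshElements 𝒯, ∀ z ∈ T, ∀ x ∈ simplexHull T, ENNReal.ofReal ((v x - a z) ^ 2) ≤
      ENNReal.ofReal (C * simplexDiam T ^ (2 * s)) * gagliardoAt s v x) :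
    ∃ G : Finset (Euc n) → ℝ, ∀ T ∈ meshElements 𝒯, 0 ≤ G T ∧
      (∀ x ∈ simplexHull T, ∀ y ∈ simplexHull T,
        |h.interp hΩ a x - h.interp hΩ a y| ≤ G T * ‖x - y‖) ∧
      ENNReal.ofReal (G T ^ 2 * simplexDiam T ^ (2 - 2 * s)) * volume (simplexHull T) ≤
        ENNReal.ofReal (4 * κ ^ 2 * C) * ∫⁻ x in simplexHull T, gagliardoAt s v x := by
  have hmax : ∀ T : Finset (Euc n), ∃ D : ℝ, T ∈ meshElements 𝒯 →
      (∀ z ∈ T, ∀ z' ∈ T, |a z - a z'| ≤ D) ∧ ∃ z ∈ T, ∃ z' ∈ T, D = |a z - a z'| := by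
    intro T
    by_cases hT : T ∈ meshElements 𝒯
    · have hne : (T ×ˢ T).Nonempty := by
        have : T.Nonempty := Finset.card_pos.1 (by rw [hT.2]; omega)
        exact this.product this
      obtain ⟨q, hq, hmax⟩ := Finset.exists_max_image (T ×ˢ T) (fun q => |a q.1 - a q.2|) hne
      rw [Finset.mem_product] at hq
      exact ⟨|a q.1 - a q.2|, fun _ => ⟨fun z hz z' hz' => hmax (z, z')
        (Finset.mem_product.2 ⟨hz, hz'⟩), q.1, hq.1, q.2, hq.2, rfl⟩⟩
    · exact ⟨0, fun h => absurd h hT⟩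
  choose D hD using hmax
  refine ⟨fun T => κ * D T / simplexDiam T, fun T hT => ?_⟩
  have hd := simplexDiam_pos hn hT
  obtain ⟨hle, z, hz, z', hz', hDeq⟩ := hD T hT
  have hD0 : 0 ≤ D T := hDeq ▸ abs_nonneg _
  refine ⟨by positivity, fun x hx y hy => h.abs_interp_sub_le hΩ hκ hκ0 hn hT hle hx hy, ?_⟩
  have hds : 0 < simplexDiam T ^ (2 * s) := by positivity
  rw [← setLIntegral_const, ← lintegral_const_mul' _ _ ENNReal.ofReal_ne_top]
  refine setLIntegral_mono' (isClosed_simplexHull T).measurableSet fun x hx => ?_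
  have e1 : (κ * D T / simplexDiam T) ^ 2 * simplexDiam T ^ (2 - 2 * s) =
      κ ^ 2 * (simplexDiam T ^ (2 * s))⁻¹ * D T ^ 2 := by
    rw [sub_eq_add_neg, Real.rpow_add hd, Real.rpow_two, Real.rpow_neg hd.le]
    field_simp
  rw [e1]
  calc _ ≤ ENNReal.ofReal (2 * κ ^ 2 * (simplexDiam T ^ (2 * s))⁻¹ * (v x - a z) ^ 2 +
          2 * κ ^ 2 * (simplexDiam T ^ (2 * s))⁻¹ * (v x - a z') ^ 2) := by
        apply ENNReal.ofReal_le_ofReal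
        have : D T ^ 2 ≤ 2 * (v x - a z) ^ 2 + 2 * (v x - a z') ^ 2 := by
          rw [hDeq, sq_abs]
          nlinarith [sq_nonneg ((v x - a z) + (v x - a z'))]
        calc _ ≤ κ ^ 2 * (simplexDiam T ^ (2 * s))⁻¹ *
              (2 * (v x - a z) ^ 2 + 2 * (v x - a z') ^ 2) := by gcongr
          _ = _ := by ring
    _ ≤ ENNReal.ofReal (2 * κ ^ 2 * C) * gagliardoAt s v x +
        ENNReal.ofReal (2 * κ ^ 2 * C) * gagliardoAt s v x := by
        rw [ENNReal.ofReal_add (by positivity) (by positivity)]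
        have e2 : 2 * κ ^ 2 * C =
            2 * κ ^ 2 * (simplexDiam T ^ (2 * s))⁻¹ * (C * simplexDiam T ^ (2 * s)) := by
          field_simp
        rw [e2]
        exact add_le_add (ofReal_mul_le_of_le (by positivity) (ha T hT z hz x hx))
          (ofReal_mul_le_of_le (by positivity) (ha T hT z' hz' x hx))
    _ = _ := by
        rw [← add_mul, ← ENNReal.ofReal_add (by positivity) (by positivity)]
        congr 2
        ring

open Classical in
/-- The elements touching `T` have comparable total volume. -/
theorem sum_volume_touching_le (h : IsTriangulation 𝒯 Ω) (hκ : IsShapeRegular κ 𝒯) (hκ0 : 0 < κ)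
    (hn : 0 < n) {T : Finset (Euc n)} (hT : T ∈ meshElements 𝒯) :
    ∑ T' ∈ h.elements.filter (fun T' => ∃ z, z ∈ T' ∧ z ∈ T), volume (simplexHull T') ≤
      ENNReal.ofReal (((κ + 2) * κ) ^ n) * volume (simplexHull T) := by
  obtain ⟨x₀, hx₀⟩ := interior_simplexHull_nonempty hT
  have hx₀' := interior_subset hx₀
  have hd := simplexDiam_pos hn hT
  -- A touching element reaches at most `(κ + 1) h_T` from `x₀`; the extra `h_T` makes the
  -- inequality strict for the open ball.
  set B := Metric.ball x₀ ((κ + 2) * simplexDiam T)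
  have hBm : MeasurableSet B := Metric.isOpen_ball.measurableSet
  have hsub : ∀ T' ∈ h.elements.filter (fun T' => ∃ z, z ∈ T' ∧ z ∈ T), simplexHull T' ⊆ B := by
    intro T' hT' y hy
    obtain ⟨hT'e, z, hz', hz⟩ := Finset.mem_filter.1 hT'
    have h1 := hκ.neighbours T' (h.mem_elements.1 hT'e) T hT ⟨z, hz', hz⟩
    have h2 := dist_le_simplexDiam hy (mem_simplexHull_of_mem hz')
    have h3 := dist_le_simplexDiam (mem_simplexHull_of_mem hz) hx₀'
    rw [Metric.mem_ball]
    have := dist_triangle y z x₀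
    nlinarith
  calc _ ≤ ∑ T' ∈ h.elements.filter (fun T' => ∃ z, z ∈ T' ∧ z ∈ T),
        ∫⁻ x in simplexHull T', B.indicator 1 x := by
        refine Finset.sum_le_sum fun T' hT' => ?_
        rw [← setLIntegral_one]
        refine setLIntegral_mono' (isClosed_simplexHull T').measurableSet fun x hx => ?_
        rw [Set.indicator_of_mem (hsub T' hT' hx)]
        rfl
    _ ≤ ∑ T' ∈ h.elements, ∫⁻ x in simplexHull T', B.indicator 1 x :=
        Finset.sum_le_sum_of_subset (Finset.filter_subset _ _)
    _ ≤ ∫⁻ x, B.indicator 1 x := h.sum_setLIntegral_le _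
    _ = volume B := lintegral_indicator_one hBm
    _ = ENNReal.ofReal (((κ + 2) * κ) ^ n) *
        ENNReal.ofReal (unitBallVol n * (simplexDiam T / κ) ^ n) := by
        rw [volume_ball_eq _ (by positivity), ← ENNReal.ofReal_mul (by positivity)]
        congr 1
        rw [div_pow, mul_pow, mul_pow]
        field_simp
    _ ≤ _ := by
        gcongr
        exact hκ.le_volume hκ0 hn hT

-- After exchanging the sums, the slope of `T'` is weighted with the total volume of the elements
-- touching `T'`, which is comparable to that of `T'`. Hence no bound on the number of neighbours is
-- needed.
open Classical in
theorem sum_touching_slopes_le (h : IsTriangulation 𝒯 Ω) (hκ : IsShapeRegular κ 𝒯) (hκ0 : 0 < κ)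
    (hn : 0 < n) (hs1 : s < 1) {G : Finset (Euc n) → ℝ} :
    ∑ T ∈ h.elements, ENNReal.ofReal (√(∑ T' ∈ h.elements.filter (fun T' => ∃ z, z ∈ T ∧ z ∈ T'),
        G T' ^ 2) ^ 2 * simplexDiam T ^ (2 - 2 * s)) * volume (simplexHull T) ≤
      ENNReal.ofReal (κ ^ (2 - 2 * s) * ((κ + 2) * κ) ^ n) * ∑ T ∈ h.elements,
        ENNReal.ofReal (G T ^ 2 * simplexDiam T ^ (2 - 2 * s)) * volume (simplexHull T) := by
  have h1 : ∀ T ∈ h.elements, ENNReal.ofReal (√(∑ T' ∈ h.elements.filter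
        (fun T' => ∃ z, z ∈ T ∧ z ∈ T'), G T' ^ 2) ^ 2 * simplexDiam T ^ (2 - 2 * s)) *
        volume (simplexHull T) ≤
      ∑ T' ∈ h.elements, if ∃ z, z ∈ T ∧ z ∈ T' then ENNReal.ofReal (κ ^ (2 - 2 * s)) *
        (ENNReal.ofReal (G T' ^ 2 * simplexDiam T' ^ (2 - 2 * s)) * volume (simplexHull T))
        else 0 := by
    intro T hT
    have hd := simplexDiam_pos hn (h.mem_elements.1 hT)
    rw [Real.sq_sqrt (Finset.sum_nonneg fun _ _ => sq_nonneg _), Finset.sum_mul,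
      ENNReal.ofReal_sum_of_nonneg fun _ _ => by positivity, Finset.sum_mul, ← Finset.sum_filter]
    refine Finset.sum_le_sum fun T' hT' => ?_
    obtain ⟨hT'e, hz⟩ := Finset.mem_filter.1 hT'
    have hd' := simplexDiam_pos hn (h.mem_elements.1 hT'e)
    rw [← mul_assoc, ← ENNReal.ofReal_mul (by positivity)]
    refine mul_le_mul' (ENNReal.ofReal_le_ofReal ?_) le_rfl
    have h2 := hκ.neighbours T (h.mem_elements.1 hT) T' (h.mem_elements.1 hT'e) hz
    calc G T' ^ 2 * simplexDiam T ^ (2 - 2 * s) ≤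
          G T' ^ 2 * (κ * simplexDiam T') ^ (2 - 2 * s) := by
          gcongr
          linarith
      _ = _ := by rw [Real.mul_rpow hκ0.le hd'.le]; ring
  refine (Finset.sum_le_sum h1).trans ?_
  rw [Finset.sum_comm, Finset.mul_sum]
  refine Finset.sum_le_sum fun T' hT' => ?_
  rw [← Finset.sum_filter, ← Finset.mul_sum, ← Finset.mul_sum,
    ENNReal.ofReal_mul (p := κ ^ (2 - 2 * s)) (by positivity), mul_assoc]
  refine mul_le_mul' le_rfl ?_
  rw [mul_left_comm]
  refine mul_le_mul' le_rfl ?_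
  exact sum_volume_touching_le h hκ hκ0 hn (h.mem_elements.1 hT')

/-- A stable quasi-interpolation operator on shape-regular meshes. -/
theorem exists_quasiInterpolant (hn : 0 < n) (hs0 : 0 < s) (hs1 : s < 1)
    (hΩ : IsBoundedLipschitzDomain Ω) (hκ0 : 0 < κ) :
    ∃ C : ℝ, 0 < C ∧ ∀ 𝒯 : Geometry.SimplicialComplex ℝ (EuclideanSpace ℝ (Fin n)),
      IsTriangulation 𝒯 Ω → IsShapeRegular κ 𝒯 → ∀ v : Euc n → ℝ, Measurable v →
      MemLp v 2 volume → (∀ x, x ∉ Ω → v x = 0) → ∃ g : Euc n → ℝ, IsMeshFunction 𝒯 Ω g ∧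
        (∀ T ∈ meshElements 𝒯, ∀ x ∈ simplexHull T, ENNReal.ofReal ((g x - v x) ^ 2) ≤
          ENNReal.ofReal (C * simplexDiam T ^ (2 * s)) * gagliardoAt s v x) ∧
        gagliardo s g ≤ ENNReal.ofReal C * gagliardo s v := by
  classical
  obtain ⟨C₁, hC₁, hnode⟩ := exists_node_values (s := s) hn hs0 hΩ hκ0
  obtain ⟨C₂, hC₂, henergy⟩ := exists_gagliardo_le hn hs0 hs1 hΩ
    (c := 1 / (2 * κ ^ 2)) (c₁ := C₁) (by positivity) hC₁
  set K : ℝ := κ ^ (2 - 2 * s) * ((κ + 2) * κ) ^ n * (4 * κ ^ 2 * C₁) with hK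
  have hK0 : 0 < K := by positivity
  refine ⟨max C₁ (C₂ * (1 + K)), by positivity, fun 𝒯 h hκ v hvm hv hv0 => ?_⟩
  obtain ⟨a, ha0, ha⟩ := hnode 𝒯 h hκ v hv hv0
  obtain ⟨G, hG⟩ := exists_slopes h hΩ.isOpen hκ hκ0 hn hC₁ ha
  have hg0 : ∀ x, x ∉ Ω → h.interp hΩ.isOpen a x = 0 := fun x hx =>
    h.interp_eq_zero_of_free hΩ.isOpen ha0 hx
  have hmesh := h.isMeshFunction_interp hΩ.isOpen hg0
  have herr : ∀ T ∈ meshElements 𝒯, ∀ x ∈ simplexHull T,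
      ENNReal.ofReal ((h.interp hΩ.isOpen a x - v x) ^ 2) ≤
        ENNReal.ofReal (C₁ * simplexDiam T ^ (2 * s)) * gagliardoAt s v x := by
    intro T hT x hx
    obtain ⟨z, hz, h1⟩ := h.exists_vertex_interp hΩ.isOpen a hT (v x) hx
    refine le_trans (ENNReal.ofReal_le_ofReal ?_) (ha T hT z hz x hx)
    rw [← sq_abs, ← sq_abs (v x - a z), abs_sub_comm (v x)]
    gcongr
  refine ⟨h.interp hΩ.isOpen a, hmesh, fun T hT x hx => ?_, ?_⟩
  · have hd := simplexDiam_pos hn hT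
    refine (herr T hT x hx).trans ?_
    gcongr
    exact le_max_left _ _
  -- A short segment from `T` runs through touching elements, so its slope is bounded by any
  -- majorant of their slopes. The root of the sum of squares is one whose square can be summed over
  -- the mesh.
  · set M : Finset (Euc n) → ℝ := fun T =>
      √(∑ T' ∈ h.elements.filter (fun T' => ∃ z, z ∈ T ∧ z ∈ T'), G T' ^ 2) with hM
    have hGM : ∀ T ∈ meshElements 𝒯, ∀ T' ∈ meshElements 𝒯, (∃ z, z ∈ T ∧ z ∈ T') →
        G T' ≤ M T := by
      intro T hT T' hT' hz
      refine Real.le_sqrt_of_sq_le ?_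
      exact Finset.single_le_sum (f := fun T' => G T' ^ 2) (fun _ _ => sq_nonneg _)
        (Finset.mem_filter.2 ⟨h.mem_elements.2 hT', hz⟩)
    have h1 := henergy 𝒯 h v hvm hv hv0 _ hmesh.continuous hg0 M
      (fun T hT x hx y hseg hxy => h.abs_sub_le_of_touching hΩ.isOpen hκ hκ0 hn hT
        hmesh.continuous.continuousOn (fun T' hT' hz q hq r hr =>
          ((hG T' hT').2.1 q hq r hr).trans (by gcongr; exact hGM T hT T' hT' hz)) hx hseg
        (by rwa [one_div, inv_mul_eq_div] at hxy)) herr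
    refine h1.trans ?_
    have h2 : ∑ T ∈ h.elements, ENNReal.ofReal (M T ^ 2 * simplexDiam T ^ (2 - 2 * s)) *
        volume (simplexHull T) ≤ ENNReal.ofReal K * gagliardo s v := by
      refine (sum_touching_slopes_le h hκ hκ0 hn hs1).trans ?_
      rw [hK, ENNReal.ofReal_mul (p := κ ^ (2 - 2 * s) * ((κ + 2) * κ) ^ n) (by positivity),
        mul_assoc]
      refine mul_le_mul' le_rfl ?_
      refine (Finset.sum_le_sum fun T hT => (hG T (h.mem_elements.1 hT)).2.2).trans ?_
      rw [← Finset.mul_sum]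
      exact mul_le_mul' le_rfl (h.sum_setLIntegral_le _)
    calc _ ≤ ENNReal.ofReal C₂ * (gagliardo s v + ENNReal.ofReal K * gagliardo s v) := by gcongr
      _ = ENNReal.ofReal (C₂ * (1 + K)) * gagliardo s v := by
        rw [ENNReal.ofReal_mul hC₂.le, ENNReal.ofReal_add zero_le_one hK0.le, ENNReal.ofReal_one]
        ring
      _ ≤ _ := by
        gcongr
        exact le_max_right _ _

end QuasiInterpolation

/-! ### Bubbles and the Fortin operator. -/

section Fortin

variable {n : ℕ} {s : ℝ} {Ω : Set (EuclideanSpace ℝ (Fin n))} {κ : ℝ}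
  {𝒯 𝒯H : Geometry.SimplicialComplex ℝ (EuclideanSpace ℝ (Fin n))}

theorem gagliardo_const_mul (c : ℝ) (f : Euc n → ℝ) :
    gagliardo s (fun x => c * f x) = ENNReal.ofReal (c ^ 2) * gagliardo s f := by
  unfold gagliardo gagliardoAt
  rw [← lintegral_const_mul' _ _ ENNReal.ofReal_ne_top]
  refine lintegral_congr fun x => ?_
  rw [← lintegral_const_mul' _ _ ENNReal.ofReal_ne_top]
  refine lintegral_congr fun y => ?_
  rw [← ENNReal.ofReal_mul (sq_nonneg c)]
  congr 1
  ring

theorem ofReal_le_two_mul {a b : ℝ} (h : a ≤ 2 * b) :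
    ENNReal.ofReal a ≤ 2 * ENNReal.ofReal b :=
  (ENNReal.ofReal_le_ofReal (h.trans_eq (two_mul b))).trans
    (ENNReal.ofReal_add_le.trans_eq (two_mul _).symm)

theorem gagliardo_le_of_majorant {φ : Euc n → ℝ} {A : Euc n → Euc n → ENNReal}
    (hA : Measurable fun p : Euc n × Euc n => A p.1 p.2)
    (h : ∀ x y, ENNReal.ofReal ((φ x - φ y) ^ 2 / ‖x - y‖ ^ kexp n s) ≤ A x y + A y x) :
    gagliardo s φ ≤ 2 * ∫⁻ x, ∫⁻ y, A x y := by
  have hswap : ∫⁻ x, ∫⁻ y, A y x = ∫⁻ x, ∫⁻ y, A x y :=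
    lintegral_lintegral_swap (hA.comp measurable_swap).aemeasurable
  calc gagliardo s φ ≤ ∫⁻ x, ∫⁻ y, (A x y + A y x) :=
        lintegral_mono fun x => lintegral_mono fun y => h x y
    _ = ∫⁻ x, ((∫⁻ y, A x y) + ∫⁻ y, A y x) :=
        lintegral_congr fun x =>
          lintegral_add_left (f := fun y => A x y) (hA.comp measurable_prodMk_left) _
    _ = (∫⁻ x, ∫⁻ y, A x y) + ∫⁻ x, ∫⁻ y, A y x :=
        lintegral_add_left (f := fun x => ∫⁻ y, A x y) hA.lintegral_prod_right' _
    _ = _ := by rw [hswap, two_mul]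

theorem gagliardo_finset_sum_le {ι : Type*} (I : Finset ι) {f : ι → Euc n → ℝ} {w : Euc n → ℝ}
    (hf : ∀ i ∈ I, Measurable (f i))
    (hw : ∀ x y, (w x - w y) ^ 2 ≤ 2 * ∑ i ∈ I, (f i x - f i y) ^ 2) :
    gagliardo s w ≤ 2 * ∑ i ∈ I, gagliardo s (f i) := by
  have hm : ∀ i ∈ I, ∀ x, Measurable fun y =>
      ENNReal.ofReal ((f i x - f i y) ^ 2 / ‖x - y‖ ^ kexp n s) := by
    intro i hi x
    have := hf i hi
    fun_prop
  have hpt : ∀ x y, ENNReal.ofReal ((w x - w y) ^ 2 / ‖x - y‖ ^ kexp n s) ≤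
      2 * ∑ i ∈ I, ENNReal.ofReal ((f i x - f i y) ^ 2 / ‖x - y‖ ^ kexp n s) := by
    intro x y
    rw [← ENNReal.ofReal_sum_of_nonneg fun i _ =>
      div_nonneg (sq_nonneg _) (Real.rpow_nonneg (norm_nonneg _) _)]
    refine ofReal_le_two_mul ?_
    rw [← Finset.sum_div, ← mul_div_assoc]
    exact div_le_div_of_nonneg_right (hw x y) (Real.rpow_nonneg (norm_nonneg _) _)
  have hin : ∀ x, gagliardoAt s w x ≤ 2 * ∑ i ∈ I, gagliardoAt s (f i) x := by
    intro x
    refine (lintegral_mono (hpt x)).trans_eq ?_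
    rw [lintegral_const_mul' _ _ ENNReal.ofNat_ne_top, lintegral_finsetSum' _ fun i hi =>
      (hm i hi x).aemeasurable]
    rfl
  refine (lintegral_mono hin).trans_eq ?_
  rw [lintegral_const_mul' _ _ ENNReal.ofNat_ne_top, lintegral_finsetSum' _ fun i hi =>
    (measurable_gagliardoAt s (hf i hi)).aemeasurable]
  rfl

theorem gagliardo_add_le {f g : Euc n → ℝ} (hf : Measurable f) (hg : Measurable g) :
    gagliardo s (fun x => f x + g x) ≤ 2 * (gagliardo s f + gagliardo s g) := by
  have h := gagliardo_finset_sum_le (s := s) Finset.univ (f := ![f, g]) (w := fun x => f x + g x)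
    (fun i _ => by fin_cases i <;> assumption) (fun x y => by
      rw [Fin.sum_univ_two]
      simp only [Matrix.cons_val_zero, Matrix.cons_val_one]
      nlinarith [sq_nonneg ((f x - f y) - (g x - g y))])
  rwa [Fin.sum_univ_two] at h

/-- At most one function is nonzero at `x` and at most one at `y`, so at most two differences
survive, and Cauchy–Schwarz costs the factor `2` whatever the number of functions. -/
theorem sq_sum_sub_le_of_disjoint {ι α : Type*} (I : Finset ι) {f : ι → α → ℝ}
    (hf : ∀ x, ∀ i ∈ I, ∀ j ∈ I, f i x ≠ 0 → f j x ≠ 0 → i = j) (x y : α) :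
    (∑ i ∈ I, f i x - ∑ i ∈ I, f i y) ^ 2 ≤ 2 * ∑ i ∈ I, (f i x - f i y) ^ 2 := by
  classical
  rw [← Finset.sum_sub_distrib]
  set J := I.filter fun i => f i x ≠ 0 ∨ f i y ≠ 0 with hJ
  have hsub : ∀ i ∈ I, i ∉ J → f i x - f i y = 0 := by
    intro i hi hiJ
    simp only [hJ, Finset.mem_filter, not_and, not_or, not_not] at hiJ
    rw [(hiJ hi).1, (hiJ hi).2, sub_zero]
  have hcard : J.card ≤ 2 := by
    rw [hJ, Finset.filter_or]
    refine (Finset.card_union_le _ _).trans ?_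
    have hone : ∀ z, (I.filter fun i => f i z ≠ 0).card ≤ 1 := fun z => by
      rw [Finset.card_le_one]
      intro i hi j hj
      rw [Finset.mem_filter] at hi hj
      exact hf z i hi.1 j hj.1 hi.2 hj.2
    linarith [hone x, hone y]
  rw [← Finset.sum_subset (Finset.filter_subset _ I) hsub]
  refine (sq_sum_le_card_mul_sum_sq).trans ?_
  have h2 : ∑ i ∈ J, (f i x - f i y) ^ 2 ≤ ∑ i ∈ I, (f i x - f i y) ^ 2 :=
    Finset.sum_le_sum_of_subset_of_nonneg (Finset.filter_subset _ I) fun _ _ _ => sq_nonneg _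
  have h3 : (J.card : ℝ) ≤ 2 := by exact_mod_cast hcard
  have h4 : 0 ≤ ∑ i ∈ J, (f i x - f i y) ^ 2 := Finset.sum_nonneg fun _ _ => sq_nonneg _
  nlinarith

/-- Energy of a Lipschitz bump supported in a ball. -/
theorem exists_gagliardo_bump_le (hn : 0 < n) (hs0 : 0 < s) (hs1 : s < 1) :
    ∃ C : ℝ, 0 < C ∧ ∀ (φ : Euc n → ℝ) (b : Euc n) (r L : ℝ), 0 < r → 0 ≤ L →
      (∀ x, φ x ≠ 0 → x ∈ Metric.ball b (2 * r)) → (∀ x y, |φ x - φ y| ≤ L * ‖x - y‖) →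
      (∀ x y, |φ x - φ y| ≤ L * r) →
      gagliardo s φ ≤ ENNReal.ofReal (C * L ^ 2 * r ^ n * r ^ (2 - 2 * s)) := by
  obtain ⟨C₀, hC₀, hker⟩ := exists_lintegral_truncKernel_le hn hs0 hs1
  have hω := unitBallVol_pos n
  refine ⟨2 * (unitBallVol n * 2 ^ n) * C₀, by positivity, fun φ b r L hr hL hsupp hLip hbd => ?_⟩
  set B := Metric.ball b (2 * r)
  have hBm : MeasurableSet B := Metric.isOpen_ball.measurableSet
  set A : Euc n → Euc n → ENNReal := fun x y =>
    B.indicator (fun _ => 1) x * ENNReal.ofReal (L ^ 2 * truncKernel n s r ‖x - y‖) with hA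
  have hAm : Measurable (fun p : Euc n × Euc n => A p.1 p.2) := by
    simp only [hA]
    have h1 : Measurable (B.indicator (fun _ => (1 : ENNReal))) :=
      measurable_const.indicator hBm
    unfold truncKernel
    fun_prop
  have hpt : ∀ x y, ENNReal.ofReal ((φ x - φ y) ^ 2 / ‖x - y‖ ^ kexp n s) ≤ A x y + A y x := by
    intro x y
    have hreal : (φ x - φ y) ^ 2 / ‖x - y‖ ^ kexp n s ≤ L ^ 2 * truncKernel n s r ‖x - y‖ := by
      rw [truncKernel, ← mul_div_assoc]
      gcongr
      rw [mul_min_of_nonneg _ _ (sq_nonneg L), ← mul_pow, ← mul_pow, ← sq_abs]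
      exact le_min (by gcongr; exact hbd x y) (by gcongr; exact hLip x y)
    by_cases hx : x ∈ B
    · refine le_trans (ENNReal.ofReal_le_ofReal hreal) (le_trans ?_ le_self_add)
      simp [hA, hx]
    by_cases hy : y ∈ B
    · refine le_trans (ENNReal.ofReal_le_ofReal hreal) (le_trans ?_ le_add_self)
      simp [hA, hy, norm_sub_rev y x]
    · have h1 : φ x = 0 := by by_contra h; exact hx (hsupp x h)
      have h2 : φ y = 0 := by by_contra h; exact hy (hsupp y h)
      simp [h1, h2]
  have hint : ∫⁻ x, ∫⁻ y, A x y ≤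
      ENNReal.ofReal (unitBallVol n * 2 ^ n * C₀ * L ^ 2 * r ^ n * r ^ (2 - 2 * s)) := by
    have h1 : ∀ x, ∫⁻ y, A x y ≤
        B.indicator (fun _ => ENNReal.ofReal (L ^ 2 * (C₀ * r ^ (2 - 2 * s)))) x := by
      intro x
      by_cases hx : x ∈ B
      · simp only [hA, Set.indicator_of_mem hx, one_mul]
        simp_rw [ENNReal.ofReal_mul (sq_nonneg L)]
        rw [lintegral_const_mul' _ _ ENNReal.ofReal_ne_top]
        gcongr
        exact hker r hr x
      · simp [hA, hx]
    refine (lintegral_mono h1).trans_eq ?_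
    rw [lintegral_indicator_const hBm, volume_ball_eq _ (by positivity),
      ← ENNReal.ofReal_mul (by positivity), mul_pow]
    congr 1
    ring
  refine (gagliardo_le_of_majorant hAm hpt).trans ((mul_le_mul_right hint 2).trans_eq ?_)
  rw [two_mul, ← ENNReal.ofReal_add (by positivity) (by positivity)]
  congr 1
  ring

theorem closure_interior_simplexHull {T : Finset (Euc n)} (hT : T ∈ meshElements 𝒯) :
    closure (interior (simplexHull T)) = simplexHull T := by
  rw [(convex_convexHull ℝ (T : Set (Euc n))).closure_interior_eq_closure_of_nonempty_interior
    (interior_simplexHull_nonempty hT), (isClosed_simplexHull T).closure_eq]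

/-- An element is the closure of its interior, so an open set that meets it meets its interior. -/
theorem MeshSizeGE.le_of_mem {C : ℝ} (hsize : MeshSizeGE C 𝒯H 𝒯) {K T : Finset (Euc n)}
    (hK : K ∈ meshElements 𝒯H) (hT : T ∈ meshElements 𝒯) {x : Euc n}
    (hxK : x ∈ interior (simplexHull K)) (hxT : x ∈ simplexHull T) :
    C * simplexDiam T ≤ simplexDiam K := by
  refine hsize K hK T hT ?_
  rw [← closure_interior_simplexHull hT] at hxT
  exact mem_closure_iff.1 hxT _ isOpen_interior hxK

/-- A mesh function on the fine mesh that is a bump inside an element of the coarse mesh. -/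
theorem exists_bubble (hn : 0 < n) (hΩ : IsBoundedLipschitzDomain Ω) (hκ0 : 0 < κ)
    (h : IsTriangulation 𝒯 Ω) (hκ : IsShapeRegular κ 𝒯) (hH : IsTriangulation 𝒯H Ω)
    (hκH : IsShapeRegular κ 𝒯H) (hsize : MeshSizeGE (8 * κ) 𝒯H 𝒯) {K : Finset (Euc n)}
    (hK : K ∈ meshElements 𝒯H) {r : ℝ} (hr : r = simplexDiam K / (2 * κ)) :
    ∃ (b : Euc n) (φ : Euc n → ℝ), IsMeshFunction 𝒯 Ω φ ∧
      Metric.ball b (2 * r) ⊆ interior (simplexHull K) ∧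
      (∀ x, φ x ≠ 0 → x ∈ Metric.ball b (2 * r)) ∧ (∀ x, 0 ≤ φ x ∧ φ x ≤ r) ∧
      (∀ x y, |φ x - φ y| ≤ κ * ‖x - y‖) ∧ ∀ x ∈ Metric.ball b (r / 4), r / 2 ≤ φ x := by
  have hdK := simplexDiam_pos hn hK
  have hr0 : 0 < r := by rw [hr]; positivity
  have hKr : simplexDiam K = 2 * κ * r := by rw [hr]; field_simp
  obtain ⟨b, hb⟩ := hκH.inball K hK
  have hbK : Metric.ball b (2 * r) ⊆ interior (simplexHull K) := by
    refine interior_maximal (Set.Subset.trans ?_ hb) Metric.isOpen_ball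
    refine Metric.ball_subset_closedBall.trans (Metric.closedBall_subset_closedBall ?_)
    rw [hKr]
    apply le_of_eq
    field_simp
  have hKΩ : interior (simplexHull K) ⊆ Ω :=
    (interior_mono (hH.simplexHull_subset hK)).trans hΩ.interior_closure_subset
  -- Here the constant `8κ` is used: since `h_K = 2κr`, a fine element meeting the inball, of radius
  -- `2r`, has diameter at most `r/4`.
  have hsmall : ∀ T ∈ meshElements 𝒯, ∀ x ∈ simplexHull T, x ∈ Metric.ball b (2 * r) →
      simplexDiam T ≤ r / 4 := by
    intro T hT x hxT hx
    have h1 := hsize.le_of_mem hK hT (hbK hx) hxT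
    rw [hKr] at h1
    have h2 : 2 * κ * (4 * simplexDiam T) ≤ 2 * κ * r := by linarith
    linarith [le_of_mul_le_mul_left h2 (by positivity)]
  -- A tent of height and radius `r`. Its interpolant on the fine mesh spreads the support by at
  -- most one element, hence stays in the inball, and still exceeds `r/2` on the ball of radius
  -- `r/4`.
  set τ : Euc n → ℝ := fun z => max (r - dist z b) 0 with hτ
  have hτ0 : ∀ z, 0 ≤ τ z := fun z => le_max_right _ _
  have hτr : ∀ z, τ z ≤ r := fun z => max_le (by linarith [dist_nonneg (x := z) (y := b)]) hr0.le
  have hτL : ∀ z z', |τ z - τ z'| ≤ dist z z' := by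
    intro z z'
    have h1 := abs_max_sub_max_le_abs (r - dist z b) (r - dist z' b) 0
    rw [sub_sub_sub_cancel_left, abs_sub_comm (dist z' b)] at h1
    exact h1.trans (abs_dist_sub_le z z' b)
  set φ := h.interp hΩ.isOpen τ with hφ
  have hsupp : ∀ x, φ x ≠ 0 → x ∈ Metric.ball b (2 * r) := by
    intro x hx
    have hxc : x ∈ closure Ω := by
      by_contra hxc
      exact hx (h.interp_eq_zero_of_notMem _ _ hxc)
    obtain ⟨T, hT, hxT⟩ := h.exists_mem_element hΩ.isOpen hxc
    obtain ⟨z, hz, h1⟩ := h.exists_vertex_interp hΩ.isOpen τ hT 0 hxT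
    rw [sub_zero, sub_zero] at h1
    have h2 : 0 < τ z := by
      have := (abs_pos.2 hx).trans_le h1
      rwa [abs_of_nonneg (hτ0 z)] at this
    have h3 : dist z b < r := by
      by_contra! hcon
      rw [hτ] at h2
      simp only [lt_max_iff, lt_self_iff_false, or_false] at h2
      linarith
    have h4 := hsmall T hT z (mem_simplexHull_of_mem hz) (by rw [Metric.mem_ball]; linarith)
    have h5 := dist_le_simplexDiam hxT (mem_simplexHull_of_mem hz)
    rw [Metric.mem_ball]
    linarith [dist_triangle x z b]
  have hzero : ∀ x, x ∉ Ω → φ x = 0 := by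
    intro x hx
    by_contra hne
    exact hx (hKΩ (hbK (hsupp x hne)))
  have hmesh := h.isMeshFunction_interp hΩ.isOpen hzero
  refine ⟨b, φ, hmesh, hbK, hsupp, fun x => ?_, ?_, fun x hx => ?_⟩
  · by_cases hxΩ : x ∈ Ω
    · obtain ⟨T, hT, hxT⟩ := h.exists_mem_element hΩ.isOpen (subset_closure hxΩ)
      obtain ⟨z, hz, h1⟩ := h.exists_vertex_interp hΩ.isOpen τ hT (r / 2) hxT
      have h2 : |τ z - r / 2| ≤ r / 2 := by
        rw [abs_le]
        constructor <;> linarith [hτ0 z, hτr z]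
      have h3 := abs_le.1 (h1.trans h2)
      constructor <;> linarith [h3.1, h3.2]
    · rw [hzero x hxΩ]
      exact ⟨le_rfl, hr0.le⟩
  · refine hmesh.abs_sub_le h hΩ.isOpen hκ0.le fun T hT q hq p hp => ?_
    have hd := simplexDiam_pos hn hT
    have h1 := h.abs_interp_sub_le hΩ.isOpen hκ hκ0 hn hT (D := simplexDiam T)
      (fun z hz z' hz' => (hτL z z').trans
        (dist_le_simplexDiam (mem_simplexHull_of_mem hz) (mem_simplexHull_of_mem hz'))) hq hp
    rwa [mul_div_assoc, div_self hd.ne', mul_one] at h1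
  · rw [Metric.mem_ball] at hx
    have hx2 : x ∈ Metric.ball b (2 * r) := by rw [Metric.mem_ball]; linarith
    obtain ⟨T, hT, hxT⟩ := h.exists_mem_element hΩ.isOpen (subset_closure (hKΩ (hbK hx2)))
    obtain ⟨z, hz, h1⟩ := h.exists_vertex_interp hΩ.isOpen τ hT r hxT
    have h4 := hsmall T hT x hxT hx2
    have h5 := dist_le_simplexDiam (mem_simplexHull_of_mem hz) hxT
    have h6 : r / 2 ≤ τ z := by
      refine le_trans ?_ (le_max_left _ _)
      linarith [dist_triangle z x b]
    have h2 : |τ z - r| ≤ r / 2 := by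
      rw [abs_le]
      constructor <;> linarith [hτr z]
    linarith [(abs_le.1 (h1.trans h2)).1]

end Fortin

section Fortin

variable {n : ℕ} {s : ℝ} {Ω : Set (EuclideanSpace ℝ (Fin n))} {κ : ℝ}
  {𝒯 𝒯H : Geometry.SimplicialComplex ℝ (EuclideanSpace ℝ (Fin n))}

theorem ofReal_sq_setIntegral_le {f : Euc n → ℝ} (hf : MemLp f 2 volume) {A : Set (Euc n)}
    {V : ℝ} (hV0 : volume A ≠ 0) (hV : volume A ≤ ENNReal.ofReal V) :
    ENNReal.ofReal ((∫ x in A, f x) ^ 2) ≤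
      ENNReal.ofReal V * ∫⁻ x in A, ENNReal.ofReal (f x ^ 2) := by
  have hfin : volume A < ⊤ := hV.trans_lt ENNReal.ofReal_lt_top
  have hfm : IsFiniteMeasure (volume.restrict A) :=
    ⟨by rw [Measure.restrict_apply_univ]; exact hfin⟩
  have hne : NeZero (volume.restrict A) := ⟨fun h => hV0 (Measure.restrict_eq_zero.1 h)⟩
  have hfA : MemLp f 2 (volume.restrict A) := hf.restrict _
  have hJ := (even_two.convexOn_pow (𝕜 := ℝ)).map_average_le (f := f)
    (μ := volume.restrict A) (by fun_prop) isClosed_univ (by simp)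
    (hfA.integrable (by norm_num)) hfA.integrable_sq
  have hpos : 0 < volume.real A := ENNReal.toReal_pos hV0 hfin.ne
  have hVr : volume.real A ≤ V := by
    rcases le_or_gt V 0 with h | h
    · rw [ENNReal.ofReal_eq_zero.2 h] at hV
      exact absurd (le_antisymm hV zero_le) hV0
    · exact ENNReal.toReal_le_of_le_ofReal h.le hV
  rw [setAverage_eq, setAverage_eq, smul_eq_mul, smul_eq_mul, mul_pow] at hJ
  have h0 : 0 ≤ ∫ x in A, f x ^ 2 := integral_nonneg fun x => sq_nonneg _
  have h1 : (∫ x in A, f x) ^ 2 ≤ V * ∫ x in A, f x ^ 2 := by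
    have h2 : (∫ x in A, f x) ^ 2 ≤ volume.real A * ∫ x in A, f x ^ 2 := by
      have h3 := mul_le_mul_of_nonneg_left hJ (sq_nonneg (volume.real A))
      have e1 : volume.real A ^ 2 * ((volume.real A)⁻¹ ^ 2 * (∫ x in A, f x) ^ 2) =
          (∫ x in A, f x) ^ 2 := by field_simp
      have e2 : volume.real A ^ 2 * ((volume.real A)⁻¹ * ∫ x in A, f x ^ 2) =
          volume.real A * ∫ x in A, f x ^ 2 := by field_simp
      calc _ = _ := e1.symm
        _ ≤ _ := h3
        _ = _ := e2
    exact h2.trans (by gcongr)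
  refine (ENNReal.ofReal_le_ofReal h1).trans ?_
  rw [ENNReal.ofReal_mul (hpos.le.trans hVr), ofReal_integral_eq_lintegral_ofReal hfA.integrable_sq
    (Filter.Eventually.of_forall fun x => sq_nonneg _)]

theorem IsMeshFunction.hasCompactSupport (hΩ : IsBoundedLipschitzDomain Ω) {g : Euc n → ℝ}
    (hg : IsMeshFunction 𝒯 Ω g) : HasCompactSupport g :=
  HasCompactSupport.intro
    (Metric.isCompact_of_isClosed_isBounded isClosed_closure hΩ.isBounded.closure)
    fun x hx => hg.eq_zero x fun hxΩ => hx (subset_closure hxΩ)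

theorem IsMeshFunction.memLp (hΩ : IsBoundedLipschitzDomain Ω) {g : Euc n → ℝ}
    (hg : IsMeshFunction 𝒯 Ω g) : MemLp g 2 volume :=
  hg.continuous.memLp_of_hasCompactSupport (hg.hasCompactSupport hΩ)

theorem IsMeshFunction.integrable (hΩ : IsBoundedLipschitzDomain Ω) {g : Euc n → ℝ}
    (hg : IsMeshFunction 𝒯 Ω g) : Integrable g volume :=
  hg.continuous.integrable_of_hasCompactSupport (hg.hasCompactSupport hΩ)

theorem volume_interior_simplexHull_le (hn : 0 < n) {K : Finset (Euc n)}
    (hK : K ∈ meshElements 𝒯H) :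
    volume (interior (simplexHull K)) ≤ ENNReal.ofReal (unitBallVol n * (2 * simplexDiam K) ^ n) := by
  obtain ⟨x, hx⟩ := interior_simplexHull_nonempty hK
  have hd := simplexDiam_pos hn hK
  rw [← volume_ball_eq x (by positivity)]
  refine measure_mono fun y hy => ?_
  have := dist_le_simplexDiam (interior_subset hy) (interior_subset hx)
  rw [Metric.mem_ball]
  linarith

theorem bubble_integral_ge {K : Finset (Euc n)} {b : Euc n} {φ : Euc n → ℝ} {r : ℝ} (hr : 0 < r)
    (hint : Integrable φ volume) (h0 : ∀ x, 0 ≤ φ x)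
    (hbK : Metric.ball b (2 * r) ⊆ interior (simplexHull K))
    (hlow : ∀ x ∈ Metric.ball b (r / 4), r / 2 ≤ φ x) :
    r / 2 * (unitBallVol n * (r / 4) ^ n) ≤ ∫ x in interior (simplexHull K), φ x := by
  have hω := unitBallVol_pos n
  have hsub : Metric.ball b (r / 4) ⊆ interior (simplexHull K) :=
    (Metric.ball_subset_ball (by linarith)).trans hbK
  have hvol : volume.real (Metric.ball b (r / 4)) = unitBallVol n * (r / 4) ^ n := by
    rw [Measure.real, volume_ball_eq _ (by positivity), ENNReal.toReal_ofReal (by positivity)]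
  calc r / 2 * (unitBallVol n * (r / 4) ^ n) = ∫ x in Metric.ball b (r / 4), r / 2 := by
        rw [setIntegral_const, hvol, smul_eq_mul, mul_comm]
    _ ≤ ∫ x in Metric.ball b (r / 4), φ x := by
        refine setIntegral_mono_on (integrableOn_const measure_ball_lt_top.ne)
          hint.integrableOn Metric.isOpen_ball.measurableSet hlow
    _ ≤ _ := setIntegral_mono_set hint.integrableOn
        (Filter.Eventually.of_forall h0) hsub.eventuallyLE

/-- Energy of the correction on one element of the coarse mesh. -/
theorem exists_correction_le (hn : 0 < n) (hs0 : 0 < s) (hs1 : s < 1)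
    (hκ0 : 0 < κ) {Cq : ℝ} (hCq : 0 < Cq) :
    ∃ C : ℝ, 0 < C ∧ ∀ (𝒯H : Geometry.SimplicialComplex ℝ (EuclideanSpace ℝ (Fin n)))
      (K : Finset (Euc n)), K ∈ meshElements 𝒯H → ∀ (r : ℝ), r = simplexDiam K / (2 * κ) →
      ∀ (b : Euc n) (φ e : Euc n → ℝ) (S : Euc n → ENNReal), Integrable φ volume →
      MemLp e 2 volume → Metric.ball b (2 * r) ⊆ interior (simplexHull K) →
      (∀ x, φ x ≠ 0 → x ∈ Metric.ball b (2 * r)) → (∀ x, 0 ≤ φ x ∧ φ x ≤ r) →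
      (∀ x y, |φ x - φ y| ≤ κ * ‖x - y‖) → (∀ x ∈ Metric.ball b (r / 4), r / 2 ≤ φ x) →
      (∀ x ∈ interior (simplexHull K),
        ENNReal.ofReal (e x ^ 2) ≤ ENNReal.ofReal (Cq * (r / 4) ^ (2 * s)) * S x) →
      gagliardo s (fun x => (∫ x in interior (simplexHull K), e x) /
        (∫ x in interior (simplexHull K), φ x) * φ x) ≤
          ENNReal.ofReal C * ∫⁻ x in simplexHull K, S x := by
  obtain ⟨Cb, hCb, hbump⟩ := exists_gagliardo_bump_le (n := n) hn hs0 hs1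
  have hω := unitBallVol_pos n
  refine ⟨(4 * κ) ^ n * Cq * Cb * max κ 1 ^ 2 * 4 * (4 ^ n) ^ 2 /
    (unitBallVol n * 4 ^ (2 * s)), by positivity, ?_⟩
  intro 𝒯H K hK r hr b φ e S hφi he hbK hsupp hφ hLip hlow heS
  have hdK := simplexDiam_pos hn hK
  have hr0 : 0 < r := by rw [hr]; positivity
  have hKr : simplexDiam K = 2 * κ * r := by rw [hr]; field_simp
  set I := ∫ x in interior (simplexHull K), φ x
  set J := r / 2 * (unitBallVol n * (r / 4) ^ n) with hJ
  have hJ0 : 0 < J := by positivity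
  have hIJ : J ≤ I := bubble_integral_ge hr0 hφi (fun x => (hφ x).1) hbK hlow
  have h1 : ENNReal.ofReal ((∫ x in interior (simplexHull K), e x) ^ 2) ≤
      ENNReal.ofReal (unitBallVol n * (4 * κ * r) ^ n) *
        (ENNReal.ofReal (Cq * (r / 4) ^ (2 * s)) * ∫⁻ x in simplexHull K, S x) := by
    refine (ofReal_sq_setIntegral_le he (V := unitBallVol n * (4 * κ * r) ^ n)
      (isOpen_interior.measure_pos volume (interior_simplexHull_nonempty hK)).ne' ?_).trans ?_
    · refine (volume_interior_simplexHull_le hn hK).trans_eq ?_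
      rw [hKr]
      ring_nf
    · refine mul_le_mul' le_rfl ?_
      rw [← lintegral_const_mul' _ _ ENNReal.ofReal_ne_top]
      refine (setLIntegral_mono' isOpen_interior.measurableSet heS).trans ?_
      exact lintegral_mono_set interior_subset
  have h2 : gagliardo s φ ≤ ENNReal.ofReal (Cb * max κ 1 ^ 2 * r ^ n * r ^ (2 - 2 * s)) := by
    -- The slope of `φ` is at most `κ` and its oscillation at most `r`; the bump estimate wants one
    -- `L` for both.
    refine hbump φ b r (max κ 1) hr0 (by positivity) hsupp (fun x y => ?_) (fun x y => ?_)
    · refine (hLip x y).trans ?_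
      gcongr
      exact le_max_left _ _
    · have h3 : |φ x - φ y| ≤ 1 * r := by
        rw [abs_le]
        constructor <;> linarith [(hφ x).1, (hφ x).2, (hφ y).1, (hφ y).2]
      refine h3.trans ?_
      gcongr
      exact le_max_right _ _
  rw [gagliardo_const_mul]
  have h3 : ENNReal.ofReal (((∫ x in interior (simplexHull K), e x) / I) ^ 2) ≤
      ENNReal.ofReal (1 / J ^ 2) * ENNReal.ofReal ((∫ x in interior (simplexHull K), e x) ^ 2) := by
    rw [← ENNReal.ofReal_mul (by positivity), div_pow, div_mul_eq_mul_div, one_mul]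
    apply ENNReal.ofReal_le_ofReal
    gcongr
  refine (mul_le_mul' (h3.trans (mul_le_mul' le_rfl h1)) h2).trans_eq ?_
  -- All powers of `r` cancel: the squared mean error gives `r^{n+2s}`, the bump energy
  -- `r^{n+2-2s}`, and `J²` scales like `r^{2n+2}`.
  have e1 : (1 / J ^ 2) * (unitBallVol n * (4 * κ * r) ^ n) * (Cq * (r / 4) ^ (2 * s)) *
      (Cb * max κ 1 ^ 2 * r ^ n * r ^ (2 - 2 * s)) =
      (4 * κ) ^ n * Cq * Cb * max κ 1 ^ 2 * 4 * (4 ^ n) ^ 2 /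
    (unitBallVol n * 4 ^ (2 * s)) := by
    rw [hJ, Real.div_rpow hr0.le (by norm_num), sub_eq_add_neg, Real.rpow_add hr0, Real.rpow_two,
      Real.rpow_neg hr0.le, mul_pow (4 * κ), div_pow r]
    have : 0 < r ^ (2 * s) := by positivity
    have : (0 : ℝ) < 4 ^ (2 * s) := by positivity
    field_simp
    norm_num
  rw [← e1, ENNReal.ofReal_mul (p := 1 / J ^ 2 * _ * _) (by positivity),
    ENNReal.ofReal_mul (p := 1 / J ^ 2 * _) (by positivity),
    ENNReal.ofReal_mul (p := 1 / J ^ 2) (by positivity)]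
  ring

/-- The Fortin operator: mesh functions on the fine mesh with prescribed means on the elements of
the coarse mesh and controlled energy. -/
theorem exists_fortin (hn : 0 < n) (hs0 : 0 < s) (hs1 : s < 1)
    (hΩ : IsBoundedLipschitzDomain Ω) (hκ0 : 0 < κ) :
    ∃ C : ℝ, 0 < C ∧ ∀ 𝒯 𝒯H : Geometry.SimplicialComplex ℝ (EuclideanSpace ℝ (Fin n)),
      IsTriangulation 𝒯 Ω → IsTriangulation 𝒯H Ω → IsShapeRegular κ 𝒯 → IsShapeRegular κ 𝒯H →
      MeshSizeGE (8 * κ) 𝒯H 𝒯 → ∀ v : Euc n → ℝ, Measurable v →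
      MemLp v 2 volume → (∀ x, x ∉ Ω → v x = 0) → ∃ g : Euc n → ℝ, IsMeshFunction 𝒯 Ω g ∧
        (∀ K ∈ meshElements 𝒯H,
          ∫ x in interior (simplexHull K), g x = ∫ x in interior (simplexHull K), v x) ∧
        gagliardo s g ≤ ENNReal.ofReal C * gagliardo s v := by
  obtain ⟨Cq, hCq, hquasi⟩ := exists_quasiInterpolant hn hs0 hs1 hΩ hκ0
  obtain ⟨Cc, hCc, hcorr⟩ := exists_correction_le hn hs0 hs1 hκ0 hCq
  refine ⟨2 * (Cq + 2 * Cc), by positivity, fun 𝒯 𝒯H h hH hκ hκH hsize v hvm hv hv0 => ?_⟩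
  obtain ⟨g₀, hg₀, hg₀err, hg₀en⟩ := hquasi 𝒯 h hκ v hvm hv hv0
  have hbub := fun K (hK : K ∈ meshElements 𝒯H) =>
    exists_bubble hn hΩ hκ0 h hκ hH hκH hsize hK rfl
  choose! b φ hφ hbK hsupp hφr hLip hlow using hbub
  have hg₀L := hg₀.memLp hΩ
  set e : Euc n → ℝ := fun x => v x - g₀ x with he
  have heL : MemLp e 2 volume := hv.sub hg₀L
  -- Each bubble lives in the interior of its own element, so these coefficients restore the mean of
  -- `v` on every coarse element independently.
  set α : Finset (Euc n) → ℝ := fun K => (∫ x in interior (simplexHull K), e x) /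
    ∫ x in interior (simplexHull K), φ K x with hα
  have hmesh : ∀ K ∈ hH.elements, IsMeshFunction 𝒯 Ω (fun x => α K * φ K x) := fun K hK =>
    (hφ K (hH.mem_elements.1 hK)).const_mul _
  have hwmesh : IsMeshFunction 𝒯 Ω (fun x => ∑ K ∈ hH.elements, α K * φ K x) :=
    IsMeshFunction.finset_sum _ hmesh
  refine ⟨fun x => g₀ x + ∑ K ∈ hH.elements, α K * φ K x, hg₀.add hwmesh, fun K hK => ?_, ?_⟩
  · have hφint : ∀ K' ∈ meshElements 𝒯H, Integrable (φ K') volume := fun K' hK' =>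
      (hφ K' hK').integrable hΩ
    have hdK := simplexDiam_pos hn hK
    have hr0 : 0 < simplexDiam K / (2 * κ) := by positivity
    have hI := bubble_integral_ge hr0 (hφint K hK) (fun x => (hφr K hK x).1) (hbK K hK) (hlow K hK)
    have hω := unitBallVol_pos n
    have hI0 : ∫ x in interior (simplexHull K), φ K x ≠ 0 := by
      refine (lt_of_lt_of_le ?_ hI).ne'
      positivity
    have hvint : IntegrableOn v (interior (simplexHull K)) := by
      have hfm : IsFiniteMeasure (volume.restrict (interior (simplexHull K))) :=
        ⟨by
          rw [Measure.restrict_apply_univ]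
          exact (volume_interior_simplexHull_le hn hK).trans_lt ENNReal.ofReal_lt_top⟩
      exact (hv.restrict _).integrable (by norm_num)
    have hg₀int : IntegrableOn g₀ (interior (simplexHull K)) := (hg₀.integrable hΩ).integrableOn
    rw [integral_add hg₀int (hwmesh.integrable hΩ).integrableOn,
      integral_finsetSum _ fun K' hK' => ((hmesh K' hK').integrable hΩ).integrableOn,
      Finset.sum_eq_single K]
    · rw [integral_const_mul, hα]
      simp only [he]
      rw [div_mul_cancel₀ _ hI0, integral_sub hvint hg₀int]
      ring
    · intro K' hK' hne
      refine setIntegral_eq_zero_of_forall_eq_zero fun x hx => ?_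
      have hK'm := hH.mem_elements.1 hK'
      have : φ K' x = 0 := by
        by_contra hne0
        exact Set.disjoint_left.1 (disjoint_interior_simplexHull hK'm hK hne)
          (hbK K' hK'm (hsupp K' hK'm x hne0)) hx
      rw [this, mul_zero]
    · exact fun hK' => absurd (hH.mem_elements.2 hK) hK'
  · have hterm : ∀ K ∈ hH.elements, gagliardo s (fun x => α K * φ K x) ≤
        ENNReal.ofReal Cc * ∫⁻ x in simplexHull K, gagliardoAt s v x := by
      intro K hKe
      have hK := hH.mem_elements.1 hKe
      have hdK := simplexDiam_pos hn hK
      refine hcorr 𝒯H K hK _ rfl (b K) (φ K) e _ ((hφ K hK).integrable hΩ) heL (hbK K hK)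
        (hsupp K hK) (hφr K hK) (hLip K hK) (hlow K hK) fun x hx => ?_
      -- The interpolation error at `x ∈ K` is of order `h_T^{2s}` for the fine element `T`; the
      -- mesh condition turns this into the scale of `K`, at which the bubble is built.
      obtain ⟨T, hT, hxT⟩ := h.exists_mem_element hΩ.isOpen
        (hH.simplexHull_subset hK (interior_subset hx))
      have hdT := simplexDiam_pos hn hT
      have h1 := hsize.le_of_mem hK hT hx hxT
      have h2 : simplexDiam T ≤ simplexDiam K / (2 * κ) / 4 := by
        rw [div_div, le_div_iff₀ (by positivity)]
        linarith
      have h3 := hg₀err T hT x hxT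
      rw [← neg_sub, neg_sq] at h3
      refine h3.trans ?_
      gcongr
    have hwen : gagliardo s (fun x => ∑ K ∈ hH.elements, α K * φ K x) ≤
        2 * (ENNReal.ofReal Cc * gagliardo s v) := by
      refine (gagliardo_finset_sum_le hH.elements
        (fun K hK => (hmesh K hK).continuous.measurable) fun x y =>
          sq_sum_sub_le_of_disjoint hH.elements (f := fun K x => α K * φ K x) ?_ x y).trans ?_
      · intro x K hK K' hK' hne hne'
        by_contra hKK
        have hKm := hH.mem_elements.1 hK
        have hKm' := hH.mem_elements.1 hK'
        exact Set.disjoint_left.1 (disjoint_interior_simplexHull hKm hKm' hKK)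
          (hbK K hKm (hsupp K hKm x (right_ne_zero_of_mul hne)))
          (hbK K' hKm' (hsupp K' hKm' x (right_ne_zero_of_mul hne')))
      · refine mul_le_mul' le_rfl ((Finset.sum_le_sum hterm).trans ?_)
        rw [← Finset.mul_sum]
        exact mul_le_mul' le_rfl (hH.sum_setLIntegral_le _)
    refine (gagliardo_add_le hg₀.continuous.measurable hwmesh.continuous.measurable).trans ?_
    refine (mul_le_mul' le_rfl (add_le_add hg₀en hwen)).trans_eq ?_
    have e2 : ∀ x : ℝ, 0 ≤ x → ENNReal.ofReal (2 * x) = 2 * ENNReal.ofReal x := fun x hx => by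
      rw [two_mul, two_mul, ENNReal.ofReal_add hx hx]
    rw [e2 _ (by positivity), ENNReal.ofReal_add hCq.le (by positivity), e2 _ hCc.le]
    ring

end Fortin

/-! ### Transfer to the Hilbert space: coercivity and discrete lifts. -/

section Main

variable {n : ℕ} {s : ℝ} {Ω : Set (EuclideanSpace ℝ (Fin n))} {κ : ℝ}
  {𝒯 𝒯H : Geometry.SimplicialComplex ℝ (EuclideanSpace ℝ (Fin n))}

theorem IsTriangulation.ae_eq_biUnion_interior (hΩ : IsBoundedLipschitzDomain Ω)
    (h : IsTriangulation 𝒯 Ω) :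
    Ω =ᵐ[volume] ⋃ K ∈ h.elements, interior (simplexHull K) := by
  refine Filter.EventuallyLE.antisymm (ae_le_set.2 ?_) (LE.le.eventuallyLE ?_)
  · refine measure_mono_null (t := ⋃ K ∈ h.elements, simplexHull K \ interior (simplexHull K)) ?_ ?_
    · rintro x ⟨hx, hx'⟩
      obtain ⟨K, hK, hxK⟩ := h.exists_mem_element hΩ.isOpen (subset_closure hx)
      simp only [Set.mem_iUnion, not_exists] at hx' ⊢
      exact ⟨K, h.mem_elements.2 hK, hxK, hx' K (h.mem_elements.2 hK)⟩
    · exact (measure_biUnion_null_iff (Finset.countable_toSet _)).2 fun K _ =>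
        volume_diff_interior_simplexHull K
  · exact Set.iUnion₂_subset fun K hK =>
      (interior_mono (h.simplexHull_subset (h.mem_elements.1 hK))).trans
        hΩ.interior_closure_subset

theorem integrableOn_fracSobolevFun (hn : 0 < n) (v : fracSobolevZero n s Ω) {K : Finset (Euc n)}
    (hK : K ∈ meshElements 𝒯) : IntegrableOn (fracSobolevFun v) (interior (simplexHull K)) := by
  have hfm : IsFiniteMeasure (volume.restrict (interior (simplexHull K))) :=
    ⟨by
      rw [Measure.restrict_apply_univ]
      exact (volume_interior_simplexHull_le hn hK).trans_lt ENNReal.ofReal_lt_top⟩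
  exact ((memLp_fracSobolevFun v).restrict _).integrable (by norm_num)

/-- Piecewise constant functionals only see the means over the elements. -/
theorem piecewiseConstant_apply_eq (hn : 0 < n) (hΩ : IsBoundedLipschitzDomain Ω)
    (h : IsTriangulation 𝒯 Ω) {μ : StrongDual ℝ (fracSobolevZero n s Ω)}
    (hμ : μ ∈ piecewiseConstant s Ω 𝒯) {v w : fracSobolevZero n s Ω}
    (hvw : ∀ K ∈ meshElements 𝒯, ∫ x in interior (simplexHull K), fracSobolevFun v x =
      ∫ x in interior (simplexHull K), fracSobolevFun w x) : μ v = μ w := by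
  obtain ⟨g, hg, hμg⟩ := hμ
  have key : ∀ v : fracSobolevZero n s Ω, μ v = ∑ K ∈ h.elements,
      ∫ x in interior (simplexHull K), g x * fracSobolevFun v x := by
    intro v
    rw [hμg v, setIntegral_congr_set (h.ae_eq_biUnion_interior hΩ), integral_biUnion_finset]
    · exact fun K _ => isOpen_interior.measurableSet
    · intro K hK K' hK' hne
      exact disjoint_interior_simplexHull (h.mem_elements.1 hK) (h.mem_elements.1 hK') hne
    · intro K hK
      obtain ⟨c, hc⟩ := hg K (h.mem_elements.1 hK)
      exact IntegrableOn.congr_fun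
        ((integrableOn_fracSobolevFun hn v (h.mem_elements.1 hK)).const_mul c)
        (fun x hx => by rw [hc x hx]) isOpen_interior.measurableSet
  rw [key v, key w]
  refine Finset.sum_congr rfl fun K hK => ?_
  obtain ⟨c, hc⟩ := hg K (h.mem_elements.1 hK)
  have hconst : ∀ v : fracSobolevZero n s Ω,
      ∫ x in interior (simplexHull K), g x * fracSobolevFun v x =
        c * ∫ x in interior (simplexHull K), fracSobolevFun v x := by
    intro v
    rw [← integral_const_mul]
    exact setIntegral_congr_fun isOpen_interior.measurableSet fun x hx => by rw [hc x hx]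
  rw [hconst, hconst, hvw K (h.mem_elements.1 hK)]

/-- A representative that vanishes everywhere outside the domain. -/
theorem exists_representative (hΩ : MeasurableSet Ω) (v : fracSobolevZero n s Ω) :
    ∃ v' : Euc n → ℝ, Measurable v' ∧ MemLp v' 2 volume ∧ (∀ x, x ∉ Ω → v' x = 0) ∧
      fracSobolevFun v =ᵐ[volume] v' := by
  have hae : fracSobolevFun v =ᵐ[volume] Ω.indicator (fracSobolevFun v) := by
    filter_upwards [fracSobolevFun_ae_zero v] with x hx
    by_cases hxΩ : x ∈ Ω
    · rw [Set.indicator_of_mem hxΩ]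
    · rw [Set.indicator_of_notMem hxΩ, hx hxΩ]
  exact ⟨Ω.indicator (fracSobolevFun v), (measurable_fracSobolevFun v).indicator hΩ,
    (memLp_fracSobolevFun v).ae_eq hae, fun x hx => Set.indicator_of_notMem hx _, hae⟩

theorem exists_norm_sq_le_norm_snd_sq (hn : 0 < n) (hs0 : 0 < s)
    (hΩ : IsBoundedLipschitzDomain Ω) :
    ∃ C : ℝ, 0 < C ∧ ∀ v : fracSobolevZero n s Ω,
      ‖v‖ ^ 2 ≤ C * ‖(v : FracAmbient n).snd‖ ^ 2 := by
  obtain ⟨C, hC, hP⟩ := exists_poincare hn hΩ hs0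
  refine ⟨C + 1, by positivity, fun v => ?_⟩
  obtain ⟨v', _, hL, h0, hae⟩ := exists_representative hΩ.isOpen.measurableSet v
  rw [← ENNReal.ofReal_le_ofReal_iff (by positivity), ofReal_norm_sq_fracSobolevZero,
    ENNReal.ofReal_mul (by positivity), ofReal_norm_snd_sq,
    ENNReal.ofReal_add hC.le zero_le_one, ENNReal.ofReal_one, add_mul, one_mul]
  gcongr
  rw [gagliardo_congr_ae s hae, lintegral_congr_ae (g := fun x => ENNReal.ofReal (v' x ^ 2))
    (by filter_upwards [hae] with x hx; rw [hx])]
  exact hP v' hL h0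

/-- The Fortin operator on `H^s_0`, tested with piecewise constant functionals. -/
theorem exists_discrete_lift (hn : 0 < n) (hs0 : 0 < s) (hs1 : s < 1)
    (hΩ : IsBoundedLipschitzDomain Ω) (hκ0 : 0 < κ) :
    ∃ C : ℝ, 0 < C ∧ ∀ 𝒯 𝒯H : Geometry.SimplicialComplex ℝ (EuclideanSpace ℝ (Fin n)),
      IsTriangulation 𝒯 Ω → IsTriangulation 𝒯H Ω → IsShapeRegular κ 𝒯 → IsShapeRegular κ 𝒯H →
      MeshSizeGE (8 * κ) 𝒯H 𝒯 → ∀ v : fracSobolevZero n s Ω,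
      ∃ vh ∈ piecewiseLinear s Ω 𝒯, ‖vh‖ ≤ C * ‖v‖ ∧
        ∀ μ ∈ piecewiseConstant s Ω 𝒯H, μ v = μ vh := by
  obtain ⟨CF, hCF, hF⟩ := exists_fortin hn hs0 hs1 hΩ hκ0
  obtain ⟨CP, hCP, hP⟩ := exists_poincare hn hΩ hs0
  have hCC : 0 < (CP + 1) * CF := by positivity
  refine ⟨√((CP + 1) * CF), Real.sqrt_pos.2 hCC, fun 𝒯 𝒯H h hH hκ hκH hsize v => ?_⟩
  obtain ⟨v', hm, hL, h0, hae⟩ := exists_representative hΩ.isOpen.measurableSet v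
  obtain ⟨g, hg, hmean, hen⟩ := hF 𝒯 𝒯H h hH hκ hκH hsize v' hm hL h0
  have hbound : (∫⁻ x, ENNReal.ofReal (g x ^ 2)) + gagliardo s g ≤
      ENNReal.ofReal ((CP + 1) * CF * ‖v‖ ^ 2) := by
    -- The Fortin operator controls only the seminorm; Poincaré for `g` itself supplies the `L²`
    -- part.
    calc _ ≤ ENNReal.ofReal CP * gagliardo s g + gagliardo s g := by
          gcongr
          exact hP g (hg.memLp hΩ) hg.eq_zero
      _ = ENNReal.ofReal (CP + 1) * gagliardo s g := by
          rw [ENNReal.ofReal_add hCP.le zero_le_one, ENNReal.ofReal_one, add_mul, one_mul]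
      _ ≤ ENNReal.ofReal (CP + 1) * (ENNReal.ofReal CF * ENNReal.ofReal (‖v‖ ^ 2)) := by
          gcongr
          refine hen.trans (mul_le_mul' le_rfl ?_)
          rw [← gagliardo_congr_ae s hae, ofReal_norm_sq_fracSobolevZero]
          exact le_add_self
      _ = _ := by
          rw [← ENNReal.ofReal_mul hCF.le, ← ENNReal.ofReal_mul (by positivity), mul_assoc]
  obtain ⟨vh, hvh, hvhn⟩ := exists_fracSobolevZero_of_energy (s := s) (Ω := Ω)
    hg.continuous.measurable hg.eq_zero (by positivity) hbound
  refine ⟨vh, ⟨g, hg.continuous, hg.eq_zero, hg.affine, hvh⟩, ?_, fun μ hμ => ?_⟩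
  · refine le_of_sq_le_sq ?_ (by positivity)
    rw [mul_pow, Real.sq_sqrt hCC.le]
    exact hvhn
  · refine piecewiseConstant_apply_eq hn hΩ hH hμ fun K hK => ?_
    rw [setIntegral_congr_ae (g := v') isOpen_interior.measurableSet
        (hae.mono fun x hx _ => hx), ← hmean K hK]
    exact (setIntegral_congr_ae isOpen_interior.measurableSet (hvh.mono fun x hx _ => hx)).symm

theorem exists_fracForm_coercive (hn : 0 < n) (hs0 : 0 < s) (hs1 : s < 1)
    (hΩ : IsBoundedLipschitzDomain Ω) :
    ∃ m : ℝ, 0 < m ∧ ∀ v : fracSobolevZero n s Ω, m * ‖v‖ ^ 2 ≤ fracForm v v := by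
  obtain ⟨CP, hCP, hcoer⟩ := exists_norm_sq_le_norm_snd_sq (s := s) hn hs0 hΩ
  have hγ0 : 0 < fracConst n s / 2 := by have := fracConst_pos (n := n) hs0 hs1; positivity
  refine ⟨fracConst n s / 2 / CP, by positivity, fun v => ?_⟩
  rw [fracForm_eq, real_inner_self_eq_norm_sq, div_mul_eq_mul_div, div_le_iff₀ hCP, mul_assoc]
  refine mul_le_mul_of_nonneg_left ((hcoer v).trans_eq ?_) hγ0.le
  rw [mul_comm]

/-- Young's inequality: the two products containing `e` absorb a quarter of `m e²` each, and half of
it remains. -/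
theorem sq_le_of_quadratic_le {m γ e X Y D : ℝ} (hm : 0 < m)
    (h : m * e ^ 2 ≤ γ * (e * X) + D * X + D * e) :
    e ^ 2 ≤ 2 / m * (γ ^ 2 / m + 1 / m + 1) * (X ^ 2 + Y ^ 2 + D ^ 2) := by
  have y1 : γ * (e * X) ≤ m / 4 * e ^ 2 + γ ^ 2 / m * X ^ 2 := by
    have h0 : 0 ≤ 1 / m * (m / 2 * e - γ * X) ^ 2 := by positivity
    have e3 : 1 / m * (m / 2 * e - γ * X) ^ 2 =
        m / 4 * e ^ 2 + γ ^ 2 / m * X ^ 2 - γ * (e * X) := by field_simp; ring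
    linarith
  have y2 : D * e ≤ m / 4 * e ^ 2 + 1 / m * D ^ 2 := by
    have h0 : 0 ≤ 1 / m * (m / 2 * e - D) ^ 2 := by positivity
    have e3 : 1 / m * (m / 2 * e - D) ^ 2 = m / 4 * e ^ 2 + 1 / m * D ^ 2 - D * e := by
      field_simp; ring
    linarith
  have y3 : D * X ≤ D ^ 2 + X ^ 2 := by nlinarith [sq_nonneg (D - X), sq_nonneg D, sq_nonneg X]
  have h7 : m / 2 * e ^ 2 ≤ (γ ^ 2 / m + 1 / m + 1) * (X ^ 2 + Y ^ 2 + D ^ 2) := by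
    have q1 : 0 ≤ γ ^ 2 / m * D ^ 2 := by positivity
    have q2 : 0 ≤ 1 / m * X ^ 2 := by positivity
    have q3 : 0 ≤ (γ ^ 2 / m + 1 / m + 1) * Y ^ 2 := by positivity
    linarith
  have h8 : 2 / m * (m / 2 * e ^ 2) = e ^ 2 := by field_simp
  rw [← h8, mul_assoc (2 / m)]
  gcongr

theorem IsMixedSolution.fracForm_sub_eq {W : Set (fracSobolevZero n s Ω)}
    {Λ ΛH : Set (StrongDual ℝ (fracSobolevZero n s Ω))}
    {f lam lamH : StrongDual ℝ (fracSobolevZero n s Ω)} {w u uh z : fracSobolevZero n s Ω}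
    (hu : IsMixedSolution Set.univ Λ f w u lam) (huh : IsMixedSolution W ΛH f w uh lamH)
    (hz : z ∈ W) : fracForm (u - uh) z = lamH z - lam z := by
  have h1 := hu.equation z (Set.mem_univ z)
  have h2 := huh.equation z hz
  rw [fracForm_sub_left]
  linarith

theorem multiplier_error_le {γ C e Y Z D : ℝ} (hγ : 0 ≤ γ) (hC : 0 ≤ C) (he : 0 ≤ e) (hY : 0 ≤ Y)
    (hD : D ≤ Y + Z) (hZ : Z ≤ C * (γ * e + Y)) : D ≤ (1 + C * (1 + γ)) * (e + Y) := by
  have q1 : 0 ≤ C * γ * Y := by positivity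
  have q2 : 0 ≤ (1 + C) * e := by positivity
  linarith

end Main

/-! ### The abstract error estimates and the conclusion. -/

section Abstract

variable {E : Type*} [NormedAddCommGroup E] [NormedSpace ℝ E] {a : E → E → ℝ} {m γ : ℝ}

/-- Write `u - u_h = (u - v_h) + (v_h - u_h)` in the second argument of `a`; the error equation
replaces the second part by the multiplier error, tested with `u - v_h` and `u - u_h`. -/
theorem norm_sub_sq_le_of_galerkin (hm : 0 < m) (hcoer : ∀ v, m * ‖v‖ ^ 2 ≤ a v v)
    (hbd : ∀ u v, |a u v| ≤ γ * (‖u‖ * ‖v‖)) (hsub : ∀ u v w, a u (v - w) = a u v - a u w)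
    {lam lamH μH : StrongDual ℝ E} {u uh vh : E}
    (huh : a (u - uh) uh = lamH uh - lam uh) (hvh : a (u - uh) vh = lamH vh - lam vh) :
    ‖u - uh‖ ^ 2 ≤ 2 / m * (γ ^ 2 / m + 1 / m + 1) *
      (‖u - vh‖ ^ 2 + ‖lam - μH‖ ^ 2 + ‖lam - lamH‖ ^ 2) := by
  refine sq_le_of_quadratic_le hm ((hcoer _).trans ?_)
  have h1 : a (u - uh) (u - uh) =
      a (u - uh) (u - vh) + (lam - lamH) (u - vh) - (lam - lamH) (u - uh) := by
    rw [hsub _ u uh, hsub _ u vh, huh, hvh]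
    simp only [map_sub, sub_apply]
    ring
  have h2 := (le_abs_self _).trans (hbd (u - uh) (u - vh))
  have h3 := (le_abs_self _).trans ((lam - lamH).le_opNorm (u - vh))
  have h4 := (neg_le_abs _).trans ((lam - lamH).le_opNorm (u - uh))
  rw [h1]
  linarith

/-- Fortin's trick: `λ_H - μ_H` takes the same value at `v` and at its lift `z`, and there it equals
`a(u - u_h, z) + ⟨λ - μ_H, z⟩`. The triangle inequality through `μ_H` concludes. -/
theorem norm_multiplier_sub_le_of_lift (hγ : 0 ≤ γ) (hbd : ∀ u v, |a u v| ≤ γ * (‖u‖ * ‖v‖))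
    {C : ℝ} (hC : 0 ≤ C) {W : Set E} {lam lamH μH : StrongDual ℝ E} {u uh : E}
    (hgal : ∀ z ∈ W, a (u - uh) z = lamH z - lam z)
    (hlift : ∀ v, ∃ z ∈ W, ‖z‖ ≤ C * ‖v‖ ∧ lamH v = lamH z ∧ μH v = μH z) :
    ‖lam - lamH‖ ≤ (1 + C * (1 + γ)) * (‖u - uh‖ + ‖lam - μH‖) := by
  refine multiplier_error_le hγ hC (norm_nonneg _) (norm_nonneg _)
    (norm_sub_le_norm_sub_add_norm_sub lam μH lamH) ?_
  rw [norm_sub_rev]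
  refine ContinuousLinearMap.opNorm_le_bound _ (by positivity) fun v => ?_
  obtain ⟨z, hz, hzn, hz1, hz2⟩ := hlift v
  have e1 : (lamH - μH) v = a (u - uh) z + (lam - μH) z := by
    rw [hgal z hz, sub_apply, sub_apply, hz1, hz2]
    ring
  rw [e1, Real.norm_eq_abs]
  calc |a (u - uh) z + (lam - μH) z| ≤ |a (u - uh) z| + |(lam - μH) z| := abs_add_le _ _
    _ ≤ γ * (‖u - uh‖ * ‖z‖) + ‖lam - μH‖ * ‖z‖ :=
        add_le_add (hbd _ _) ((lam - μH).le_opNorm z)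
    _ = (γ * ‖u - uh‖ + ‖lam - μH‖) * ‖z‖ := by ring
    _ ≤ (γ * ‖u - uh‖ + ‖lam - μH‖) * (C * ‖v‖) :=
        mul_le_mul_of_nonneg_left hzn (by positivity)
    _ = _ := by ring

end Abstract

theorem mainTheorem8 (n : ℕ) (hn : 0 < n) (s : ℝ) (hs0 : 0 < s) (hs1 : s < 1)
    (Ω : Set (EuclideanSpace ℝ (Fin n))) (hΩ : IsBoundedLipschitzDomain Ω) :
    ∃ C₁ : ℝ, 0 < C₁ ∧ ∀ κ : ℝ, 0 < κ → ∃ C₀ C₂ : ℝ, 0 < C₀ ∧ 0 < C₂ ∧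
      ∀ 𝒯h 𝒯H : Geometry.SimplicialComplex ℝ (EuclideanSpace ℝ (Fin n)),
        IsTriangulation 𝒯h Ω → IsTriangulation 𝒯H Ω →
        IsShapeRegular κ 𝒯h → IsShapeRegular κ 𝒯H →
      ∀ Λ ΛH : Set (StrongDual ℝ (fracSobolevZero n s Ω)),
        IsClosed Λ → Convex ℝ Λ → IsClosed ΛH → Convex ℝ ΛH →
        ΛH ⊆ piecewiseConstant s Ω 𝒯H → ΛH ⊆ Λ →
      ∀ (f : StrongDual ℝ (fracSobolevZero n s Ω)) (w u uh : fracSobolevZero n s Ω)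
        (lam lamH : StrongDual ℝ (fracSobolevZero n s Ω)),
        IsMixedSolution Set.univ Λ f w u lam →
        IsMixedSolution (piecewiseLinear s Ω 𝒯h) ΛH f w uh lamH →
      ∀ vh ∈ piecewiseLinear s Ω 𝒯h, ∀ μH ∈ ΛH,
        ‖u - uh‖ ^ 2 ≤ C₁ * (‖u - vh‖ ^ 2 + ‖lam - μH‖ ^ 2 + ‖lam - lamH‖ ^ 2) ∧
        (MeshSizeGE C₀ 𝒯H 𝒯h →
          ‖lam - lamH‖ ≤ C₂ * (‖u - uh‖ + ‖lam - μH‖)) := by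
  refine (exists_fracForm_coercive (s := s) hn hs0 hs1 hΩ).elim fun m hm => ?_
  have hγ0 : 0 < fracConst n s / 2 := half_pos (fracConst_pos (n := n) hs0 hs1)
  have hm0 := hm.1
  refine ⟨2 / m * ((fracConst n s / 2) ^ 2 / m + 1 / m + 1), by positivity, fun κ hκ0 => ?_⟩
  refine (exists_discrete_lift hn hs0 hs1 hΩ hκ0).elim fun CF hCF => ?_
  have hCF0 := hCF.1
  refine ⟨8 * κ, 1 + CF * (1 + fracConst n s / 2), by positivity, by positivity, ?_⟩
  intro 𝒯h 𝒯H hh hH hκh hκH Λ ΛH _ _ _ _ hΛM _ f w u uh lam lamH hu huh vh hvh μH hμH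
  have hgal : ∀ z ∈ piecewiseLinear s Ω 𝒯h, fracForm (u - uh) z = lamH z - lam z :=
    fun z hz => hu.fracForm_sub_eq huh hz
  refine ⟨norm_sub_sq_le_of_galerkin hm.1 hm.2 (abs_fracForm_le hs0 hs1) fracForm_sub_right
    (hgal uh huh.mem_space) (hgal vh hvh), fun hsize => ?_⟩
  refine norm_multiplier_sub_le_of_lift hγ0.le (abs_fracForm_le hs0 hs1) hCF.1.le hgal fun v => ?_
  obtain ⟨z, hz, hzn, hzμ⟩ := hCF.2 𝒯h 𝒯H hh hH hκh hκH hsize v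
  exact ⟨z, hz, hzn, hzμ lamH (hΛM huh.mem_multipliers), hzμ μH (hΛM hμH)⟩
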